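/- Smoothness ($C^\infty$) of maps between open subsets of real Hausdorff locally convex spaces is understood in the sense of Keller's $C^\infty_c$-theory (all iterated directional derivatives exist and are jointly continuous in the point and the directions); manifolds and Lie groups modelled on locally convex spaces are defined accordingly. For $p\in[1,\infty]$ and a locally convex space $E$, $\mathcal L^p([0,1],E)$ is the space of Lusin measurable functions $\gamma\colon[0,1]\to E$ with $\|q\circ\gamma\|_{\mathcal L^p}<\infty$ for every continuous seminorm $q$ on $E$, and $L^p([0,1],E)$ is the space of classes $[\gamma]$ modulo equality almost everywhere, with the locally convex topology given by the seminorms $\|[\gamma]\|_{L^p,q}:=\|q\circ\gamma\|_{\mathcal L^p}$. Let $G$ be a Lie group modelled on a sequentially complete locally convex space, with neutral element $e$ and Lie algebra $\mathfrak g=T_eG$; for $g\in G$ and $v\in\mathfrak g$ write $g.v:=T\lambda_g(v)\in T_gG$, where $\lambda_g(h)=gh$. An evolution of $\gamma\in\mathcal L^p([0,1],\mathfrak g)$ is a Carathéodory solution $\eta\colon[0,1]\to G$ of $$\dot y(t)=y(t).\gamma(t),\qquad y(0)=e,$$ that is, $\eta(0)=e$ and there is a subdivision $0=t_0<\dots<t_m=1$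 such that each $\eta([t_{j-1},t_j])$ lies in the domain of a chart $\phi$ for which $\phi\circ\eta|_{[t_{j-1},t_j]}$ is a primitive (with respect to weak integrals) of an $\mathcal L^1$-function that equals $t\mapsto d\phi(\eta(t).\gamma(t))$ almost everywhere. An evolution is unique if it exists, depends only on $[\gamma]$, and is denoted $\operatorname{Evol}([\gamma])$. The group $G$ is called $L^p$-semiregular if every $\gamma\in\mathcal L^p([0,1],\mathfrak g)$ has an evolution. It is called $L^p$-regular if, moreover, $\operatorname{Evol}\colon L^p([0,1],\mathfrak g)\to C([0,1],G)$ is smooth. Here $C([0,1],G)$ carries the compact-open topology and its usual Lie group structure modelled on $C([0,1],\mathfrak g)$, whose charts are $\zeta\mapsto\phi\circ(\eta^{-1}\zeta)$ for $\eta\in C([0,1],G)$ and charts $\phi$ of $G$ around $e$, defined on the set of those $\zeta$ for which $\eta^{-1}\zeta$ takes values in the domain of $\phi$. **Theorem.** Let $G$ be a Lie group modelled on a sequentially complete locally convex space, with Lie algebra $\mathfrak g=T_eG$, and let $p\in[1,\infty]$. If $G$ is $L^p$-semiregular and $\operatorname{Evol}\colon L^p([0,1],\mathfrak g)\to C([0,1],G)$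 is continuous at $0$, then $G$ is $L^p$-regular. -/

import Mathlib

open Set Filter Topology MeasureTheory
open scoped ENNReal Manifold

/-! ### Calculus in locally convex spaces -/

section Calculus

variable {E F : Type*} [AddCommGroup E] [Module ℝ E] [TopologicalSpace E]
  [AddCommGroup F] [Module ℝ F] [TopologicalSpace F]

/-- Sequential completeness of a topological vector space: every Cauchy sequence converges. -/
def IsSeqComplete (E : Type*) [AddCommGroup E] [TopologicalSpace E] : Prop :=
  ∀ u : ℕ → E, (∀ U ∈ 𝓝 (0 : E), ∃ N, ∀ m ≥ N, ∀ n ≥ N, u m - u n ∈ U) →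
    ∃ a, Tendsto u atTop (𝓝 a)

/-- `v` is the directional derivative of `f` at `x` in the direction `y`. -/
def HasDirDerivAt (f : E → F) (x y : E) (v : F) : Prop :=
  Tendsto (fun t : ℝ => t⁻¹ • (f (x + t • y) - f x)) (𝓝[≠] 0) (𝓝 v)

/-- Smoothness on an open set `U` in the sense of Keller's `C^∞_c`-theory: all iterated directional
derivatives `d j x (y₁, …, yⱼ) = (D_{yⱼ} ⋯ D_{y₁} f)(x)` exist and are continuous on `U × Eʲ`. -/
def KellerSmoothOn (f : E → F) (U : Set E) : Prop :=
  ∃ d : (j : ℕ) → E → (Fin j → E) → F,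
    (∀ x ∈ U, ∀ y, d 0 x y = f x) ∧
    (∀ j, ∀ x ∈ U, ∀ y : Fin (j + 1) → E,
      HasDirDerivAt (fun x' => d j x' (Fin.init y)) x (y (Fin.last j)) (d (j + 1) x y)) ∧
    (∀ j, ContinuousOn (fun z : E × (Fin j → E) => d j z.1 z.2) (U ×ˢ univ))

end Calculus

/-! ### Manifolds and Lie groups modelled on locally convex spaces -/

section LieGroups

/-- Smooth maps between manifolds `M`, `N` modelled on `E`, `F`: continuous, and smooth in charts. -/
def KellerSmooth (E F : Type*) [AddCommGroup E] [Module ℝ E] [TopologicalSpace E]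
    [AddCommGroup F] [Module ℝ F] [TopologicalSpace F]
    {M N : Type*} [TopologicalSpace M] [ChartedSpace E M] [TopologicalSpace N] [ChartedSpace F N]
    (f : M → N) : Prop :=
  Continuous f ∧ ∀ φ ∈ atlas E M, ∀ ψ ∈ atlas F N,
    KellerSmoothOn (fun x => ψ (f (φ.symm x))) (φ.target ∩ {x | f (φ.symm x) ∈ ψ.source})

/-- `G` is a Lie group modelled on the topological vector space `E`: a smooth manifold (the
transition maps between charts are smooth) with smooth multiplication and inversion. -/
class KellerLieGroup (E G : Type*) [AddCommGroup E] [Module ℝ E] [TopologicalSpace E]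
    [Group G] [TopologicalSpace G] [ChartedSpace E G] : Prop where
  smooth_transition : ∀ φ ∈ atlas E G, ∀ ψ ∈ atlas E G,
    KellerSmoothOn (φ.symm ≫ₕ ψ : OpenPartialHomeomorph E E) (φ.symm ≫ₕ ψ).source
  smooth_mul :
    letI : ChartedSpace (E × E) (G × G) := prodChartedSpace E G E G
    KellerSmooth (E × E) E (fun g : G × G => g.1 * g.2)
  smooth_inv : KellerSmooth E E (fun g : G => g⁻¹)

end LieGroups

/-! ### The Lie group `C([0,1], G)` -/

section MappingGroup

open Classical in
/-- Postcomposition with a homeomorphism `φ : U → V` between open sets, as a homeomorphism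
`C(K, U) → C(K, V)` between open subsets of `C(K, X)` and `C(K, Y)`.
Outside these sets it takes the irrelevant constant values `y₀`, `x₀`. -/
noncomputable def postcompHomeo (K : Type*) [TopologicalSpace K] [CompactSpace K] [T2Space K]
    {X Y : Type*} [TopologicalSpace X] [TopologicalSpace Y]
    (φ : OpenPartialHomeomorph X Y) (x₀ : X) (y₀ : Y) :
    OpenPartialHomeomorph C(K, X) C(K, Y) where
  toFun ζ := if h : ∀ t, ζ t ∈ φ.source
    then ⟨fun t => φ (ζ t), φ.continuousOn.comp_continuous ζ.continuous h⟩
    else ContinuousMap.const K y₀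
  invFun ξ := if h : ∀ t, ξ t ∈ φ.target
    then ⟨fun t => φ.symm (ξ t), φ.symm.continuousOn.comp_continuous ξ.continuous h⟩
    else ContinuousMap.const K x₀
  source := {ζ | ∀ t, ζ t ∈ φ.source}
  target := {ξ | ∀ t, ξ t ∈ φ.target}
  map_source' ζ hζ := by
    have hζ' : ∀ t, ζ t ∈ φ.source := hζ
    intro t
    simp only [dif_pos hζ']
    exact φ.map_source (hζ' t)
  map_target' ξ hξ := by
    have hξ' : ∀ t, ξ t ∈ φ.target := hξ
    intro t
    simp only [dif_pos hξ']
    exact φ.map_target (hξ' t)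
  left_inv' ζ hζ := by
    have hζ' : ∀ t, ζ t ∈ φ.source := hζ
    ext t
    simp [hζ', fun t => φ.map_source (hζ' t)]
  right_inv' ξ hξ := by
    have hξ' : ∀ t, ξ t ∈ φ.target := hξ
    ext t
    simp [hξ', fun t => φ.map_target (hξ' t)]
  open_source := by
    have := ContinuousMap.isOpen_setOfPred_mapsTo (X := K) (Y := X) isCompact_univ φ.open_source
    simpa [MapsTo] using this
  open_target := by
    have := ContinuousMap.isOpen_setOfPred_mapsTo (X := K) (Y := Y) isCompact_univ φ.open_target
    simpa [MapsTo] using this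
  continuousOn_toFun := by
    rw [continuousOn_iff_continuous_domRestrict]
    refine ContinuousMap.continuous_of_continuous_uncurry _ ?_
    have h : Continuous fun z : {ζ : C(K, X) | ∀ t, ζ t ∈ φ.source} × K => φ (z.1.1 z.2) :=
      φ.continuousOn.comp_continuous (by fun_prop) fun z => z.1.2 z.2
    refine h.congr fun z => ?_
    have hz : ∀ t, z.1.1 t ∈ φ.source := z.1.2
    simp [Function.uncurry, hz]
  continuousOn_invFun := by
    rw [continuousOn_iff_continuous_domRestrict]
    refine ContinuousMap.continuous_of_continuous_uncurry _ ?_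
    have h : Continuous fun z : {ξ : C(K, Y) | ∀ t, ξ t ∈ φ.target} × K => φ.symm (z.1.1 z.2) :=
      φ.symm.continuousOn.comp_continuous (by fun_prop) fun z => z.1.2 z.2
    refine h.congr fun z => ?_
    have hz : ∀ t, z.1.1 t ∈ φ.target := z.1.2
    simp [Function.uncurry, hz]

variable {E G : Type*} [AddCommGroup E] [TopologicalSpace E]
  [Group G] [TopologicalSpace G] [IsTopologicalGroup G] [ChartedSpace E G]

/-- The chart `ζ ↦ φ ∘ (η⁻¹ ζ)` of the mapping group `C([0,1], G)` around `η`, where `φ` is a chart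
of `G` around the neutral element; its domain consists of the `ζ` with `η⁻¹ ζ ∈ C([0,1], U_φ)`. -/
noncomputable def mappingChart (φ : OpenPartialHomeomorph G E) (η : C(unitInterval, G)) :
    OpenPartialHomeomorph C(unitInterval, G) C(unitInterval, E) :=
  (Homeomorph.mulLeft η⁻¹).toOpenPartialHomeomorph ≫ₕ postcompHomeo unitInterval φ 1 0

/-- The manifold structure of the mapping group `C([0,1], G)` (with the compact-open topology),
modelled on `C([0,1], E)`. -/
noncomputable instance mappingGroupChartedSpace :
    ChartedSpace C(unitInterval, E) C(unitInterval, G) where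
  atlas := {Φ | ∃ φ ∈ atlas E G, (1 : G) ∈ φ.source ∧ ∃ η, Φ = mappingChart φ η}
  chartAt η := mappingChart (chartAt E 1) η
  mem_chart_source η := by
    simp [mappingChart, postcompHomeo]
  chart_mem_atlas η := ⟨chartAt E 1, chart_mem_atlas E 1, mem_chart_source E 1, η, rfl⟩

end MappingGroup

/-! ### Lebesgue spaces of vector-valued functions -/

section Lebesgue

variable {E : Type*} [AddCommGroup E] [Module ℝ E] [TopologicalSpace E]

/-- Lusin measurability on `I ⊆ ℝ` of a function with values in a topological space. -/
def LusinMeasurableOn {X : Type*} [TopologicalSpace X] (γ : ℝ → X) (I : Set ℝ) : Prop :=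
  ∃ K : ℕ → Set ℝ, (∀ j, IsCompact (K j) ∧ K j ⊆ I ∧ ContinuousOn γ (K j)) ∧
    volume (I \ ⋃ j, K j) = 0

/-- `γ|_I` is an `ℒ^p`-function: Lusin measurable, and `q ∘ γ` has finite `ℒ^p`-norm on `I` for each
continuous seminorm `q` on `E`. -/
def MemLusinLp (p : ℝ≥0∞) (γ : ℝ → E) (I : Set ℝ) : Prop :=
  LusinMeasurableOn γ I ∧ ∀ q : Seminorm ℝ E, Continuous q →
    eLpNorm (fun t => q (γ t)) p (volume.restrict I) < ∞

theorem LusinMeasurableOn.aestronglyMeasurable {f : ℝ → ℝ} {I : Set ℝ}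
    (hf : LusinMeasurableOn f I) : AEStronglyMeasurable f (volume.restrict I) := by
  obtain ⟨K, hK, h0⟩ := hf
  have h1 : AEStronglyMeasurable f (volume.restrict (⋃ j, K j)) := by
    rw [aestronglyMeasurable_iUnion_iff]
    exact fun j => (hK j).2.2.aestronglyMeasurable (hK j).1.measurableSet
  refine h1.mono_measure (Measure.restrict_mono_ae ?_)
  have : ∀ᵐ t, t ∉ I \ ⋃ j, K j := measure_eq_zero_iff_ae_notMem.1 h0
  filter_upwards [this] with t ht hI
  by_contra h
  exact ht ⟨hI, h⟩

theorem LusinMeasurableOn.comp {X Y : Type*} [TopologicalSpace X] [TopologicalSpace Y]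
    {γ : ℝ → X} {I : Set ℝ} (h : LusinMeasurableOn γ I) {f : X → Y} (hf : Continuous f) :
    LusinMeasurableOn (fun t => f (γ t)) I := by
  obtain ⟨K, hK, h0⟩ := h
  exact ⟨K, fun j => ⟨(hK j).1, (hK j).2.1, hf.comp_continuousOn (hK j).2.2⟩, h0⟩

theorem LusinMeasurableOn.add [IsTopologicalAddGroup E] {γ δ : ℝ → E} {I : Set ℝ}
    (h : LusinMeasurableOn γ I) (h' : LusinMeasurableOn δ I) : LusinMeasurableOn (γ + δ) I := by
  obtain ⟨K, hK, h0⟩ := h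
  obtain ⟨L, hL, h0'⟩ := h'
  refine ⟨fun n => K n.unpair.1 ∩ L n.unpair.2, fun n => ⟨?_, ?_, ?_⟩, ?_⟩
  · exact (hK _).1.inter (hL _).1
  · exact inter_subset_left.trans (hK _).2.1
  · exact ((hK _).2.2.mono inter_subset_left).add ((hL _).2.2.mono inter_subset_right)
  · refine measure_mono_null ?_ (measure_union_null h0 h0')
    rintro t ⟨hI, ht⟩
    by_contra hc
    simp only [mem_union, Set.mem_sdiff, mem_iUnion, not_or, not_and, not_not] at hc ht
    obtain ⟨i, hi⟩ := hc.1 hI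
    obtain ⟨j, hj⟩ := hc.2 hI
    exact ht ⟨Nat.pair i j, by simpa using ⟨hi, hj⟩⟩

theorem MemLusinLp.memLp {p : ℝ≥0∞} {γ : ℝ → E} {I : Set ℝ} (h : MemLusinLp p γ I)
    (q : Seminorm ℝ E) (hq : Continuous q) : MemLp (fun t => q (γ t)) p (volume.restrict I) :=
  ⟨(h.1.comp hq).aestronglyMeasurable, h.2 q hq⟩

variable [IsTopologicalAddGroup E] [ContinuousSMul ℝ E]

/-- The vector space `ℒ^p([0,1], E)`; functions are represented by arbitrary extensions to `ℝ`, whose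
values outside `[0,1]` are irrelevant. -/
def LpFun (p : ℝ≥0∞) (E : Type*) [AddCommGroup E] [Module ℝ E] [TopologicalSpace E]
    [IsTopologicalAddGroup E] [ContinuousSMul ℝ E] : Submodule ℝ (ℝ → E) where
  carrier := {γ | MemLusinLp p γ (Icc 0 1)}
  zero_mem' := by
    refine ⟨⟨fun _ => Icc 0 1, fun _ => ⟨isCompact_Icc, Subset.rfl, continuousOn_const⟩, ?_⟩, ?_⟩
    · rw [iUnion_const, sdiff_self]
      exact measure_empty
    · intro q _
      simp
  add_mem' := by
    intro γ δ hγ hδ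
    refine ⟨hγ.1.add hδ.1, fun q hq => ?_⟩
    refine lt_of_le_of_lt (eLpNorm_mono_real fun t => ?_)
      ((hγ.memLp q hq).add (hδ.memLp q hq)).2
    simpa [abs_of_nonneg (apply_nonneg q _)] using map_add_le_add q (γ t) (δ t)
  smul_mem' := by
    intro c γ hγ
    refine ⟨hγ.1.comp (continuous_const_smul c), fun q hq => ?_⟩
    have h : (fun t => q ((c • γ) t)) = ‖c‖ • fun t => q (γ t) := by
      ext t
      simp [map_smul_eq_mul]
    rw [h]
    exact ((hγ.memLp q hq).const_smul ‖c‖).2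

/-- The `ℒ^p`-functions on `[0,1]` which vanish almost everywhere. -/
def LpNull (p : ℝ≥0∞) (E : Type*) [AddCommGroup E] [Module ℝ E] [TopologicalSpace E]
    [IsTopologicalAddGroup E] [ContinuousSMul ℝ E] : Submodule ℝ (LpFun p E) where
  carrier := {γ | γ.1 =ᵐ[volume.restrict (Icc 0 1)] 0}
  zero_mem' := by
    rw [mem_ofPred_eq]
    exact EventuallyEq.rfl
  add_mem' := by
    intro γ δ hγ hδ
    rw [mem_ofPred_eq] at hγ hδ ⊢
    filter_upwards [hγ, hδ] with t h1 h2
    simp [h1, h2]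
  smul_mem' := by
    intro c γ hγ
    rw [mem_ofPred_eq] at hγ ⊢
    filter_upwards [hγ] with t h1
    simp [h1]

/-- The vector space `L^p([0,1], E)` of `ℒ^p`-functions modulo equality almost everywhere. -/
def LpSpace (p : ℝ≥0∞) (E : Type*) [AddCommGroup E] [Module ℝ E] [TopologicalSpace E]
    [IsTopologicalAddGroup E] [ContinuousSMul ℝ E] : Type _ :=
  LpFun p E ⧸ LpNull p E

noncomputable instance (p : ℝ≥0∞) : AddCommGroup (LpSpace p E) :=
  inferInstanceAs (AddCommGroup (LpFun p E ⧸ LpNull p E))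

noncomputable instance (p : ℝ≥0∞) : Module ℝ (LpSpace p E) :=
  inferInstanceAs (Module ℝ (LpFun p E ⧸ LpNull p E))

/-- The class `[γ]` of an `ℒ^p`-function `γ`. -/
def LpSpace.mk {p : ℝ≥0∞} : LpFun p E →ₗ[ℝ] LpSpace p E := (LpNull p E).mkQ

theorem LpSpace.mk_surjective {p : ℝ≥0∞} :
    Function.Surjective (LpSpace.mk : LpFun p E →ₗ[ℝ] LpSpace p E) :=
  (LpNull p E).mkQ_surjective

/-- The seminorm `‖γ‖_{ℒ^p, q} = ‖q ∘ γ‖_{ℒ^p}` on `ℒ^p([0,1], E)`. -/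
noncomputable def LpFun.seminorm (p : ℝ≥0∞) [hp : Fact (1 ≤ p)] (q : Seminorm ℝ E)
    (hq : Continuous q) : Seminorm ℝ (LpFun p E) :=
  Seminorm.of (fun γ => (eLpNorm (fun t => q (γ.1 t)) p (volume.restrict (Icc 0 1))).toReal)
    (by
      intro γ δ
      have h1 := γ.2.memLp q hq
      have h2 := δ.2.memLp q hq
      rw [← ENNReal.toReal_add h1.2.ne h2.2.ne]
      refine ENNReal.toReal_mono (ENNReal.add_ne_top.2 ⟨h1.2.ne, h2.2.ne⟩) ?_
      refine le_trans (eLpNorm_mono_real fun t => ?_) (eLpNorm_add_le h1.1 h2.1 hp.out)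
      simpa [abs_of_nonneg (apply_nonneg q _)] using map_add_le_add q (γ.1 t) (δ.1 t))
    (by
      intro c γ
      have h : (fun t => q ((c • γ).1 t)) = ‖c‖ • fun t => q (γ.1 t) := by
        ext t
        simp [map_smul_eq_mul]
      rw [h, eLpNorm_const_smul, ENNReal.toReal_mul]
      simp)

/-- The seminorm `‖[γ]‖_{L^p, q} = ‖q ∘ γ‖_{ℒ^p}` on `L^p([0,1], E)`. -/
noncomputable def LpSpace.seminorm (p : ℝ≥0∞) [Fact (1 ≤ p)] (q : Seminorm ℝ E)
    (hq : Continuous q) : Seminorm ℝ (LpSpace p E) :=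
  have key : ∀ γ δ : LpFun p E, LpSpace.mk γ = LpSpace.mk δ →
      LpFun.seminorm p q hq γ = LpFun.seminorm p q hq δ := by
    intro γ δ h
    have h' : γ - δ ∈ LpNull p E := (Submodule.Quotient.eq _).1 h
    have h'' : (γ - δ).1 =ᵐ[volume.restrict (Icc 0 1)] 0 := h'
    refine congrArg ENNReal.toReal (eLpNorm_congr_ae ?_)
    filter_upwards [h''] with t ht
    have : γ.1 t = δ.1 t := sub_eq_zero.1 (by simpa using ht)
    rw [this]
  have key' : ∀ γ : LpFun p E,
      LpFun.seminorm p q hq (Function.surjInv LpSpace.mk_surjective (LpSpace.mk γ)) =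
        LpFun.seminorm p q hq γ :=
    fun γ => key _ _ (Function.surjInv_eq LpSpace.mk_surjective (LpSpace.mk γ))
  Seminorm.of (fun g => LpFun.seminorm p q hq (Function.surjInv LpSpace.mk_surjective g))
    (by
      intro g g'
      obtain ⟨γ, rfl⟩ := LpSpace.mk_surjective g
      obtain ⟨δ, rfl⟩ := LpSpace.mk_surjective g'
      rw [← map_add, key', key', key']
      exact map_add_le_add _ γ δ)
    (by
      intro c g
      obtain ⟨γ, rfl⟩ := LpSpace.mk_surjective g
      rw [← map_smul, key', key']
      exact map_smul_eq_mul _ c γ)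

/-- The value of the seminorm does not depend on the representative. -/
theorem LpSpace.seminorm_mk (p : ℝ≥0∞) [Fact (1 ≤ p)] (q : Seminorm ℝ E)
    (hq : Continuous q) (γ : LpFun p E) :
    LpSpace.seminorm p q hq (LpSpace.mk γ) =
      (eLpNorm (fun t => q (γ.1 t)) p (volume.restrict (Icc 0 1))).toReal := by
  have h := Function.surjInv_eq LpSpace.mk_surjective (LpSpace.mk γ)
  have h' : Function.surjInv LpSpace.mk_surjective (LpSpace.mk γ) - γ ∈ LpNull p E :=
    (Submodule.Quotient.eq _).1 h
  have h'' : (Function.surjInv LpSpace.mk_surjective (LpSpace.mk γ) - γ).1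
      =ᵐ[volume.restrict (Icc 0 1)] 0 := h'
  refine congrArg ENNReal.toReal (eLpNorm_congr_ae ?_)
  filter_upwards [h''] with t ht
  have : (Function.surjInv LpSpace.mk_surjective (LpSpace.mk γ)).1 t = γ.1 t :=
    sub_eq_zero.1 (by simpa using ht)
  rw [this]

/-- The family of all seminorms `‖·‖_{L^p, q}`, for continuous seminorms `q` on `E`. -/
noncomputable def LpSpace.seminormFamily (p : ℝ≥0∞) [Fact (1 ≤ p)] (E : Type*) [AddCommGroup E]
    [Module ℝ E] [TopologicalSpace E] [IsTopologicalAddGroup E] [ContinuousSMul ℝ E] :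
    SeminormFamily ℝ (LpSpace p E) {q : Seminorm ℝ E // Continuous q} :=
  fun q => LpSpace.seminorm p q.1 q.2

instance : Nonempty {q : Seminorm ℝ E // Continuous q} :=
  ⟨⟨0, continuous_const⟩⟩

/-- The locally convex topology of `L^p([0,1], E)`, determined by the seminorms `‖·‖_{L^p, q}`. -/
noncomputable instance (p : ℝ≥0∞) [Fact (1 ≤ p)] : TopologicalSpace (LpSpace p E) :=
  (LpSpace.seminormFamily p E).moduleFilterBasis.topology

theorem LpSpace.withSeminorms (p : ℝ≥0∞) [Fact (1 ≤ p)] :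
    WithSeminorms (LpSpace.seminormFamily p E) :=
  ⟨rfl⟩

end Lebesgue

/-! ### Absolutely continuous functions and evolutions -/

section Evolution

variable {E : Type*} [AddCommGroup E] [Module ℝ E] [TopologicalSpace E]

/-- `v` is the weak integral `∫_a^b γ(s) ds`. -/
def IsWeakIntegral (γ : ℝ → E) (a b : ℝ) (v : E) : Prop :=
  ∀ l : E →L[ℝ] ℝ, l v = ∫ s in a..b, l (γ s)

/-- `η|_{[a,b]}` is absolutely continuous with `η' = [γ]`, i.e. it is a primitive of the
`ℒ^1`-function `γ`. -/
def HasACDerivOn (η γ : ℝ → E) (a b : ℝ) : Prop :=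
  MemLusinLp 1 γ (Icc a b) ∧ ∀ t ∈ Icc a b, IsWeakIntegral γ a t (η t - η a)

variable {G : Type*} [Group G] [TopologicalSpace G] [ChartedSpace E G]

/-- The Lie algebra `𝔤 = T_e G` is identified with `E` by means of the preferred chart around `e`.
For `v ∈ 𝔤` and `g ∈ G`, this says that `w` is the component in the chart `φ` around `g` of the tangent
vector `g.v = T λ_g (v) ∈ T_g G`, where `λ_g` is left translation by `g`. -/
def IsLeftTranslate (φ : OpenPartialHomeomorph G E) (g : G) (v w : E) : Prop :=
  HasDirDerivAt (fun x => φ (g * (chartAt E (1 : G)).symm x)) (chartAt E (1 : G) 1) v w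

/-- `η : [0,1] → G` is an evolution of `γ : [0,1] → 𝔤`, i.e. an (absolutely continuous) Carathéodory
solution of `y' = y.γ`, `y(0) = e`: there is a subdivision of `[0,1]` on whose subintervals `η` takes
its values in the domain of a chart `φ`, such that there `φ ∘ η` is absolutely continuous and its
derivative is given, almost everywhere, by the component of `η(s).γ(s)` in the chart `φ`. -/
def IsEvolution (γ : ℝ → E) (η : C(unitInterval, G)) : Prop :=
  η 0 = 1 ∧
  ∃ (m : ℕ) (t : ℕ → ℝ), t 0 = 0 ∧ t m = 1 ∧ (∀ j < m, t j < t (j + 1)) ∧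
    ∀ j < m, ∃ φ ∈ atlas E G,
      (∀ s ∈ Icc (t j) (t (j + 1)), IccExtend zero_le_one η s ∈ φ.source) ∧
      ∃ δ : ℝ → E, HasACDerivOn (fun s => φ (IccExtend zero_le_one η s)) δ (t j) (t (j + 1)) ∧
        ∀ᵐ s ∂volume.restrict (Icc (t j) (t (j + 1))),
          IsLeftTranslate φ (IccExtend zero_le_one η s) (γ s) (δ s)

variable [IsTopologicalAddGroup E] [ContinuousSMul ℝ E]

/-- `G` is `L^p`-semiregular: each `ℒ^p`-function `γ : [0,1] → 𝔤` has an evolution. -/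
def LpSemiregular (p : ℝ≥0∞) (E G : Type*) [AddCommGroup E] [Module ℝ E] [TopologicalSpace E]
    [IsTopologicalAddGroup E] [ContinuousSMul ℝ E] [Group G] [TopologicalSpace G]
    [ChartedSpace E G] : Prop :=
  ∀ γ ∈ LpFun p E, ∃ η : C(unitInterval, G), IsEvolution γ η

open Classical in
/-- `Evol [γ]` is the evolution of `γ` (and the constant function `e` if there is none). -/
noncomputable def Evol (p : ℝ≥0∞) (E G : Type*) [AddCommGroup E] [Module ℝ E] [TopologicalSpace E]
    [IsTopologicalAddGroup E] [ContinuousSMul ℝ E] [Group G] [TopologicalSpace G]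
    [ChartedSpace E G] (g : LpSpace p E) : C(unitInterval, G) :=
  if h : ∃ η : C(unitInterval, G), ∃ γ : LpFun p E, LpSpace.mk γ = g ∧ IsEvolution γ.1 η
  then h.choose else ContinuousMap.const _ 1

/-- `G` is `L^p`-regular: it is `L^p`-semiregular, and `Evol` is smooth as a map from the locally
convex space `L^p([0,1], 𝔤)` to the Lie group `C([0,1], G)`. -/
def LpRegular (p : ℝ≥0∞) [Fact (1 ≤ p)] (E G : Type*) [AddCommGroup E] [Module ℝ E]
    [TopologicalSpace E] [IsTopologicalAddGroup E] [ContinuousSMul ℝ E] [Group G]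
    [TopologicalSpace G] [IsTopologicalGroup G] [ChartedSpace E G] : Prop :=
  LpSemiregular p E G ∧ KellerSmooth (LpSpace p E) C(unitInterval, E) (Evol p E G)

end Evolution

/-!
The evolution map solves a differential equation with smooth right-hand side, so that its smoothness
follows from its continuity.

*Reduction to the origin.* If `η = Evol γ` and `ζ = Evol δ`, then `η ζ⁻¹` is an evolution of
`Ad(ζ)(γ - δ)` (`IsEvolution.div`). This identity gives uniqueness of evolutions, and it shows that
`Evol (γ + ε v) = Evol (ε Ad(Evol γ) v) · Evol γ` (`LpSemiregular.Evol_eq_mul`). Hence continuity at `0`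
implies continuity, and directional derivatives exist everywhere if they exist at `0`.

*The derivative at the origin.* Read in the chart around `e`, the curve `Evol (ε u)` is a primitive of
`ε c(·, u)`, where `c(x, u)` is smooth in `x`, linear in `u`, and equal to `u` at the point `x₀`
belonging to `e`. A function of class `C^1` which is linear in a further variable satisfies a Lipschitz
estimate `q (c(x, u) - c(x₀, u)) ≤ r (x - x₀) r'(u)` with continuous seminorms
(`HasContDirDerivOn.exists_lipschitz`). Since `Evol (ε u) → e` uniformly as `ε → 0`, the difference
quotients are uniformly Cauchy. As the model space is sequentially complete, they converge, and the
limit is a primitive of `u` (`exists_primitive_of_tendsto`). In particular all `L^p`-functions have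
primitives, which define a continuous linear operator `P : L^p → C([0,1], E)`, the derivative of `Evol`
at `0` (`LpSemiregular.exists_hasDirDerivAt_Evol_zero`).

*The differential equation.* By the first two steps, the local representative `S` of `Evol` in a chart
`ζ ↦ φ ∘ (η⁻¹ ζ)` has directional derivatives `dS(g, v) = Ψ(S g, v)`, where `Ψ` is composed of
superposition operators between spaces of continuous functions, of the operator `P`, and of the
multiplication operator `(y, v) ↦ Ad(η φ⁻¹(y)) v` with values in `L^p`. All of these are smooth
(`ParamCk.superposition`, `ParamCk.mulOp`); in the case of `ParamCk.mulOp` this again rests on the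
Lipschitz estimate. As `S` is continuous, it follows by induction that `S` is of class `C^k` for all `k`
(`ParamCk.of_hasDirDerivAt`).

The calculus is developed for maps `f : T → E → F` depending on a parameter from a topological space
`T`, which are differentiable in the variable from `E`, all derivatives being continuous jointly with
the parameter (`ParamCk`). A variable may be turned into a parameter, and a parameter that enters
linearly into a variable (`ParamCk.param_of_prod`, `ParamCk.prod_of_param`). In this way all arguments
use first derivatives only, iterated by passing from `E` to `E × E`; the comparison with iterated
directional derivatives is made in `KellerSmoothOn.paramCk` and `ParamCk.kellerSmoothOn`.
-/

set_option linter.unusedSectionVars false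

/-! ### Continuous seminorms and directional derivatives -/

section Seminorms

variable {E : Type*} [AddCommGroup E] [Module ℝ E] [TopologicalSpace E]
  [IsTopologicalAddGroup E] [ContinuousSMul ℝ E] [LocallyConvexSpace ℝ E]

theorem exists_seminorm_lt_one_subset {U : Set E} (hU : U ∈ 𝓝 (0 : E)) :
    ∃ q : Seminorm ℝ E, Continuous q ∧ {x | q x < 1} ⊆ U := by
  obtain ⟨W, ⟨hW, hWc⟩, hWU⟩ := (nhds_hasBasis_absConvex_open ℝ E).mem_iff.1 hU
  let s : AbsConvexOpenSets ℝ E := ⟨W, hW, hWc⟩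
  refine ⟨gaugeSeminormFamily ℝ E s, (with_gaugeSeminormFamily).continuous_seminorm s, ?_⟩
  intro x hx
  have h := gaugeSeminormFamily_ball s
  have : x ∈ (gaugeSeminormFamily ℝ E s).ball 0 1 := by simpa [Seminorm.mem_ball] using hx
  rw [h] at this
  exact hWU this

theorem tendsto_nhds_iff_seminorm {ι : Type*} {l : Filter ι} {u : ι → E} {a : E} :
    Tendsto u l (𝓝 a) ↔ ∀ q : Seminorm ℝ E, Continuous q → ∀ ε > 0, ∀ᶠ i in l, q (u i - a) < ε := by
  rw [(PolynormableSpace.withSeminorms ℝ E).tendsto_nhds]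
  exact ⟨fun h q hq ε hε => h ⟨q, hq⟩ ε hε, fun h q ε hε => h q.1 q.2 ε hε⟩

theorem exists_dual_eq_seminorm (q : Seminorm ℝ E) (hq : Continuous q) (x : E) :
    ∃ l : E →L[ℝ] ℝ, l x = q x ∧ ∀ y, |l y| ≤ q y := by
  by_cases hx : x = 0
  · exact ⟨0, by simp [hx]⟩
  let f : Module.Dual ℝ (ℝ ∙ x) :=
    q x • (LinearEquiv.toSpanNonzeroSingleton ℝ E x hx).symm.toLinearMap
  have hf : ∀ c : ℝ, ∀ h, f ⟨c • x, h⟩ = c * q x := by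
    intro c h
    have : (⟨c • x, h⟩ : (ℝ ∙ x)) = LinearEquiv.toSpanNonzeroSingleton ℝ E x hx c := by
      ext; simp
    rw [this, LinearMap.smul_apply, LinearEquiv.coe_coe, LinearEquiv.symm_apply_apply,
      smul_eq_mul, mul_comm]
  obtain ⟨g, hg, hle⟩ := f.exists_continuous_extension_of_le_seminorm_real (ℝ ∙ x) hq (by
    rintro ⟨y, hy⟩
    obtain ⟨c, rfl⟩ := Submodule.mem_span_singleton.1 hy
    rw [hf]
    simp only [map_smul_eq_mul]
    exact mul_le_mul_of_nonneg_right (le_abs_self c) (apply_nonneg q x))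
  refine ⟨g, ?_, hle⟩
  have := hg ⟨(1 : ℝ) • x, Submodule.smul_mem _ _ (Submodule.mem_span_singleton_self x)⟩
  rw [hf] at this
  simpa using this

end Seminorms

section DirDeriv

variable {E F : Type*} [AddCommGroup E] [Module ℝ E] [TopologicalSpace E]
  [AddCommGroup F] [Module ℝ F] [TopologicalSpace F]

theorem HasDirDerivAt.unique [T2Space F] {f : E → F} {x y : E} {v w : F}
    (hv : HasDirDerivAt f x y v) (hw : HasDirDerivAt f x y w) : v = w :=
  tendsto_nhds_unique hv hw

theorem HasDirDerivAt.smul [ContinuousConstSMul ℝ F] {f : E → F} {x y : E} {v : F}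
    (h : HasDirDerivAt f x y v) (c : ℝ) : HasDirDerivAt f x (c • y) (c • v) := by
  unfold HasDirDerivAt at *
  by_cases hc : c = 0
  · subst hc
    simp [tendsto_const_nhds]
  have h1 : Tendsto (fun t : ℝ => t * c) (𝓝[≠] 0) (𝓝[≠] 0) := by
    refine tendsto_nhdsWithin_iff.2 ⟨?_, ?_⟩
    · have : Tendsto (fun t : ℝ => t * c) (𝓝 0) (𝓝 (0 * c)) :=
        (continuous_mul_const c).tendsto 0
      rw [zero_mul] at this
      exact this.mono_left nhdsWithin_le_nhds
    · filter_upwards [self_mem_nhdsWithin] with t ht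
      exact mul_ne_zero ht hc
  refine ((h.comp h1).const_smul c).congr fun t => ?_
  simp only [Function.comp_apply, smul_smul, mul_inv]
  congr 2
  field_simp

theorem HasDirDerivAt.congr_of_eventuallyEq {f g : E → F} {x y : E} {v : F}
    (h : HasDirDerivAt f x y v) (hfg : ∀ᶠ t : ℝ in 𝓝 0, f (x + t • y) = g (x + t • y)) :
    HasDirDerivAt g x y v := by
  have h0 : f x = g x := by simpa using hfg.self_of_nhds
  refine Tendsto.congr' ?_ h
  filter_upwards [hfg.filter_mono nhdsWithin_le_nhds] with t ht
  rw [ht, h0]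

theorem hasDirDerivAt_const (c : F) (x y : E) : HasDirDerivAt (fun _ => c) x y 0 := by
  simp [HasDirDerivAt, tendsto_const_nhds]

theorem HasDirDerivAt.prodMk {G : Type*} [AddCommGroup G] [Module ℝ G] [TopologicalSpace G]
    {f : E → F} {g : E → G} {x y : E} {v : F} {w : G}
    (hf : HasDirDerivAt f x y v) (hg : HasDirDerivAt g x y w) :
    HasDirDerivAt (fun z => (f z, g z)) x y (v, w) :=
  Tendsto.prodMk_nhds hf hg

theorem ContinuousLinearMap.hasDirDerivAt (L : E →L[ℝ] F) (x y : E) :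
    HasDirDerivAt L x y (L y) := by
  refine Tendsto.congr' ?_ tendsto_const_nhds
  filter_upwards [self_mem_nhdsWithin] with t ht
  have ht : t ≠ 0 := ht
  simp [smul_smul, inv_mul_cancel₀ ht]

theorem HasDirDerivAt.clm_comp {G : Type*} [AddCommGroup G] [Module ℝ G] [TopologicalSpace G]
    (L : F →L[ℝ] G) {f : E → F} {x y : E} {v : F} (hf : HasDirDerivAt f x y v) :
    HasDirDerivAt (fun z => L (f z)) x y (L v) := by
  refine ((L.continuous.tendsto v).comp hf).congr fun t => ?_
  simp

theorem HasDirDerivAt.comp_clm {G : Type*} [AddCommGroup G] [Module ℝ G] [TopologicalSpace G]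
    (L : G →L[ℝ] E) {f : E → F} {x y : G} {v : F} (hf : HasDirDerivAt f (L x) (L y) v) :
    HasDirDerivAt (fun z => f (L z)) x y v := by
  refine Tendsto.congr (fun t => ?_) hf
  simp

/-- The restriction of `f` to the line `σ ↦ x + σ • v` is differentiable wherever `f` has a
derivative in the direction `v`. -/
theorem HasDirDerivAt.hasDerivAt_line {f : E → ℝ} {x v : E} {σ d : ℝ}
    (h : HasDirDerivAt f (x + σ • v) v d) : HasDerivAt (fun s : ℝ => f (x + s • v)) d σ := by
  rw [hasDerivAt_iff_tendsto_slope_zero]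
  refine Tendsto.congr (fun t => ?_) h
  rw [add_smul, add_assoc]

/-- Mean value estimate along a segment. -/
theorem seminorm_sub_le_of_hasDirDerivAt [IsTopologicalAddGroup F] [ContinuousSMul ℝ F]
    [LocallyConvexSpace ℝ F] {f : E → F} {x v : E} {d : ℝ → F}
    (hd : ∀ σ ∈ Icc (0 : ℝ) 1, HasDirDerivAt f (x + σ • v) v (d σ))
    (q : Seminorm ℝ F) (hq : Continuous q) {w : F} {M : ℝ}
    (hM : ∀ σ ∈ Icc (0 : ℝ) 1, q (d σ - w) ≤ M) : q (f (x + v) - f x - w) ≤ M := by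
  obtain ⟨l, hl, hle⟩ := exists_dual_eq_seminorm q hq (f (x + v) - f x - w)
  have h1 : ∀ σ ∈ Icc (0 : ℝ) 1, HasDerivAt (fun s : ℝ => l (f (x + s • v))) (l (d σ)) σ :=
    fun σ hσ => ((hd σ hσ).clm_comp l).hasDerivAt_line
  obtain ⟨c, hc, hc'⟩ := exists_hasDerivAt_eq_slope (fun s : ℝ => l (f (x + s • v)))
    (fun σ => l (d σ)) zero_lt_one (fun σ hσ => (h1 σ hσ).continuousAt.continuousWithinAt)
    (fun σ hσ => h1 σ (Ioo_subset_Icc_self hσ))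
  simp only [one_smul, zero_smul, add_zero, sub_zero, div_one] at hc'
  rw [← hl, map_sub, map_sub, ← hc', ← map_sub]
  exact (le_abs_self _).trans ((hle _).trans (hM c (Ioo_subset_Icc_self hc)))

/-- A real function with directional derivatives along a segment satisfies the mean value theorem. -/
theorem exists_sub_eq_of_hasDirDerivAt {f : E → ℝ} {x v : E} {d : ℝ → ℝ}
    (hd : ∀ σ ∈ Icc (0 : ℝ) 1, HasDirDerivAt f (x + σ • v) v (d σ)) :
    ∃ σ ∈ Icc (0 : ℝ) 1, f (x + v) - f x = d σ := by
  have h1 : ∀ σ ∈ Icc (0 : ℝ) 1, HasDerivAt (fun s : ℝ => f (x + s • v)) (d σ) σ :=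
    fun σ hσ => (hd σ hσ).hasDerivAt_line
  obtain ⟨c, hc, hc'⟩ := exists_hasDerivAt_eq_slope (fun s : ℝ => f (x + s • v))
    d zero_lt_one (fun σ hσ => (h1 σ hσ).continuousAt.continuousWithinAt)
    (fun σ hσ => h1 σ (Ioo_subset_Icc_self hσ))
  refine ⟨c, Ioo_subset_Icc_self hc, ?_⟩
  simpa using hc'.symm

end DirDeriv

section Hadamard

variable {T : Type*} [TopologicalSpace T]
  {E F : Type*} [AddCommGroup E] [Module ℝ E] [TopologicalSpace E]
  [IsTopologicalAddGroup E] [ContinuousSMul ℝ E]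
  [AddCommGroup F] [Module ℝ F] [TopologicalSpace F]

/-- `df` is a continuous directional derivative on `Ω ⊆ T × E` of the family `f t : E → F`
depending on a parameter `t : T`. -/
structure HasContDirDerivOn (f : T → E → F) (df : T → E × E → F) (Ω : Set (T × E)) : Prop where
  hasDirDerivAt : ∀ z ∈ Ω, ∀ v, HasDirDerivAt (f z.1) z.2 v (df z.1 (z.2, v))
  continuousOn : ContinuousOn (fun z : T × (E × E) => df z.1 z.2) {z | (z.1, z.2.1) ∈ Ω}

variable [IsTopologicalAddGroup F] [ContinuousSMul ℝ F] [LocallyConvexSpace ℝ F]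
  {f : T → E → F} {df : T → E × E → F} {Ω : Set (T × E)}

/-- Difference quotients of a parametrized `C¹`-map converge jointly in the parameter, the point, the
direction and the step. -/
theorem HasContDirDerivOn.tendsto (hf : HasContDirDerivOn f df Ω) (hΩ : IsOpen Ω)
    {t₀ : T} {x₀ : E} (h₀ : (t₀, x₀) ∈ Ω) (v₀ : E) :
    Tendsto (fun w : T × E × E × ℝ =>
        w.2.2.2⁻¹ • (f w.1 (w.2.1 + w.2.2.2 • w.2.2.1) - f w.1 w.2.1))
      (𝓝[{w | w.2.2.2 ≠ 0}] (t₀, x₀, v₀, 0)) (𝓝 (df t₀ (x₀, v₀))) := by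
  rw [tendsto_nhds_iff_seminorm]
  intro q hq ε hε
  have hΩ' : IsOpen {z : T × (E × E) | (z.1, z.2.1) ∈ Ω} := hΩ.preimage (by fun_prop)
  have hA : ∀ᶠ z : T × (E × E) in 𝓝 (t₀, (x₀, v₀)),
      (z.1, z.2.1) ∈ Ω ∧ q (df z.1 z.2 - df t₀ (x₀, v₀)) < ε / 2 := by
    have h0 : {z : T × (E × E) | (z.1, z.2.1) ∈ Ω} ∈ 𝓝 (t₀, (x₀, v₀)) := hΩ'.mem_nhds h₀
    refine Filter.Eventually.and h0 ?_
    have h1 := (hf.continuousOn.continuousAt h0).tendsto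
    exact tendsto_nhds_iff_seminorm.1 h1 q hq _ (half_pos hε)
  have hB : ∀ᶠ w : T × E × E × ℝ in 𝓝 (t₀, x₀, v₀, 0), ∀ σ ∈ Icc (0 : ℝ) 1,
      (w.1, w.2.1 + (σ * w.2.2.2) • w.2.2.1) ∈ Ω ∧
        q (df w.1 (w.2.1 + (σ * w.2.2.2) • w.2.2.1, w.2.2.1) - df t₀ (x₀, v₀)) < ε / 2 := by
    refine isCompact_Icc.eventually_forall_of_forall_eventually
      (P := fun (w : T × E × E × ℝ) σ => (w.1, w.2.1 + (σ * w.2.2.2) • w.2.2.1) ∈ Ω ∧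
        q (df w.1 (w.2.1 + (σ * w.2.2.2) • w.2.2.1, w.2.2.1) - df t₀ (x₀, v₀)) < ε / 2) fun σ _ => ?_
    have hc : Tendsto (fun z : (T × E × E × ℝ) × ℝ =>
        (z.1.1, (z.1.2.1 + (z.2 * z.1.2.2.2) • z.1.2.2.1, z.1.2.2.1)))
        (𝓝 ((t₀, x₀, v₀, 0), σ)) (𝓝 (t₀, (x₀, v₀))) := by
      have : Continuous (fun z : (T × E × E × ℝ) × ℝ =>
        (z.1.1, (z.1.2.1 + (z.2 * z.1.2.2.2) • z.1.2.2.1, z.1.2.2.1))) := by fun_prop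
      simpa using this.tendsto ((t₀, x₀, v₀, 0), σ)
    exact hc.eventually hA
  filter_upwards [hB.filter_mono nhdsWithin_le_nhds, self_mem_nhdsWithin] with w hw hs
  obtain ⟨t, x, v, s⟩ := w
  simp only [ne_eq] at hs hw ⊢
  have key := seminorm_sub_le_of_hasDirDerivAt (f := f t) (x := x) (v := s • v)
    (d := fun σ => s • df t (x + (σ * s) • v, v)) (fun σ hσ => by
      rw [smul_smul]
      exact (hf.hasDirDerivAt (t, x + (σ * s) • v) (hw σ hσ).1 v).smul s) q hq
    (w := s • df t₀ (x₀, v₀)) (M := |s| * (ε / 2)) (fun σ hσ => by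
      rw [← smul_sub, map_smul_eq_mul]
      exact mul_le_mul_of_nonneg_left (hw σ hσ).2.le (abs_nonneg s))
  have h2 : s⁻¹ • (f t (x + s • v) - f t x) - df t₀ (x₀, v₀)
      = s⁻¹ • (f t (x + s • v) - f t x - s • df t₀ (x₀, v₀)) := by
    rw [smul_sub s⁻¹ (_ - _), smul_smul, inv_mul_cancel₀ hs, one_smul]
  rw [h2, map_smul_eq_mul, norm_inv, Real.norm_eq_abs]
  have hs' : 0 < |s| := abs_pos.2 hs
  calc |s|⁻¹ * q _ ≤ |s|⁻¹ * (|s| * (ε / 2)) := by gcongr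
    _ = ε / 2 := by field_simp
    _ < ε := half_lt_self hε

/-- The chain rule for a differentiable curve `c`, with parameters `τ` moving along. -/
theorem HasContDirDerivOn.tendsto_comp (hf : HasContDirDerivOn f df Ω) (hΩ : IsOpen Ω)
    {ι : Type*} {l : Filter ι} {s : ι → ℝ} (hs : Tendsto s l (𝓝[≠] 0))
    {τ : ι → T} {t₀ : T} (hτ : Tendsto τ l (𝓝 t₀))
    {x : ι → E} {x₀ : E} (hx : Tendsto x l (𝓝 x₀)) {c : ι → E} {v : E}
    (h₀ : (t₀, x₀) ∈ Ω) (hc : Tendsto (fun i => (s i)⁻¹ • (c i - x i)) l (𝓝 v)) :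
    Tendsto (fun i => (s i)⁻¹ • (f (τ i) (c i) - f (τ i) (x i))) l (𝓝 (df t₀ (x₀, v))) := by
  have h1 := hf.tendsto hΩ h₀ v
  have h2 : Tendsto (fun i => (τ i, x i, (s i)⁻¹ • (c i - x i), s i)) l
      (𝓝[{w | w.2.2.2 ≠ 0}] (t₀, x₀, v, 0)) := by
    refine tendsto_nhdsWithin_iff.2 ⟨?_, ?_⟩
    · exact hτ.prodMk_nhds (hx.prodMk_nhds (hc.prodMk_nhds (hs.mono_right nhdsWithin_le_nhds)))
    · exact (tendsto_nhdsWithin_iff.1 hs).2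
  refine (h1.comp h2).congr' ?_
  filter_upwards [(tendsto_nhdsWithin_iff.1 hs).2] with i hi
  have hi : s i ≠ 0 := hi
  simp [smul_smul, mul_inv_cancel₀ hi]

theorem HasContDirDerivOn.comp_hasDirDerivAt (hf : HasContDirDerivOn f df Ω) (hΩ : IsOpen Ω)
    {H : Type*} [AddCommGroup H] [Module ℝ H] [TopologicalSpace H]
    {t : T} {g : H → E} {x y : H} {v : E} (h₀ : (t, g x) ∈ Ω) (hg : HasDirDerivAt g x y v) :
    HasDirDerivAt (fun z => f t (g z)) x y (df t (g x, v)) :=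
  hf.tendsto_comp hΩ (s := fun s => s) tendsto_id tendsto_const_nhds tendsto_const_nhds h₀ hg

theorem HasContDirDerivOn.map_smul [T2Space F] (hf : HasContDirDerivOn f df Ω)
    {t : T} {x : E} (h : (t, x) ∈ Ω) (c : ℝ) (v : E) :
    df t (x, c • v) = c • df t (x, v) :=
  (hf.hasDirDerivAt _ h (c • v)).unique ((hf.hasDirDerivAt _ h v).smul c)

theorem HasContDirDerivOn.map_add [T2Space F] (hf : HasContDirDerivOn f df Ω) (hΩ : IsOpen Ω)
    {t : T} {x : E} (h : (t, x) ∈ Ω) (v w : E) :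
    df t (x, v + w) = df t (x, v) + df t (x, w) := by
  refine (hf.hasDirDerivAt _ h (v + w)).unique ?_
  have hid : Tendsto (fun s : ℝ => s) (𝓝[≠] 0) (𝓝[≠] 0) := tendsto_id
  have hx : ∀ u : E, Tendsto (fun s : ℝ => x + s • u) (𝓝[≠] 0) (𝓝 x) := by
    intro u
    have : Continuous fun s : ℝ => x + s • u := by fun_prop
    simpa using (this.tendsto 0).mono_left nhdsWithin_le_nhds
  have h1 := hf.tendsto_comp hΩ hid (tendsto_const_nhds (x := t)) (hx v)
    (c := fun s => x + s • (v + w)) (v := w) h (by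
      refine Tendsto.congr' ?_ tendsto_const_nhds
      filter_upwards [self_mem_nhdsWithin] with s hs
      have hs : s ≠ 0 := hs
      simp [smul_smul, inv_mul_cancel₀ hs])
  have h2 := hf.hasDirDerivAt _ h v
  refine (Tendsto.add h2 h1).congr fun s => ?_
  rw [← smul_add, add_comm (_ - _), sub_add_sub_cancel]

end Hadamard

/-! ### Differentiability classes with a topological parameter -/

section ParamCk

universe u

/-- The part of `T × (E × E)` lying over `Ω ⊆ T × E`: the domain of the derivative of a
parametrized map with domain `Ω`. -/
def tangentDomain {T E : Type*} (Ω : Set (T × E)) : Set (T × (E × E)) :=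
  {z | (z.1, z.2.1) ∈ Ω}

/-- `f : T → E → F` is `k` times continuously differentiable (in Keller's sense) on `Ω ⊆ T × E` in the
variable `x ∈ E`, all derivatives being jointly continuous in `x`, the directions and the parameter
`t ∈ T`. The parameter ranges over an arbitrary topological space. The definition is by recursion:
the derivative, a map `T → E × E → F`, has to be of class `C^{k-1}`.
For `T = Unit` this is ordinary differentiability. -/
def ParamCk {T : Type*} [TopologicalSpace T] {F : Type*} [AddCommGroup F] [Module ℝ F]
    [TopologicalSpace F] : ℕ → ∀ {E : Type u} [AddCommGroup E] [Module ℝ E] [TopologicalSpace E],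
    (T → E → F) → Set (T × E) → Prop
  | 0, _, _, _, _, f, Ω => ContinuousOn (fun z => f z.1 z.2) Ω
  | k + 1, E, _, _, _, f, Ω => ContinuousOn (fun z => f z.1 z.2) Ω ∧
      ∃ df : T → E × E → F, HasContDirDerivOn f df Ω ∧ ParamCk k df (tangentDomain Ω)

variable {T : Type*} [TopologicalSpace T]
  {E : Type u} [AddCommGroup E] [Module ℝ E] [TopologicalSpace E]
  {F : Type*} [AddCommGroup F] [Module ℝ F] [TopologicalSpace F]

theorem IsOpen.tangentDomain {Ω : Set (T × E)} (hΩ : IsOpen Ω) : IsOpen (tangentDomain Ω) :=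
  hΩ.preimage (by fun_prop : Continuous fun z : T × (E × E) => (z.1, z.2.1))

theorem HasContDirDerivOn.mono {f : T → E → F} {df : T → E × E → F} {Ω Ω' : Set (T × E)}
    (h : HasContDirDerivOn f df Ω) (hs : Ω' ⊆ Ω) : HasContDirDerivOn f df Ω' :=
  ⟨fun z hz v => h.hasDirDerivAt z (hs hz) v, h.continuousOn.mono fun _ hz => hs hz⟩

namespace ParamCk

theorem continuousOn {k : ℕ} {f : T → E → F} {Ω : Set (T × E)} (h : ParamCk k f Ω) :
    ContinuousOn (fun z : T × E => f z.1 z.2) Ω := by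
  cases k with
  | zero => exact h
  | succ k => exact h.1

theorem of_succ {k : ℕ} {f : T → E → F} {Ω : Set (T × E)} (h : ParamCk (k + 1) f Ω) :
    ParamCk k f Ω := by
  induction k generalizing E with
  | zero => exact h.1
  | succ k ih =>
    obtain ⟨h0, df, h1, h2⟩ := h
    exact ⟨h0, df, h1, ih h2⟩

theorem mono {k : ℕ} {f : T → E → F} {Ω Ω' : Set (T × E)} (h : ParamCk k f Ω) (hs : Ω' ⊆ Ω) :
    ParamCk k f Ω' := by
  induction k generalizing E with
  | zero => exact ContinuousOn.mono h hs
  | succ k ih =>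
    obtain ⟨h0, df, h1, h2⟩ := h
    exact ⟨h0.mono hs, df, h1.mono hs, ih h2 fun _ hz => hs hz⟩

theorem prodMk {H : Type*} [AddCommGroup H] [Module ℝ H] [TopologicalSpace H] {k : ℕ}
    {f : T → E → F} {g : T → E → H} {Ω : Set (T × E)}
    (hf : ParamCk k f Ω) (hg : ParamCk k g Ω) : ParamCk k (fun t x => (f t x, g t x)) Ω := by
  induction k generalizing E with
  | zero => exact ContinuousOn.prodMk hf hg
  | succ k ih =>
    obtain ⟨f0, df, f1, f2⟩ := hf
    obtain ⟨g0, dg, g1, g2⟩ := hg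
    exact ⟨f0.prodMk g0, fun t z => (df t z, dg t z),
      ⟨fun z hz v => (f1.hasDirDerivAt z hz v).prodMk (g1.hasDirDerivAt z hz v),
        f1.continuousOn.prodMk g1.continuousOn⟩, ih f2 g2⟩

theorem clm_comp {H : Type*} [AddCommGroup H] [Module ℝ H] [TopologicalSpace H] {k : ℕ}
    (L : F →L[ℝ] H) {f : T → E → F} {Ω : Set (T × E)}
    (hf : ParamCk k f Ω) : ParamCk k (fun t x => L (f t x)) Ω := by
  induction k generalizing E with
  | zero => exact L.continuous.comp_continuousOn hf
  | succ k ih =>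
    obtain ⟨f0, df, f1, f2⟩ := hf
    exact ⟨L.continuous.comp_continuousOn f0, fun t z => L (df t z),
      ⟨fun z hz v => (f1.hasDirDerivAt z hz v).clm_comp L,
        L.continuous.comp_continuousOn f1.continuousOn⟩, ih f2⟩

theorem add [IsTopologicalAddGroup F] {k : ℕ}
    {f g : T → E → F} {Ω : Set (T × E)}
    (hf : ParamCk k f Ω) (hg : ParamCk k g Ω) : ParamCk k (fun t x => f t x + g t x) Ω :=
  (hf.prodMk hg).clm_comp (ContinuousLinearMap.fst ℝ F F + ContinuousLinearMap.snd ℝ F F)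

/-- Precomposition with a linear map in the variable and a continuous map in the parameter. -/
theorem comp_clm {S : Type*} [TopologicalSpace S] {H : Type*} [AddCommGroup H] [Module ℝ H]
    [TopologicalSpace H] {k : ℕ} {f : T → E → F} {Ω : Set (T × E)} (hf : ParamCk k f Ω)
    {τ : S → T} (hτ : Continuous τ) (L : H →L[ℝ] E) {Ω' : Set (S × H)}
    (hΩ : ∀ z ∈ Ω', (τ z.1, L z.2) ∈ Ω) : ParamCk k (fun s y => f (τ s) (L y)) Ω' := by
  induction k generalizing E H with
  | zero =>
    exact ContinuousOn.comp hf
      (by fun_prop : Continuous fun z : S × H => (τ z.1, L z.2)).continuousOn hΩ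
  | succ k ih =>
    obtain ⟨f0, df, f1, f2⟩ := hf
    refine ⟨f0.comp (by fun_prop : Continuous fun z : S × H => (τ z.1, L z.2)).continuousOn hΩ,
      fun s z => df (τ s) (L.prodMap L z), ⟨fun z hz v => ?_, ?_⟩,
      ih f2 (L.prodMap L) fun z hz => hΩ _ hz⟩
    · exact (f1.hasDirDerivAt _ (hΩ z hz) (L v)).comp_clm L
    · exact f1.continuousOn.comp (f := fun z : S × (H × H) => (τ z.1, L.prodMap L z.2))
        (by fun_prop) fun z hz => hΩ (z.1, z.2.1) hz

theorem comp_param {S : Type*} [TopologicalSpace S] {k : ℕ} {f : T → E → F} {Ω : Set (T × E)}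
    (hf : ParamCk k f Ω) {τ : S → T} (hτ : Continuous τ) {Ω' : Set (S × E)}
    (hΩ : ∀ z ∈ Ω', (τ z.1, z.2) ∈ Ω) : ParamCk k (fun s y => f (τ s) y) Ω' :=
  hf.comp_clm hτ (ContinuousLinearMap.id ℝ E) hΩ

theorem zero (k : ℕ) (Ω : Set (T × E)) : ParamCk k (fun _ _ => (0 : F)) Ω := by
  induction k generalizing E with
  | zero => exact continuousOn_const
  | succ k ih =>
    exact ⟨continuousOn_const, fun _ _ => 0, ⟨fun z _ v => hasDirDerivAt_const _ _ _,
      continuousOn_const⟩, ih _⟩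

/-- A map that depends on the parameter only. -/
theorem of_param (k : ℕ) {c : T → F} {Ω : Set (T × E)}
    (hc : ContinuousOn (fun z : T × E => c z.1) Ω) :
    ParamCk k (fun t _ => c t) Ω := by
  cases k with
  | zero => exact hc
  | succ k =>
    exact ⟨hc, fun _ _ => 0, ⟨fun z _ v => hasDirDerivAt_const _ _ _,
      continuousOn_const⟩, zero k _⟩

theorem clm (k : ℕ) (L : E →L[ℝ] F) (Ω : Set (T × E)) : ParamCk k (fun _ x => L x) Ω := by
  induction k generalizing E with
  | zero => exact (L.continuous.comp continuous_snd).continuousOn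
  | succ k ih =>
    exact ⟨(L.continuous.comp continuous_snd).continuousOn,
      fun _ z => L z.2, ⟨fun z _ v => L.hasDirDerivAt _ _,
      (by fun_prop : Continuous fun z : T × (E × E) => L z.2.2).continuousOn⟩,
      ih (L.comp (ContinuousLinearMap.snd ℝ E E)) _⟩

theorem congr [IsTopologicalAddGroup E] [ContinuousSMul ℝ E] {k : ℕ} {f g : T → E → F}
    {Ω : Set (T × E)} (hf : ParamCk k f Ω) (hΩ : IsOpen Ω)
    (hfg : ∀ z ∈ Ω, f z.1 z.2 = g z.1 z.2) : ParamCk k g Ω := by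
  cases k with
  | zero => exact ContinuousOn.congr hf fun z hz => (hfg z hz).symm
  | succ k =>
    obtain ⟨f0, df, f1, f2⟩ := hf
    refine ⟨f0.congr fun z hz => (hfg z hz).symm, df, ⟨fun z hz v => ?_, f1.continuousOn⟩, f2⟩
    refine (f1.hasDirDerivAt z hz v).congr_of_eventuallyEq ?_
    have hc : Continuous fun t : ℝ => (z.1, z.2 + t • v) := by fun_prop
    have : ∀ᶠ t : ℝ in 𝓝 0, (z.1, z.2 + t • v) ∈ Ω :=
      (hΩ.preimage hc).mem_nhds (by simpa using hz)
    filter_upwards [this] with t ht using hfg _ ht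

/-- Being of class `C^k` is a local property. -/
theorem of_local [IsTopologicalAddGroup E] [ContinuousSMul ℝ E] [T2Space F] {k : ℕ}
    {f : T → E → F} {Ω : Set (T × E)} (hΩ : IsOpen Ω)
    (h : ∀ z ∈ Ω, ∃ W, IsOpen W ∧ z ∈ W ∧ ParamCk k f (Ω ∩ W)) : ParamCk k f Ω := by
  induction k generalizing E with
  | zero =>
    intro z hz
    obtain ⟨W, hW, hzW, hf⟩ := h z hz
    exact (ContinuousOn.continuousAt hf ((hΩ.inter hW).mem_nhds ⟨hz, hzW⟩)).continuousWithinAt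
  | succ k ih =>
    have hc : ContinuousOn (fun z : T × E => f z.1 z.2) Ω := by
      intro z hz
      obtain ⟨W, hW, hzW, hf⟩ := h z hz
      exact (hf.continuousOn.continuousAt ((hΩ.inter hW).mem_nhds ⟨hz, hzW⟩)).continuousWithinAt
    choose! W hW hzW hf using h
    choose! df hdf hdf' using fun z hz => (hf z hz).2
    have heq : ∀ z ∈ Ω, ∀ w ∈ tangentDomain (Ω ∩ W z), df z w.1 w.2 = df (w.1, w.2.1) w.1 w.2 := by
      intro z hz w hw
      exact ((hdf z hz).hasDirDerivAt _ hw w.2.2).unique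
        ((hdf _ hw.1).hasDirDerivAt _ ⟨hw.1, hzW _ hw.1⟩ w.2.2)
    have hloc : ∀ z ∈ Ω, ParamCk k (fun t (w : E × E) => df (t, w.1) t w)
        (tangentDomain (Ω ∩ W z)) := fun z hz =>
      (hdf' z hz).congr (hΩ.inter (hW z hz)).tangentDomain (heq z hz)
    have hk : ParamCk k (fun t (w : E × E) => df (t, w.1) t w) (tangentDomain Ω) := by
      refine ih hΩ.tangentDomain fun w hw => ?_
      exact ⟨tangentDomain (W (w.1, w.2.1)), (hW _ hw).tangentDomain, hzW _ hw, hloc _ hw⟩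
    refine ⟨hc, fun t w => df (t, w.1) t w, ⟨fun z hz v => ?_, hk.continuousOn⟩, hk⟩
    exact (hdf z hz).hasDirDerivAt z ⟨hz, hzW z hz⟩ v

section Comp

variable {S : Type*} [TopologicalSpace S]

/-- The chain rule. -/
theorem comp {M : Type*} [AddCommGroup M] [Module ℝ M] [TopologicalSpace M]
    [IsTopologicalAddGroup M] [ContinuousSMul ℝ M] [IsTopologicalAddGroup F]
    [ContinuousSMul ℝ F] [LocallyConvexSpace ℝ F] {k : ℕ} {g : T → M → F} {Ω : Set (T × M)}
    (hg : ParamCk k g Ω) (hΩ : IsOpen Ω) {τ : S → T} (hτ : Continuous τ) {f : S → E → M}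
    {Ω' : Set (S × E)} (hf : ParamCk k f Ω') (hmaps : ∀ z ∈ Ω', (τ z.1, f z.1 z.2) ∈ Ω) :
    ParamCk k (fun s x => g (τ s) (f s x)) Ω' := by
  induction k generalizing E M with
  | zero =>
    exact ContinuousOn.comp (g := fun z : T × M => g z.1 z.2) hg
      (((hτ.comp continuous_fst).continuousOn).prodMk hf) hmaps
  | succ k ih =>
    have f0 := hf.of_succ
    obtain ⟨fc, df, f1, f2⟩ := hf
    obtain ⟨gc, dg, g1, g2⟩ := hg
    have hk : ParamCk k (fun s (z : E × E) => dg (τ s) (f s z.1, df s z)) (tangentDomain Ω') := by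
      refine ih (M := M × M) g2 hΩ.tangentDomain ?_ (fun z hz => hmaps _ hz)
      exact (f0.comp_clm continuous_id (ContinuousLinearMap.fst ℝ E E) fun z hz => hz).prodMk f2
    refine ⟨?_, fun s z => dg (τ s) (f s z.1, df s z), ⟨fun z hz v => ?_, hk.continuousOn⟩, hk⟩
    · exact ContinuousOn.comp (g := fun z : T × M => g z.1 z.2) gc
        (((hτ.comp continuous_fst).continuousOn).prodMk fc) hmaps
    · exact g1.comp_hasDirDerivAt hΩ (hmaps z hz) (f1.hasDirDerivAt z hz v)

end Comp

section Exchange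

variable {H : Type u} [AddCommGroup H] [Module ℝ H] [TopologicalSpace H]

/-- A variable may be regarded as a parameter. -/
theorem param_of_prod {k : ℕ} {f : T → E × H → F} {Ω : Set (T × (E × H))} (hf : ParamCk k f Ω) :
    ParamCk k (fun (s : T × H) x => f s.1 (x, s.2)) {z | (z.1.1, (z.2, z.1.2)) ∈ Ω} := by
  induction k generalizing E H with
  | zero =>
    exact ContinuousOn.comp (g := fun z : T × (E × H) => f z.1 z.2) hf
      (by fun_prop : Continuous fun z : (T × H) × E => (z.1.1, (z.2, z.1.2))).continuousOn
      fun _ hz => hz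
  | succ k ih =>
    obtain ⟨fc, df, f1, f2⟩ := hf
    have hc := ContinuousOn.comp (g := fun z : T × (E × H) => f z.1 z.2) fc
      (by fun_prop : Continuous fun z : (T × H) × E => (z.1.1, (z.2, z.1.2))).continuousOn
      (s := {z : (T × H) × E | (z.1.1, (z.2, z.1.2)) ∈ Ω}) fun _ hz => hz
    let L : (E × E) × (H × H) →L[ℝ] (E × H) × (E × H) :=
      (((ContinuousLinearMap.fst ℝ E E).comp (ContinuousLinearMap.fst ℝ (E × E) (H × H))).prod
        ((ContinuousLinearMap.fst ℝ H H).comp (ContinuousLinearMap.snd ℝ (E × E) (H × H)))).prod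
      (((ContinuousLinearMap.snd ℝ E E).comp (ContinuousLinearMap.fst ℝ (E × E) (H × H))).prod
        ((ContinuousLinearMap.snd ℝ H H).comp (ContinuousLinearMap.snd ℝ (E × E) (H × H))))
    have hL := ih (f2.comp_clm (Ω' := {z | (z.1, (z.2.1.1, z.2.2.1)) ∈ Ω}) continuous_id L
      fun z hz => hz)
    have hk : ParamCk k (fun (s : T × H) (z : E × E) => df s.1 ((z.1, s.2), (z.2, 0)))
        (tangentDomain {z | (z.1.1, (z.2, z.1.2)) ∈ Ω}) :=
      hL.comp_param (τ := fun s : T × H => (s.1, (s.2, (0 : H)))) (by fun_prop) fun z hz => hz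
    refine ⟨hc, _, ⟨fun z hz v => ?_, hk.continuousOn⟩, hk⟩
    refine (f1.hasDirDerivAt _ hz (v, 0)).congr (fun t => ?_)
    simp

/-- A parameter on which the map depends linearly may be regarded as a variable. -/
theorem prod_of_param [IsTopologicalAddGroup E] [ContinuousSMul ℝ E]
    [IsTopologicalAddGroup F] [ContinuousSMul ℝ F] [LocallyConvexSpace ℝ F] [T2Space F]
    [IsTopologicalAddGroup H] [ContinuousSMul ℝ H]
    {k : ℕ} {f : T × H → E → F} {Ω : Set (T × E)} (hΩ : IsOpen Ω)
    (hf : ParamCk k f {z | (z.1.1, z.2) ∈ Ω})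
    (hadd : ∀ z ∈ Ω, ∀ y y', f (z.1, y + y') z.2 = f (z.1, y) z.2 + f (z.1, y') z.2)
    (hsmul : ∀ z ∈ Ω, ∀ (c : ℝ) y, f (z.1, c • y) z.2 = c • f (z.1, y) z.2) :
    ParamCk k (fun t (z : E × H) => f (t, z.2) z.1) {z | (z.1, z.2.1) ∈ Ω} := by
  induction k generalizing E H with
  | zero =>
    exact ContinuousOn.comp (g := fun z : (T × H) × E => f z.1 z.2) hf
      (by fun_prop : Continuous fun z : T × (E × H) => ((z.1, z.2.2), z.2.1)).continuousOn
      fun _ hz => hz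
  | succ k ih =>
    have hk0 := ih hΩ hf.of_succ hadd hsmul
    have hΩ' : IsOpen {z : (T × H) × E | (z.1.1, z.2) ∈ Ω} := hΩ.preimage (by fun_prop)
    obtain ⟨fc, df, f1, f2⟩ := hf
    have hd := f1.hasDirDerivAt
    have hdf := ih (f := df) hΩ.tangentDomain f2
      (fun z hz y y' => by
        refine (hd ((z.1, y + y'), z.2.1) hz z.2.2).unique (Tendsto.congr' ?_
          (Tendsto.add (hd ((z.1, y), z.2.1) hz z.2.2) (hd ((z.1, y'), z.2.1) hz z.2.2)))
        have hc : Continuous fun t : ℝ => (z.1, z.2.1 + t • z.2.2) := by fun_prop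
        have hz' : (z.1, z.2.1) ∈ Ω := hz
        have : ∀ᶠ t : ℝ in 𝓝 0, (z.1, z.2.1 + t • z.2.2) ∈ Ω :=
          (hΩ.preimage hc).mem_nhds (by simpa using hz')
        filter_upwards [this.filter_mono nhdsWithin_le_nhds] with t ht
        have h1 := hadd _ ht y y'
        have h2 := hadd _ hz y y'
        simp only at h1 h2
        simp only [h1, h2]
        rw [← smul_add, add_sub_add_comm])
      (fun z hz c y => by
        refine (hd ((z.1, c • y), z.2.1) hz z.2.2).unique (Tendsto.congr' ?_
          (Tendsto.const_smul (hd ((z.1, y), z.2.1) hz z.2.2) c))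
        have hc : Continuous fun t : ℝ => (z.1, z.2.1 + t • z.2.2) := by fun_prop
        have hz' : (z.1, z.2.1) ∈ Ω := hz
        have : ∀ᶠ t : ℝ in 𝓝 0, (z.1, z.2.1 + t • z.2.2) ∈ Ω :=
          (hΩ.preimage hc).mem_nhds (by simpa using hz')
        filter_upwards [this.filter_mono nhdsWithin_le_nhds] with t ht
        have h1 := hsmul _ ht c y
        have h2 := hsmul _ hz c y
        simp only at h1 h2
        simp only [h1, h2]
        rw [← smul_sub, smul_comm])
    let e1 := ContinuousLinearMap.fst ℝ (E × H) (E × H)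
    let e2 := ContinuousLinearMap.snd ℝ (E × H) (E × H)
    let a := ContinuousLinearMap.fst ℝ E H
    let b := ContinuousLinearMap.snd ℝ E H
    have h3 := hdf.comp_clm continuous_id (((a.comp e1).prod (a.comp e2)).prod (b.comp e1))
      (Ω' := tangentDomain {z | (z.1, z.2.1) ∈ Ω}) fun z hz => hz
    have h4 := hk0.comp_clm continuous_id ((a.comp e1).prod (b.comp e2))
      (Ω' := tangentDomain {z | (z.1, z.2.1) ∈ Ω}) fun z hz => hz
    have h5 := h3.add h4
    have hc : ContinuousOn (fun z : T × (E × H) => f (z.1, z.2.2) z.2.1) {z | (z.1, z.2.1) ∈ Ω} :=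
      ContinuousOn.comp (g := fun z : (T × H) × E => f z.1 z.2) fc
        (by fun_prop : Continuous fun z : T × (E × H) => ((z.1, z.2.2), z.2.1)).continuousOn
        fun _ hz => hz
    refine ⟨hc, _, ⟨fun z hz v => ?_, h5.continuousOn⟩, h5⟩
    have hc2 : Tendsto (fun s : ℝ => ((z.1, v.2), z.2.1 + s • v.1)) (𝓝[≠] 0)
        (𝓝 ((z.1, v.2), z.2.1)) := by
      have : Continuous fun s : ℝ => ((z.1, v.2), z.2.1 + s • v.1) := by fun_prop
      simpa using (this.tendsto 0).mono_left nhdsWithin_le_nhds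
    have h6 : Tendsto (fun s : ℝ => f (z.1, v.2) (z.2.1 + s • v.1)) (𝓝[≠] 0)
        (𝓝 (f (z.1, v.2) z.2.1)) := by
      have hz' : ((z.1, v.2), z.2.1) ∈ {z : (T × H) × E | (z.1.1, z.2) ∈ Ω} := hz
      exact (fc.continuousAt (hΩ'.mem_nhds hz')).tendsto.comp hc2
    have h7 := hd ((z.1, z.2.2), z.2.1) hz v.1
    refine Tendsto.congr' ?_ (Tendsto.add h7 h6)
    have hev : ∀ᶠ s : ℝ in 𝓝[≠] 0, ((z.1, v.2), z.2.1 + s • v.1) ∈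
        {z : (T × H) × E | (z.1.1, z.2) ∈ Ω} := hc2.eventually (hΩ'.mem_nhds hz)
    filter_upwards [hev, self_mem_nhdsWithin] with s hs hs0
    have hs0 : s ≠ 0 := hs0
    have h8 := hadd _ hs z.2.2 (s • v.2)
    have h9 := hsmul _ hs s v.2
    simp only at h8 h9
    simp only [Prod.snd_add, Prod.smul_snd, Prod.fst_add, Prod.smul_fst, h8, h9]
    rw [add_sub_right_comm, smul_add _ _ (s • _), smul_smul, inv_mul_cancel₀ hs0, one_smul]

end Exchange

end ParamCk

end ParamCk

/-! ### Comparison with iterated directional derivatives -/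

section Keller

universe u

open Classical in
/-- The directional derivative of `f` at `x` in the direction `v` (and `0` if it does not exist). -/
noncomputable def dirDeriv {E F : Type*} [AddCommGroup E] [Module ℝ E] [AddCommGroup F] [Module ℝ F]
    [TopologicalSpace F] [TopologicalSpace E] (f : E → F) (x v : E) : F :=
  if h : ∃ w, HasDirDerivAt f x v w then h.choose else 0

theorem HasDirDerivAt.dirDeriv_eq {E F : Type*} [AddCommGroup E] [Module ℝ E] [AddCommGroup F]
    [Module ℝ F] [TopologicalSpace F] [TopologicalSpace E] [T2Space F] {f : E → F} {x v : E} {w : F}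
    (h : HasDirDerivAt f x v w) : dirDeriv f x v = w := by
  have h' : ∃ w, HasDirDerivAt f x v w := ⟨w, h⟩
  rw [dirDeriv, dif_pos h']
  exact h'.choose_spec.unique h

variable {E : Type u} [AddCommGroup E] [Module ℝ E] [TopologicalSpace E]
  [IsTopologicalAddGroup E] [ContinuousSMul ℝ E]
  {F : Type*} [AddCommGroup F] [Module ℝ F] [TopologicalSpace F]
  [IsTopologicalAddGroup F] [ContinuousSMul ℝ F] [LocallyConvexSpace ℝ F] [T2Space F]

/-- The directions of an iterated directional derivative, which enter linearly, are parameters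
here until `ParamCk.prod_of_param` turns the last one into a variable. -/
theorem KellerSmoothOn.paramCk {f : E → F} {U : Set E} (hf : KellerSmoothOn f U) (hU : IsOpen U)
    (k : ℕ) : ParamCk k (fun (_ : Unit) x => f x) {z | z.2 ∈ U} := by
  obtain ⟨d, hd0, hd, hdc⟩ := hf
  have hU' : ∀ j, IsOpen {z : (Fin j → E) × E | z.2 ∈ U} := fun j => hU.preimage continuous_snd
  have hc : ∀ j, ContinuousOn (fun z : (Fin j → E) × E => d j z.2 z.1) {z | z.2 ∈ U} := fun j =>
    (hdc j).comp (f := fun z : (Fin j → E) × E => (z.2, z.1)) (by fun_prop)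
      fun z hz => ⟨hz, mem_univ _⟩
  have hd' : ∀ j, HasContDirDerivOn (fun (y : Fin j → E) x => d j x y)
      (fun y z => d (j + 1) z.1 (Fin.snoc (α := fun _ => E) y z.2)) {z | z.2 ∈ U} := by
    intro j
    refine ⟨fun z hz v => ?_, ?_⟩
    · have := hd j z.2 hz (Fin.snoc (α := fun _ => E) z.1 v)
      simpa using this
    · refine (hdc (j + 1)).comp
        (f := fun z : (Fin j → E) × (E × E) => (z.2.1, Fin.snoc (α := fun _ => E) z.1 z.2.2)) ?_
        fun z hz => ⟨hz, mem_univ _⟩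
      exact Continuous.continuousOn (by fun_prop)
  have key : ∀ k j, ParamCk k (fun (y : Fin j → E) x => d j x y) {z | z.2 ∈ U} := by
    intro k
    induction k with
    | zero => exact hc
    | succ k ih =>
      intro j
      refine ⟨hc j, _, hd' j, ?_⟩
      refine ParamCk.prod_of_param
        (f := fun (s : (Fin j → E) × E) x => d (j + 1) x (Fin.snoc (α := fun _ => E) s.1 s.2))
        (hU' j) ?_ ?_ ?_
      · exact (ih (j + 1)).comp_param (τ := fun s : (Fin j → E) × E =>
          Fin.snoc (α := fun _ => E) s.1 s.2) (by fun_prop) fun z hz => hz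
      · intro z hz v w
        exact (hd' j).map_add (hU' j) hz v w
      · intro z hz c v
        exact (hd' j).map_smul hz c v
  refine ((key k 0).comp_param (τ := fun _ : Unit => (Fin.elim0 : Fin 0 → E)) continuous_const
    (Ω' := {z | z.2 ∈ U}) fun z hz => hz).congr (hU.preimage continuous_snd) fun z hz => ?_
  exact hd0 z.2 hz _

/-- The iterated directional derivative `D_{yⱼ} ⋯ D_{y₁} f`. -/
noncomputable def iterDirDeriv (f : E → F) : (j : ℕ) → (Fin j → E) → E → F
  | 0, _ => f
  | j + 1, y => fun x => dirDeriv (iterDirDeriv f j (Fin.init y)) x (y (Fin.last j))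

theorem ParamCk.kellerSmoothOn {f : E → F} {U : Set E} (hU : IsOpen U)
    (hf : ∀ k, ParamCk k (fun (_ : Unit) x => f x) {z | z.2 ∈ U}) : KellerSmoothOn f U := by
  have hU' : ∀ j, IsOpen {z : (Fin j → E) × E | z.2 ∈ U} := fun j => hU.preimage continuous_snd
  have hinit : ∀ j, Continuous fun y : Fin (j + 1) → E => (Fin.init y : Fin j → E) := fun j =>
    continuous_pi fun i => continuous_apply _
  have key : ∀ j k, ParamCk k (iterDirDeriv f j) {z | z.2 ∈ U} := by
    intro j
    induction j with
    | zero =>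
      intro k
      exact (hf k).comp_param (τ := fun _ => ()) continuous_const fun z hz => hz
    | succ j ih =>
      intro k
      obtain ⟨-, df, h1, h2⟩ := ih (k + 1)
      have h3 := h2.param_of_prod.comp_param
        (τ := fun y : Fin (j + 1) → E => ((Fin.init y : Fin j → E), y (Fin.last j)))
        ((hinit j).prodMk (continuous_apply _)) (Ω' := {z | z.2 ∈ U}) fun z hz => hz
      refine h3.congr (hU' _) fun z hz => ?_
      exact (h1.hasDirDerivAt (Fin.init z.1, z.2) hz (z.1 (Fin.last j))).dirDeriv_eq.symm
  refine ⟨fun j x y => iterDirDeriv f j y x, fun x _ y => rfl, fun j x hx y => ?_, fun j => ?_⟩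
  · obtain ⟨-, df, h1, -⟩ := key j 1
    have h2 := h1.hasDirDerivAt (Fin.init y, x) hx (y (Fin.last j))
    change HasDirDerivAt _ _ _ (dirDeriv (iterDirDeriv f j (Fin.init y)) x (y (Fin.last j)))
    rw [h2.dirDeriv_eq]
    exact h2
  · exact (key j 0).continuousOn.comp (f := fun z : E × (Fin j → E) => (z.2, z.1))
      (by fun_prop) fun z hz => hz.1

end Keller

/-! ### Uniform estimates near a compact set -/

section Uniform

variable {T : Type*} [TopologicalSpace T]
  {E F H : Type*} [AddCommGroup E] [Module ℝ E] [TopologicalSpace E]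
  [IsTopologicalAddGroup E] [ContinuousSMul ℝ E] [LocallyConvexSpace ℝ E]
  [AddCommGroup F] [Module ℝ F] [TopologicalSpace F]
  [IsTopologicalAddGroup F] [ContinuousSMul ℝ F] [LocallyConvexSpace ℝ F]
  [AddCommGroup H] [Module ℝ H] [TopologicalSpace H]
  [IsTopologicalAddGroup H] [ContinuousSMul ℝ H] [LocallyConvexSpace ℝ H] [T2Space H]

theorem seminorm_le_of_homogeneous {g : F → H} (hsmul : ∀ (c : ℝ) v, g (c • v) = c • g v)
    {q : Seminorm ℝ H} {r : Seminorm ℝ F} {C : ℝ} (h : ∀ v, r v < 1 → q (g v) ≤ C) (v : F) :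
    q (g v) ≤ C * r v := by
  have key : ∀ ρ > r v, q (g v) ≤ C * ρ := by
    intro ρ hρ
    have hρ0 : 0 < ρ := (apply_nonneg r v).trans_lt hρ
    have h1 := h (ρ⁻¹ • v) (by
      rw [map_smul_eq_mul, norm_inv, Real.norm_eq_abs, abs_of_pos hρ0, inv_mul_lt_one₀ hρ0]
      exact hρ)
    rw [hsmul, map_smul_eq_mul, norm_inv, Real.norm_eq_abs, abs_of_pos hρ0,
      inv_mul_le_iff₀ hρ0] at h1
    linarith
  have hC : Tendsto (fun ρ => C * ρ) (𝓝[>] (r v)) (𝓝 (C * r v)) :=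
    ((continuous_const_mul C).tendsto _).mono_left nhdsWithin_le_nhds
  exact ge_of_tendsto hC (by filter_upwards [self_mem_nhdsWithin] with ρ hρ using key ρ hρ)

/-- A continuous map that is linear in `v` is bounded in `v` by a seminorm, uniformly on a compact
set of the other variable. -/
theorem exists_seminorm_bound {K : Set T} (hK : IsCompact K) {g : T → F → H}
    (hg : ContinuousOn (fun z : T × F => g z.1 z.2) (K ×ˢ univ))
    (hsmul : ∀ t ∈ K, ∀ (c : ℝ) v, g t (c • v) = c • g t v) (q : Seminorm ℝ H) (hq : Continuous q) :
    ∃ r : Seminorm ℝ F, Continuous r ∧ ∀ t ∈ K, ∀ v, q (g t v) ≤ r v := by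
  have key : ∃ r : Seminorm ℝ F, Continuous r ∧ ∀ t ∈ K, t ∈ K → ∀ v, q (g t v) ≤ r v := by
    refine hK.induction_on (p := fun S => ∃ r : Seminorm ℝ F, Continuous r ∧
      ∀ t ∈ S, t ∈ K → ∀ v, q (g t v) ≤ r v) ⟨0, continuous_const, by simp⟩ ?_ ?_ ?_
    · rintro s s' hs ⟨r, hr, h⟩
      exact ⟨r, hr, fun t ht => h t (hs ht)⟩
    · rintro s s' ⟨r, hr, h⟩ ⟨r', hr', h'⟩
      refine ⟨r + r', hr.add hr', fun t ht htK v => ?_⟩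
      have h1 := apply_nonneg r v
      have h2 := apply_nonneg r' v
      rw [add_apply]
      rcases ht with ht | ht
      · linarith [h t ht htK v]
      · linarith [h' t ht htK v]
    · intro t ht
      have h0 : g t 0 = 0 := by simpa using hsmul t ht 0 0
      have h1 : Tendsto (fun z : T × F => q (g z.1 z.2)) (𝓝[K ×ˢ univ] (t, 0)) (𝓝 0) := by
        have := (hq.tendsto _).comp (hg (t, 0) ⟨ht, mem_univ _⟩)
        simpa [h0, Function.comp_def] using this
      have h2 : ∀ᶠ z : T × F in 𝓝[K ×ˢ univ] (t, 0), q (g z.1 z.2) < 1 :=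
        h1.eventually (gt_mem_nhds one_pos)
      rw [nhdsWithin_prod_eq, nhdsWithin_univ] at h2
      obtain ⟨S, hS, W, hW, hSW⟩ := mem_prod_iff.1 h2
      obtain ⟨r, hr, hrW⟩ := exists_seminorm_lt_one_subset hW
      refine ⟨S, hS, r, hr, fun s hs hsK v => ?_⟩
      have := seminorm_le_of_homogeneous (hsmul s hsK) (q := q) (r := r) (C := 1)
        (fun v hv => (hSW (mk_mem_prod hs (hrW hv)) : q (g s v) < 1).le) v
      simpa using this
  obtain ⟨r, hr, h⟩ := key
  exact ⟨r, hr, fun t ht => h t ht ht⟩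

/-- A `C¹`-map `x ↦ c (t, v) x` which is linear in the parameter `v` satisfies a Lipschitz estimate,
uniformly along the graph of a continuous function on a compact set and with a seminorm in `v` as
Lipschitz constant. -/
theorem HasContDirDerivOn.exists_lipschitz {Ω : Set (T × E)} (hΩ : IsOpen Ω)
    {c : T × F → E → H} {dc : T × F → E × E → H}
    (hc : HasContDirDerivOn c dc {z | (z.1.1, z.2) ∈ Ω})
    (hsmul : ∀ z ∈ Ω, ∀ (a : ℝ) v, c (z.1, a • v) z.2 = a • c (z.1, v) z.2)
    {K : Set T} (hK : IsCompact K) {y : T → E} (hy : ContinuousOn y K)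
    (hyΩ : ∀ t ∈ K, (t, y t) ∈ Ω) (q : Seminorm ℝ H) (hq : Continuous q) :
    ∃ r : Seminorm ℝ E, Continuous r ∧ ∃ r' : Seminorm ℝ F, Continuous r' ∧
      ∀ t ∈ K, ∀ x, r (x - y t) < 1 → (t, x) ∈ Ω ∧
        ∀ v, q (c (t, v) x - c (t, v) (y t)) ≤ r (x - y t) * r' v := by
  have hΩ' : IsOpen {z : (T × F) × E | (z.1.1, z.2) ∈ Ω} := hΩ.preimage (by fun_prop)
  have key : ∃ r : Seminorm ℝ E, Continuous r ∧ ∃ r' : Seminorm ℝ F, Continuous r' ∧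
      ∀ t ∈ K, t ∈ K → ∀ x, r (x - y t) < 1 → (t, x) ∈ Ω ∧
        ∀ v, q (c (t, v) x - c (t, v) (y t)) ≤ r (x - y t) * r' v := by
    refine hK.induction_on (p := fun S => ∃ r : Seminorm ℝ E, Continuous r ∧
      ∃ r' : Seminorm ℝ F, Continuous r' ∧
      ∀ t ∈ S, t ∈ K → ∀ x, r (x - y t) < 1 → (t, x) ∈ Ω ∧
        ∀ v, q (c (t, v) x - c (t, v) (y t)) ≤ r (x - y t) * r' v)
      ⟨0, continuous_const, 0, continuous_const, by simp⟩ ?_ ?_ ?_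
    · rintro s s' hs ⟨r, hr, r', hr', h⟩
      exact ⟨r, hr, r', hr', fun t ht => h t (hs ht)⟩
    · rintro s s' ⟨r₁, hr₁, r₁', hr₁', h₁⟩ ⟨r₂, hr₂, r₂', hr₂', h₂⟩
      refine ⟨r₁ + r₂, hr₁.add hr₂, r₁' + r₂', hr₁'.add hr₂', fun t ht htK x hx => ?_⟩
      rw [add_apply] at hx
      have p1 := apply_nonneg r₁ (x - y t)
      have p2 := apply_nonneg r₂ (x - y t)
      rcases ht with ht | ht
      · obtain ⟨h3, h4⟩ := h₁ t ht htK x (by linarith)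
        refine ⟨h3, fun v => (h4 v).trans ?_⟩
        rw [add_apply, add_apply]
        have p3 := apply_nonneg r₂' v
        have p4 := apply_nonneg r₁' v
        exact mul_le_mul (by linarith) (by linarith) p4 (by linarith)
      · obtain ⟨h3, h4⟩ := h₂ t ht htK x (by linarith)
        refine ⟨h3, fun v => (h4 v).trans ?_⟩
        rw [add_apply, add_apply]
        have p3 := apply_nonneg r₁' v
        have p4 := apply_nonneg r₂' v
        exact mul_le_mul (by linarith) (by linarith) p4 (by linarith)
    · intro t ht
      have hyt : ((t, (0 : F)), y t) ∈ {z : (T × F) × E | (z.1.1, z.2) ∈ Ω} := hyΩ t ht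
      have hd0 : dc (t, 0) (y t, 0) = 0 := by
        simpa using hc.map_smul hyt 0 0
      have h1 := (hq.tendsto _).comp (hc.tendsto hΩ' hyt 0)
      rw [hd0, map_zero] at h1
      have h2 := eventually_nhdsWithin_iff.1 (h1.eventually (gt_mem_nhds one_pos))
      have h3 : ∀ᶠ w : (T × F) × E × E × ℝ in 𝓝 ((t, 0), y t, 0, 0),
          (w.1.1, w.2.1 + w.2.2.2 • w.2.2.1) ∈ Ω := by
        have hcont : Continuous fun w : (T × F) × E × E × ℝ =>
          (w.1.1, w.2.1 + w.2.2.2 • w.2.2.1) := by fun_prop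
        exact (hΩ.preimage hcont).mem_nhds (by simpa using hyΩ t ht)
      have h4 := h2.and h3
      rw [nhds_prod_eq, nhds_prod_eq, nhds_prod_eq, nhds_prod_eq] at h4
      obtain ⟨A, hA, B, hB, hAB⟩ := mem_prod_iff.1 h4
      obtain ⟨S, hS, V, hV, hSV⟩ := mem_prod_iff.1 hA
      obtain ⟨O, hO, C, hC, hOC⟩ := mem_prod_iff.1 hB
      obtain ⟨N, hN, D, hD, hND⟩ := mem_prod_iff.1 hC
      obtain ⟨ε₀, hε₀, hεD⟩ := Metric.mem_nhds_iff.1 hD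
      have hmin : 0 < min ε₀ 1 := lt_min hε₀ one_pos
      set ε := min ε₀ 1
      obtain ⟨r', hr', hrV⟩ := exists_seminorm_lt_one_subset hV
      have hN' : {x : E | ε⁻¹ • x ∈ N} ∈ 𝓝 (0 : E) := by
        have : Tendsto (fun x : E => ε⁻¹ • x) (𝓝 0) (𝓝 (ε⁻¹ • (0 : E))) :=
          (continuous_const_smul ε⁻¹).tendsto 0
        rw [smul_zero] at this
        exact this hN
      obtain ⟨r, hr, hrN⟩ := exists_seminorm_lt_one_subset hN'
      have hyO : ∀ᶠ t' in 𝓝[K] t, y t' ∈ O := (hy t ht) hO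
      have htS : ∀ᶠ t' in 𝓝[K] t, t' ∈ S := nhdsWithin_le_nhds hS
      refine ⟨{t' | t' ∈ S ∧ y t' ∈ O}, htS.and hyO, r, hr, r', hr', ?_⟩
      rintro t' ⟨htS, htO⟩ htK x hx
      -- `x` is reached from `y t'` by the step `s * ε` in the direction `(s * ε)⁻¹ • (x - y t')`,
      -- for every `s` between `r (x - y t')` and `1`
      have step : ∀ s : ℝ, r (x - y t') < s → s < 1 → (t', x) ∈ Ω ∧ ∀ v, r' v < 1 →
          q (c (t', v) x - c (t', v) (y t')) ≤ s := by
        intro s hs hs1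
        have hs0 : 0 < s := (apply_nonneg r _).trans_lt hs
        have hsε : 0 < s * ε := mul_pos hs0 hmin
        have hzN : (s * ε)⁻¹ • (x - y t') ∈ N := by
          have : s⁻¹ • (x - y t') ∈ {x : E | ε⁻¹ • x ∈ N} := hrN (by
            simp only [mem_ofPred_eq]
            rw [map_smul_eq_mul, norm_inv, Real.norm_eq_abs, abs_of_pos hs0, inv_mul_lt_one₀ hs0]
            exact hs)
          rw [mul_inv, mul_comm, ← smul_smul]
          exact this
        have hsD : s * ε ∈ D := hεD (by
          rw [Metric.mem_ball, dist_zero_right, Real.norm_eq_abs, abs_of_pos hsε]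
          exact (mul_lt_of_lt_one_left hmin hs1).trans_le (min_le_left _ _))
        have hx' : y t' + (s * ε) • (s * ε)⁻¹ • (x - y t') = x := by
          rw [smul_smul, mul_inv_cancel₀ hsε.ne', one_smul, add_sub_cancel]
        have hmem : ∀ v, r' v < 1 → (((t', v), y t', (s * ε)⁻¹ • (x - y t'), s * ε) :
            (T × F) × E × E × ℝ) ∈ A ×ˢ B := fun v hv =>
          mk_mem_prod (hSV (mk_mem_prod htS (hrV hv)))
            (hOC (mk_mem_prod htO (hND (mk_mem_prod hzN hsD))))
        refine ⟨?_, fun v hv => ?_⟩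
        · have := (hAB (hmem 0 (by simp))).2
          simp only [hx'] at this
          exact this
        · have := (hAB (hmem v hv)).1 hsε.ne'
          simp only [Function.comp_apply, hx'] at this
          rw [map_smul_eq_mul, norm_inv, Real.norm_eq_abs, abs_of_pos hsε, inv_mul_lt_one₀ hsε]
            at this
          exact this.le.trans (mul_le_of_le_one_right hs0.le (min_le_right _ _))
      obtain ⟨s₀, hs₀, hs₀1⟩ := exists_between hx
      have hxΩ := (step s₀ hs₀ hs₀1).1
      refine ⟨hxΩ, fun v => ?_⟩
      refine seminorm_le_of_homogeneous (g := fun v => c (t', v) x - c (t', v) (y t'))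
        (fun a v => ?_) (q := q) (r := r') (C := r (x - y t')) (fun v hv => ?_) v
      · have e1 := hsmul _ hxΩ a v
        have e2 := hsmul _ (hyΩ t' htK) a v
        simp only at e1 e2
        simp only [e1, e2, smul_sub]
      · have hlim : Tendsto (fun s : ℝ => s) (𝓝[>] (r (x - y t'))) (𝓝 (r (x - y t'))) :=
          nhdsWithin_le_nhds
        refine ge_of_tendsto hlim ?_
        filter_upwards [Ioo_mem_nhdsGT hx] with s hs using (step s hs.1 hs.2).2 v hv
  obtain ⟨r, hr, r', hr', h⟩ := key
  exact ⟨r, hr, r', hr', fun t ht => h t ht ht⟩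

end Uniform

/-! ### Superposition operators on spaces of continuous functions -/

section Superposition

universe u

variable {K : Type*} [TopologicalSpace K] [CompactSpace K]
  {E : Type u} [AddCommGroup E] [Module ℝ E] [TopologicalSpace E]
  [IsTopologicalAddGroup E] [ContinuousSMul ℝ E]
  {F : Type*} [AddCommGroup F] [Module ℝ F] [TopologicalSpace F]
  [IsTopologicalAddGroup F] [ContinuousSMul ℝ F]

theorem ContinuousMap.tendsto_nhds_iff_seminorm [LocallyConvexSpace ℝ F] {ι : Type*} {l : Filter ι}
    {u : ι → C(K, F)} {f : C(K, F)} :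
    Tendsto u l (𝓝 f) ↔ ∀ q : Seminorm ℝ F, Continuous q → ∀ ε > 0,
      ∀ᶠ i in l, ∀ t, q (u i t - f t) < ε := by
  let : UniformSpace F := IsTopologicalAddGroup.rightUniformSpace F
  have : IsUniformAddGroup F := isUniformAddGroup_of_addCommGroup
  rw [ContinuousMap.tendsto_iff_tendstoUniformly, TendstoUniformly, uniformity_eq_comap_nhds_zero]
  constructor
  · intro h q hq ε hε
    have hU : {x : F | q x < ε} ∈ 𝓝 (0 : F) :=
      (isOpen_Iio.preimage hq).mem_nhds (by simpa using hε)
    exact h _ (preimage_mem_comap hU)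
  · rintro h V hV
    obtain ⟨W, hW, hWV⟩ := mem_comap.1 hV
    obtain ⟨q, hq, hqW⟩ := exists_seminorm_lt_one_subset hW
    filter_upwards [h q hq 1 one_pos] with i hi t
    exact hWV (hqW (hi t))

open Classical in
/-- The superposition operator `y ↦ (t ↦ f t (y t))` on continuous functions, with the irrelevant
value `0` where the right-hand side fails to be continuous. -/
noncomputable def superposition (f : K → E → F) (y : C(K, E)) : C(K, F) :=
  if h : Continuous fun t => f t (y t) then ⟨_, h⟩ else 0

theorem superposition_apply {f : K → E → F} {Ω : Set (K × E)}
    (hf : ContinuousOn (fun z : K × E => f z.1 z.2) Ω) {y : C(K, E)} (hy : ∀ t, (t, y t) ∈ Ω) (t : K) :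
    superposition f y t = f t (y t) := by
  have h : Continuous fun t => f t (y t) :=
    hf.comp_continuous (f := fun t => (t, y t)) (by fun_prop) hy
  rw [superposition, dif_pos h]
  rfl

theorem isOpen_setOf_forall_mem {Ω : Set (K × E)} (hΩ : IsOpen Ω) :
    IsOpen {y : C(K, E) | ∀ t, (t, y t) ∈ Ω} := by
  rw [isOpen_iff_mem_nhds]
  intro y hy
  have := isCompact_univ.eventually_forall_of_forall_eventually (x₀ := y)
    (P := fun (y : C(K, E)) t => (t, y t) ∈ Ω) fun t _ => by
      have hc : Continuous fun z : C(K, E) × K => (z.2, z.1 z.2) := by fun_prop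
      exact (hΩ.preimage hc).mem_nhds (hy t)
  filter_upwards [this] with z hz t using hz t (mem_univ t)

/-- Pairing of continuous functions, as a continuous linear map. -/
noncomputable def ContinuousMap.pairL (K E F : Type*) [TopologicalSpace K] [CompactSpace K]
    [AddCommGroup E] [Module ℝ E] [TopologicalSpace E] [IsTopologicalAddGroup E]
    [ContinuousSMul ℝ E] [AddCommGroup F] [Module ℝ F] [TopologicalSpace F]
    [IsTopologicalAddGroup F] [ContinuousSMul ℝ F] :
    C(K, E) × C(K, F) →L[ℝ] C(K, E × F) where
  toFun z := z.1.prodMk z.2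
  map_add' _ _ := rfl
  map_smul' _ _ := rfl
  cont := by
    refine ContinuousMap.continuous_of_continuous_uncurry _ ?_
    have h1 : Continuous fun w : (C(K, E) × C(K, F)) × K => w.1.1 w.2 :=
      continuous_eval.comp ((continuous_fst.comp continuous_fst).prodMk continuous_snd)
    have h2 : Continuous fun w : (C(K, E) × C(K, F)) × K => w.1.2 w.2 :=
      continuous_eval.comp ((continuous_snd.comp continuous_fst).prodMk continuous_snd)
    exact h1.prodMk h2

@[simp] theorem ContinuousMap.pairL_apply (z : C(K, E) × C(K, F)) (t : K) :
    ContinuousMap.pairL K E F z t = (z.1 t, z.2 t) := rfl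

theorem ContinuousOn.superposition [LocallyConvexSpace ℝ F] {f : K → E → F} {Ω : Set (K × E)}
    (hΩ : IsOpen Ω) (hf : ContinuousOn (fun z : K × E => f z.1 z.2) Ω) :
    ContinuousOn (superposition f) {y : C(K, E) | ∀ t, (t, y t) ∈ Ω} := by
  intro y hy
  refine ContinuousAt.continuousWithinAt ?_
  refine ContinuousMap.tendsto_nhds_iff_seminorm.2 fun q hq ε hε => ?_
  have h1 : ∀ᶠ y' in 𝓝 y, ∀ t ∈ (univ : Set K), q (f t (y' t) - f t (y t)) < ε := by
    refine isCompact_univ.eventually_forall_of_forall_eventually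
      (P := fun (y' : C(K, E)) t => q (f t (y' t) - f t (y t)) < ε) fun t _ => ?_
    have hft := (hf.continuousAt (hΩ.mem_nhds (hy t))).tendsto
    have hc : Continuous fun z : C(K, E) × K => (z.2, z.1 z.2) := by fun_prop
    have hc' : Continuous fun z : C(K, E) × K => (z.2, y z.2) := by fun_prop
    have h2 := (hft.comp (hc.tendsto (y, t))).sub (hft.comp (hc'.tendsto (y, t)))
    rw [sub_self] at h2
    have h3 := (hq.tendsto _).comp h2
    rw [map_zero] at h3
    exact h3.eventually (gt_mem_nhds hε)
  filter_upwards [h1, (isOpen_setOf_forall_mem hΩ).mem_nhds hy] with y' hy' hyΩ t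
  rw [superposition_apply hf hyΩ, superposition_apply hf hy]
  exact hy' t (mem_univ t)

/-- Superposition operators inherit differentiability. -/
theorem ParamCk.superposition [LocallyConvexSpace ℝ F] {k : ℕ} {f : K → E → F} {Ω : Set (K × E)}
    (hΩ : IsOpen Ω) (hf : ParamCk k f Ω) :
    ParamCk k (fun (_ : Unit) y => superposition f y) {z | ∀ t, (t, z.2 t) ∈ Ω} := by
  induction k generalizing E with
  | zero => exact (ContinuousOn.superposition hΩ hf).comp continuousOn_snd fun z hz => hz
  | succ k ih =>
    obtain ⟨fc, df, f1, f2⟩ := hf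
    have hk := (ih hΩ.tangentDomain f2).comp_clm continuous_id (ContinuousMap.pairL K E E)
      (Ω' := tangentDomain {z | ∀ t, (t, z.2 t) ∈ Ω}) fun z hz => hz
    refine ⟨(ContinuousOn.superposition hΩ fc).comp continuousOn_snd fun z hz => hz, _,
      ⟨fun z hz v => ?_, hk.continuousOn⟩, hk⟩
    obtain ⟨_, y⟩ := z
    have hy : ∀ t, (t, y t) ∈ Ω := hz
    refine ContinuousMap.tendsto_nhds_iff_seminorm.2 fun q hq ε hε => ?_
    have h1 : ∀ᶠ s : ℝ in 𝓝 0, ∀ t ∈ (univ : Set K), s ≠ 0 →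
        q (s⁻¹ • (f t (y t + s • v t) - f t (y t)) - df t (y t, v t)) < ε := by
      refine isCompact_univ.eventually_forall_of_forall_eventually
        (P := fun (s : ℝ) t => s ≠ 0 →
          q (s⁻¹ • (f t (y t + s • v t) - f t (y t)) - df t (y t, v t)) < ε) fun t _ => ?_
      have hc : Continuous fun z : ℝ × K => (z.2, y z.2, v z.2, z.1) := by fun_prop
      have h2 : Tendsto (fun z : ℝ × K => (z.2, y z.2, v z.2, z.1)) (𝓝[{z | z.1 ≠ 0}] (0, t))
          (𝓝[{w | w.2.2.2 ≠ 0}] (t, y t, v t, 0)) :=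
        tendsto_nhdsWithin_iff.2 ⟨(hc.tendsto (0, t)).mono_left nhdsWithin_le_nhds,
          eventually_mem_nhdsWithin⟩
      have h3 := (f1.tendsto hΩ (hy t) (v t)).comp h2
      have h4 : Tendsto (fun z : ℝ × K => df z.2 (y z.2, v z.2)) (𝓝[{z | z.1 ≠ 0}] (0, t))
          (𝓝 (df t (y t, v t))) := by
        have hc' : Continuous fun z : ℝ × K => (z.2, (y z.2, v z.2)) := by fun_prop
        have hmem : tangentDomain Ω ∈ 𝓝 (t, (y t, v t)) := hΩ.tangentDomain.mem_nhds (hy t)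
        exact ((f1.continuousOn.continuousAt hmem).tendsto.comp (hc'.tendsto (0, t))).mono_left
          nhdsWithin_le_nhds
      have h5 := h3.sub h4
      rw [sub_self] at h5
      have h6 := (hq.tendsto _).comp h5
      rw [map_zero] at h6
      exact eventually_nhdsWithin_iff.1 (h6.eventually (gt_mem_nhds hε))
    have hcs : Continuous fun s : ℝ => y + s • v := by fun_prop
    have h2 : ∀ᶠ s : ℝ in 𝓝 0, ∀ t, (t, (y + s • v) t) ∈ Ω :=
      ((isOpen_setOf_forall_mem hΩ).preimage hcs).mem_nhds (by simpa using hy)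
    filter_upwards [h1.filter_mono nhdsWithin_le_nhds, h2.filter_mono nhdsWithin_le_nhds,
      self_mem_nhdsWithin] with s hs hsΩ hs0 t
    have e1 := superposition_apply fc hsΩ t
    have e2 := superposition_apply fc hy t
    have e3 := superposition_apply (y := ContinuousMap.pairL K E E (y, v)) f1.continuousOn hy t
    simp only [ContinuousMap.coe_smul, ContinuousMap.coe_sub, Pi.smul_apply, Pi.sub_apply]
    rw [e1, e2, e3]
    exact hs t (mem_univ t) hs0

end Superposition

/-! ### Smooth maps into the group, with parameters -/

section GroupSmooth

universe u

variable {T : Type*} [TopologicalSpace T]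
  {H : Type u} [AddCommGroup H] [Module ℝ H] [TopologicalSpace H]
  [IsTopologicalAddGroup H] [ContinuousSMul ℝ H]

/-- The map `f : T → H → G` is smooth on `Ω ⊆ T × H` in the variable from `H`, jointly continuously
with the parameter from `T`, when read in all charts of `G`. -/
def GroupSmoothOn (E : Type*) [AddCommGroup E] [Module ℝ E] [TopologicalSpace E] {G : Type*}
    [TopologicalSpace G] [ChartedSpace E G] (f : T → H → G) (Ω : Set (T × H)) : Prop :=
  ContinuousOn (fun z : T × H => f z.1 z.2) Ω ∧ ∀ ψ ∈ atlas E G, ∀ k,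
    ParamCk k (fun t x => ψ (f t x)) (Ω ∩ {z | f z.1 z.2 ∈ ψ.source})

variable {E : Type*} [AddCommGroup E] [Module ℝ E] [TopologicalSpace E]
  [IsTopologicalAddGroup E] [ContinuousSMul ℝ E] [LocallyConvexSpace ℝ E] [T2Space E]
  {G : Type*} [Group G] [TopologicalSpace G] [ChartedSpace E G]

namespace GroupSmoothOn

theorem isOpen_preimage {f : T → H → G} {Ω : Set (T × H)} (hf : GroupSmoothOn E f Ω)
    (hΩ : IsOpen Ω) {V : Set G} (hV : IsOpen V) : IsOpen (Ω ∩ {z | f z.1 z.2 ∈ V}) :=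
  hf.1.isOpen_inter_preimage hΩ hV

theorem mono {f : T → H → G} {Ω Ω' : Set (T × H)} (hf : GroupSmoothOn E f Ω) (h : Ω' ⊆ Ω) :
    GroupSmoothOn E f Ω' :=
  ⟨hf.1.mono h, fun ψ hψ k => (hf.2 ψ hψ k).mono (inter_subset_inter_left _ h)⟩

theorem of_param {c : T → G} (hc : Continuous c) (Ω : Set (T × H)) :
    GroupSmoothOn E (fun t (_ : H) => c t) Ω :=
  ⟨(hc.comp continuous_fst).continuousOn, fun ψ _ _ => ParamCk.of_param _
    (ψ.continuousOn.comp (hc.comp continuous_fst).continuousOn fun _ hz => hz.2)⟩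

theorem chart_symm [KellerLieGroup E G] {φ : OpenPartialHomeomorph G E} (hφ : φ ∈ atlas E G)
    (L : H →L[ℝ] E) : GroupSmoothOn E (fun (_ : T) (x : H) => φ.symm (L x)) {z | L z.2 ∈ φ.target} := by
  refine ⟨φ.symm.continuousOn.comp (f := fun z : T × H => L z.2) (by fun_prop) fun z hz => hz,
    fun ψ hψ k => ?_⟩
  have h := (KellerLieGroup.smooth_transition φ hφ ψ hψ).paramCk (φ.symm ≫ₕ ψ).open_source k
  refine h.comp_clm (τ := fun _ => ()) continuous_const L fun z hz => ?_
  simpa using hz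

theorem mul [IsTopologicalGroup G] [KellerLieGroup E G] {f g : T → H → G} {Ω : Set (T × H)}
    (hΩ : IsOpen Ω) (hf : GroupSmoothOn E f Ω) (hg : GroupSmoothOn E g Ω) :
    GroupSmoothOn E (fun t x => f t x * g t x) Ω := by
  have hc : ContinuousOn (fun z : T × H => f z.1 z.2 * g z.1 z.2) Ω := hf.1.mul hg.1
  refine ⟨hc, fun ψ hψ k => ?_⟩
  have hO := hc.isOpen_inter_preimage hΩ ψ.open_source
  refine ParamCk.of_local hO fun z hz => ?_
  set φ₁ := chartAt E (f z.1 z.2)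
  set φ₂ := chartAt E (g z.1 z.2)
  have h₁ := hf.isOpen_preimage hΩ φ₁.open_source
  have h₂ := hg.isOpen_preimage hΩ φ₂.open_source
  refine ⟨_, h₁.inter h₂, ⟨⟨hz.1, mem_chart_source E _⟩, ⟨hz.1, mem_chart_source E _⟩⟩, ?_⟩
  have hμ := (KellerLieGroup.smooth_mul (E := E) (G := G)).2 (φ₁.prod φ₂)
    (mem_image2_of_mem (chart_mem_atlas E _) (chart_mem_atlas E _)) ψ hψ
  have hU : IsOpen ((φ₁.target ×ˢ φ₂.target) ∩
      {x : E × E | φ₁.symm x.1 * φ₂.symm x.2 ∈ ψ.source}) := by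
    refine ContinuousOn.isOpen_inter_preimage
      (f := fun x : E × E => φ₁.symm x.1 * φ₂.symm x.2) ?_
      (φ₁.open_target.prod φ₂.open_target) ψ.open_source
    exact (φ₁.symm.continuousOn.comp continuousOn_fst fun x hx => hx.1).mul
      (φ₂.symm.continuousOn.comp continuousOn_snd fun x hx => hx.2)
  have hμ' := KellerSmoothOn.paramCk (f := fun x : E × E => ψ (φ₁.symm x.1 * φ₂.symm x.2)) hμ hU k
  have hpair : ParamCk k (fun t x => (φ₁ (f t x), φ₂ (g t x)))
      (Ω ∩ {z | f z.1 z.2 * g z.1 z.2 ∈ ψ.source} ∩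
        (Ω ∩ {z | f z.1 z.2 ∈ φ₁.source} ∩ (Ω ∩ {z | g z.1 z.2 ∈ φ₂.source}))) :=
    ((hf.2 φ₁ (chart_mem_atlas E _) k).mono fun w hw => hw.2.1).prodMk
      ((hg.2 φ₂ (chart_mem_atlas E _) k).mono fun w hw => hw.2.2)
  refine (hμ'.comp (hU.preimage continuous_snd) (τ := fun _ : T => ()) continuous_const hpair
    fun w hw => ?_).congr (hO.inter (h₁.inter h₂)) fun w hw => ?_
  · obtain ⟨⟨-, hw1⟩, ⟨-, hw2⟩, ⟨-, hw3⟩⟩ := hw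
    simp only [mem_ofPred_eq] at hw1 hw2 hw3
    refine ⟨⟨φ₁.map_source hw2, φ₂.map_source hw3⟩, ?_⟩
    change φ₁.symm (φ₁ (f w.1 w.2)) * φ₂.symm (φ₂ (g w.1 w.2)) ∈ ψ.source
    rwa [φ₁.left_inv hw2, φ₂.left_inv hw3]
  · obtain ⟨⟨-, hw1⟩, ⟨-, hw2⟩, ⟨-, hw3⟩⟩ := hw
    simp only [mem_ofPred_eq] at hw1 hw2 hw3 ⊢
    rw [φ₁.left_inv hw2, φ₂.left_inv hw3]

theorem inv [IsTopologicalGroup G] [KellerLieGroup E G] {f : T → H → G} {Ω : Set (T × H)}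
    (hΩ : IsOpen Ω) (hf : GroupSmoothOn E f Ω) :
    GroupSmoothOn E (fun t x => (f t x)⁻¹) Ω := by
  have hc : ContinuousOn (fun z : T × H => (f z.1 z.2)⁻¹) Ω := hf.1.inv
  refine ⟨hc, fun ψ hψ k => ?_⟩
  have hO := hc.isOpen_inter_preimage hΩ ψ.open_source
  refine ParamCk.of_local hO fun z hz => ?_
  set φ₁ := chartAt E (f z.1 z.2)
  have h₁ := hf.isOpen_preimage hΩ φ₁.open_source
  refine ⟨_, h₁, ⟨hz.1, mem_chart_source E _⟩, ?_⟩
  have hμ := (KellerLieGroup.smooth_inv (E := E) (G := G)).2 φ₁ (chart_mem_atlas E _) ψ hψ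
  have hU : IsOpen (φ₁.target ∩ {x : E | (φ₁.symm x)⁻¹ ∈ ψ.source}) :=
    φ₁.symm.continuousOn.inv.isOpen_inter_preimage φ₁.open_target ψ.open_source
  have hμ' := hμ.paramCk hU k
  refine (hμ'.comp (hU.preimage continuous_snd) (τ := fun _ : T => ()) continuous_const
    ((hf.2 φ₁ (chart_mem_atlas E _) k).mono (Ω' := Ω ∩ {z | (f z.1 z.2)⁻¹ ∈ ψ.source} ∩
      (Ω ∩ {z | f z.1 z.2 ∈ φ₁.source})) fun w hw => hw.2)
    fun w hw => ?_).congr (hO.inter h₁) fun w hw => ?_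
  · obtain ⟨⟨-, hw1⟩, -, hw2⟩ := hw
    refine ⟨φ₁.map_source hw2, ?_⟩
    simp only [mem_ofPred_eq] at hw1 hw2 ⊢
    rwa [φ₁.left_inv hw2]
  · obtain ⟨⟨-, hw1⟩, -, hw2⟩ := hw
    simp only [mem_ofPred_eq] at hw1 hw2 ⊢
    rw [φ₁.left_inv hw2]

end GroupSmoothOn

end GroupSmooth

/-! ### Derivatives of two-sided translations -/

section Partial

variable {T : Type*} [TopologicalSpace T]
  {M : Type*} [AddCommGroup M] [Module ℝ M] [TopologicalSpace M]
  [IsTopologicalAddGroup M] [ContinuousSMul ℝ M]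
  {N : Type*} [AddCommGroup N] [Module ℝ N] [TopologicalSpace N]
  [IsTopologicalAddGroup N] [ContinuousSMul ℝ N]
  {P : Type*} [AddCommGroup P] [Module ℝ P] [TopologicalSpace P]
  [IsTopologicalAddGroup P] [ContinuousSMul ℝ P] [LocallyConvexSpace ℝ P] [T2Space P]

theorem HasContDirDerivOn.dirDeriv_snd_eq {F : T → M × N → P} {dF : T → (M × N) × (M × N) → P}
    {Ω : Set (T × (M × N))} (hF : HasContDirDerivOn F dF Ω) {t : T} {x : M} {ξ : N}
    (h : (t, (x, ξ)) ∈ Ω) (w : N) :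
    HasDirDerivAt (fun ξ => F t (x, ξ)) ξ w (dF t ((x, ξ), (0, w))) ∧
      dirDeriv (fun ξ => F t (x, ξ)) ξ w = dF t ((x, ξ), (0, w)) := by
  have h1 : HasDirDerivAt (fun ξ => F t (x, ξ)) ξ w (dF t ((x, ξ), (0, w))) := by
    refine Tendsto.congr (fun s => ?_) (hF.hasDirDerivAt _ h (0, w))
    simp
  exact ⟨h1, h1.dirDeriv_eq⟩

/-- A partial derivative with respect to the second variable at a fixed point is smooth in the first
variable, with the direction as an additional parameter. -/
theorem ParamCk.dirDeriv_snd {F : T → M × N → P} {Ω : Set (T × (M × N))} (hΩ : IsOpen Ω) {k : ℕ}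
    (hF : ParamCk (k + 1) F Ω) (ξ : N) :
    ParamCk k (fun (s : T × N) x => dirDeriv (fun ξ => F s.1 (x, ξ)) ξ s.2)
      {z | (z.1.1, (z.2, ξ)) ∈ Ω} := by
  obtain ⟨-, dF, h1, h2⟩ := hF
  have hO : IsOpen {z : (T × N) × M | (z.1.1, (z.2, ξ)) ∈ Ω} := hΩ.preimage (by fun_prop)
  have hin : ParamCk k (fun (s : T × N) (x : M) => (((x, ξ), (0, s.2)) : (M × N) × (M × N)))
      {z | (z.1.1, (z.2, ξ)) ∈ Ω} :=
    ((ParamCk.clm k (ContinuousLinearMap.id ℝ M) _).prodMk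
      (ParamCk.of_param k continuousOn_const)).prodMk
      ((ParamCk.of_param k continuousOn_const).prodMk
        (ParamCk.of_param k (by fun_prop : Continuous fun z : (T × N) × M => z.1.2).continuousOn))
  exact (h2.comp hΩ.tangentDomain (τ := Prod.fst) continuous_fst hin fun z hz => hz).congr hO
    fun z hz => ((h1.dirDeriv_snd_eq hz z.1.2).2).symm

end Partial

section Translations

universe u

variable {E : Type u} [AddCommGroup E] [Module ℝ E] [TopologicalSpace E]
  [IsTopologicalAddGroup E] [ContinuousSMul ℝ E] [LocallyConvexSpace ℝ E] [T2Space E]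
  {G : Type*} [Group G] [TopologicalSpace G] [ChartedSpace E G]

/-- The tangent vector `h.w.k`, i.e. the image of `w ∈ 𝔤` under the tangent map at `e` of the two-sided
translation `x ↦ h x k`, in the chart `ψ` around `h k`. Like in `IsLeftTranslate`, the Lie algebra is
identified with `E` by means of the preferred chart around `e`. -/
noncomputable def translDeriv (ψ : OpenPartialHomeomorph G E) (h k : G) (w : E) : E :=
  dirDeriv (fun x => ψ (h * (chartAt E (1 : G)).symm x * k)) (chartAt E (1 : G) 1) w

/-- The adjoint action of `G` on its Lie algebra. -/
noncomputable def adjointAction (E : Type*) [AddCommGroup E] [Module ℝ E] [TopologicalSpace E]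
    {G : Type*} [Group G] [TopologicalSpace G] [ChartedSpace E G] (g : G) (w : E) : E :=
  translDeriv (chartAt E (1 : G)) g g⁻¹ w

theorem chartAt_one_symm_apply_one : (chartAt E (1 : G)).symm (chartAt E (1 : G) 1) = 1 :=
  (chartAt E (1 : G)).left_inv (mem_chart_source E 1)

theorem chartAt_one_apply_one_mem : chartAt E (1 : G) 1 ∈ (chartAt E (1 : G)).target :=
  (chartAt E (1 : G)).map_source (mem_chart_source E 1)

variable [IsTopologicalGroup G] [KellerLieGroup E G]

section Param

variable {T : Type*} [TopologicalSpace T]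
  {M : Type*} [AddCommGroup M] [Module ℝ M] [TopologicalSpace M]
  [IsTopologicalAddGroup M] [ContinuousSMul ℝ M]

/-- The domain of the map `(t, (x, ξ)) ↦ ψ (f t x * φ⁻¹ ξ * g t x)`, where `φ` is the preferred
chart around the neutral element. -/
def translDomain (ψ : OpenPartialHomeomorph G E) (f g : T → M → G) (Ω : Set (T × M)) :
    Set (T × (M × E)) :=
  {z | (z.1, z.2.1) ∈ Ω ∧ z.2.2 ∈ (chartAt E (1 : G)).target} ∩
    {z | f z.1 z.2.1 * (chartAt E (1 : G)).symm z.2.2 * g z.1 z.2.1 ∈ ψ.source}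

variable {Ω : Set (T × M)} {f g : T → M → G} {ψ : OpenPartialHomeomorph G E}

theorem mem_translDomain {t : T} {x : M} (h : (t, x) ∈ Ω) (hψ : f t x * g t x ∈ ψ.source) :
    (t, (x, chartAt E (1 : G) 1)) ∈ translDomain ψ f g Ω := by
  refine ⟨⟨h, chartAt_one_apply_one_mem⟩, ?_⟩
  simpa [chartAt_one_symm_apply_one] using hψ

theorem GroupSmoothOn.transl (hΩ : IsOpen Ω) (hf : GroupSmoothOn E f Ω) (hg : GroupSmoothOn E g Ω)
    (hψ : ψ ∈ atlas E G) : IsOpen (translDomain ψ f g Ω) ∧ ∀ k,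
      ParamCk k (fun t (z : M × E) => ψ (f t z.1 * (chartAt E (1 : G)).symm z.2 * g t z.1))
        (translDomain ψ f g Ω) := by
  set W : Set (T × (M × E)) := {z | (z.1, z.2.1) ∈ Ω ∧ z.2.2 ∈ (chartAt E (1 : G)).target}
  have hc : Continuous fun z : T × (M × E) => (z.1, z.2.1) := by fun_prop
  have hW : IsOpen W :=
    (hΩ.preimage hc).inter ((chartAt E (1 : G)).open_target.preimage (by fun_prop))
  have hfst : ∀ {f : T → M → G}, GroupSmoothOn E f Ω →
      GroupSmoothOn E (fun t (z : M × E) => f t z.1) W := fun hf =>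
    ⟨hf.1.comp hc.continuousOn fun z hz => hz.1, fun ψ hψ k =>
      (hf.2 ψ hψ k).comp_clm continuous_id (ContinuousLinearMap.fst ℝ M E)
        fun z hz => ⟨hz.1.1, hz.2⟩⟩
  have h := ((hfst hf).mul hW ((GroupSmoothOn.chart_symm (chart_mem_atlas E (1 : G))
    (ContinuousLinearMap.snd ℝ M E)).mono fun z hz => hz.2)).mul hW (hfst hg)
  exact ⟨h.isOpen_preimage hW ψ.open_source, h.2 ψ hψ⟩

theorem GroupSmoothOn.translDeriv (hΩ : IsOpen Ω) (hf : GroupSmoothOn E f Ω)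
    (hg : GroupSmoothOn E g Ω) (hψ : ψ ∈ atlas E G) (k : ℕ) :
    ParamCk k (fun (s : T × E) x => translDeriv ψ (f s.1 x) (g s.1 x) s.2)
      {z | (z.1.1, z.2) ∈ Ω ∧ f z.1.1 z.2 * g z.1.1 z.2 ∈ ψ.source} := by
  obtain ⟨hO, h⟩ := hf.transl hΩ hg hψ
  exact ((h (k + 1)).dirDeriv_snd hO (chartAt E (1 : G) 1)).mono
    fun z hz => mem_translDomain hz.1 hz.2

end Param

variable {ψ : OpenPartialHomeomorph G E}

theorem exists_hasContDirDerivOn_transl (hψ : ψ ∈ atlas E G) :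
    ∃ (Ω : Set ((G × G) × E)) (dF : G × G → E × E → E), IsOpen Ω ∧
      HasContDirDerivOn (fun (t : G × G) ξ => ψ (t.1 * (chartAt E (1 : G)).symm ξ * t.2)) dF Ω ∧
      (∀ h k, h * k ∈ ψ.source → ((h, k), chartAt E (1 : G) 1) ∈ Ω) := by
  have h1 : GroupSmoothOn E (fun (t : G × G) (_ : E) => t.1) univ :=
    GroupSmoothOn.of_param continuous_fst _
  have h2 : GroupSmoothOn E (fun (t : G × G) (_ : E) => t.2) univ :=
    GroupSmoothOn.of_param continuous_snd _
  obtain ⟨hO, h⟩ := h1.transl isOpen_univ h2 hψ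
  have h3 := (h 1).comp_clm continuous_id ((0 : E →L[ℝ] E).prod (ContinuousLinearMap.id ℝ E))
    (Ω' := {z | (z.1, ((0 : E), z.2)) ∈ translDomain ψ (fun (t : G × G) (_ : E) => t.1)
      (fun (t : G × G) (_ : E) => t.2) univ}) fun z hz => hz
  obtain ⟨-, dF, hdF, -⟩ := h3
  refine ⟨_, dF, hO.preimage (by fun_prop), hdF, fun h k hk => ?_⟩
  exact mem_translDomain (f := fun (t : G × G) (_ : E) => t.1) (g := fun (t : G × G) (_ : E) => t.2)
    (t := (h, k)) (mem_univ _) hk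

/-- The chain rule for two-sided translations of curves through the neutral element. -/
theorem HasDirDerivAt.transl (hψ : ψ ∈ atlas E G) {h k : G} (hk : h * k ∈ ψ.source)
    {H : Type*} [AddCommGroup H] [Module ℝ H] [TopologicalSpace H] {c : H → E} {x y : H} {w : E}
    (hc : HasDirDerivAt c x y w) (hcx : c x = chartAt E (1 : G) 1) :
    HasDirDerivAt (fun z => ψ (h * (chartAt E (1 : G)).symm (c z) * k)) x y
      (translDeriv ψ h k w) := by
  obtain ⟨Ω, dF, hO, hF, hmem⟩ := exists_hasContDirDerivOn_transl hψ
  have h1 := hF.hasDirDerivAt _ (hmem h k hk) w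
  rw [translDeriv, h1.dirDeriv_eq, ← hcx]
  refine hF.comp_hasDirDerivAt (t := (h, k)) hO ?_ hc
  rw [hcx]
  exact hmem h k hk

theorem hasDirDerivAt_transl (hψ : ψ ∈ atlas E G) {h k : G} (hk : h * k ∈ ψ.source) (w : E) :
    HasDirDerivAt (fun ξ => ψ (h * (chartAt E (1 : G)).symm ξ * k)) (chartAt E (1 : G) 1) w
      (translDeriv ψ h k w) :=
  HasDirDerivAt.transl hψ hk ((ContinuousLinearMap.id ℝ E).hasDirDerivAt _ _) rfl

theorem translDeriv_add (hψ : ψ ∈ atlas E G) {h k : G} (hk : h * k ∈ ψ.source) (v w : E) :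
    translDeriv ψ h k (v + w) = translDeriv ψ h k v + translDeriv ψ h k w := by
  obtain ⟨Ω, dF, hO, hF, hmem⟩ := exists_hasContDirDerivOn_transl hψ
  have h1 := hF.map_add hO (hmem h k hk) v w
  have h2 := fun w => (hF.hasDirDerivAt _ (hmem h k hk) w).dirDeriv_eq
  simpa only [translDeriv, h2] using h1

theorem translDeriv_smul (hψ : ψ ∈ atlas E G) {h k : G} (hk : h * k ∈ ψ.source) (c : ℝ) (w : E) :
    translDeriv ψ h k (c • w) = c • translDeriv ψ h k w := by
  obtain ⟨Ω, dF, hO, hF, hmem⟩ := exists_hasContDirDerivOn_transl hψ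
  have h1 := hF.map_smul (hmem h k hk) c w
  have h2 := fun w => (hF.hasDirDerivAt _ (hmem h k hk) w).dirDeriv_eq
  simpa only [translDeriv, h2] using h1

theorem continuousOn_translDeriv (hψ : ψ ∈ atlas E G) :
    ContinuousOn (fun z : (G × G) × E => translDeriv ψ z.1.1 z.1.2 z.2)
      {z | z.1.1 * z.1.2 ∈ ψ.source} := by
  obtain ⟨Ω, dF, hO, hF, hmem⟩ := exists_hasContDirDerivOn_transl hψ
  refine (hF.continuousOn.comp (f := fun z : (G × G) × E => (z.1, (chartAt E (1 : G) 1, z.2)))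
    (by fun_prop) fun z hz => hmem _ _ hz).congr fun z hz => ?_
  exact (hF.hasDirDerivAt _ (hmem _ _ hz) z.2).dirDeriv_eq

theorem translDeriv_chartAt_one (w : E) : translDeriv (chartAt E (1 : G)) (1 : G) 1 w = w := by
  refine HasDirDerivAt.dirDeriv_eq ?_
  refine HasDirDerivAt.congr_of_eventuallyEq ((ContinuousLinearMap.id ℝ E).hasDirDerivAt _ w) ?_
  have hc : Continuous fun t : ℝ => chartAt E (1 : G) 1 + t • w := by fun_prop
  have : ∀ᶠ t : ℝ in 𝓝 0, chartAt E (1 : G) 1 + t • w ∈ (chartAt E (1 : G)).target :=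
    ((chartAt E (1 : G)).open_target.preimage hc).mem_nhds
      (by simp)
  filter_upwards [this] with t ht
  simp [(chartAt E (1 : G)).right_inv ht]

theorem isLeftTranslate_translDeriv (hψ : ψ ∈ atlas E G) {g : G} (hg : g ∈ ψ.source) (v : E) :
    IsLeftTranslate ψ g v (translDeriv ψ g 1 v) := by
  have := hasDirDerivAt_transl hψ (h := g) (k := 1) (by simpa using hg) v
  simpa [IsLeftTranslate] using this

theorem IsLeftTranslate.eq_translDeriv (hψ : ψ ∈ atlas E G) {g : G} (hg : g ∈ ψ.source) {v w : E}
    (h : IsLeftTranslate ψ g v w) : w = translDeriv ψ g 1 v :=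
  HasDirDerivAt.unique h (isLeftTranslate_translDeriv hψ hg v)

theorem adjointAction_add (g : G) (v w : E) :
    adjointAction E g (v + w) = adjointAction E g v + adjointAction E g w :=
  translDeriv_add (chart_mem_atlas E 1) (by simp) v w

theorem adjointAction_smul (g : G) (c : ℝ) (w : E) :
    adjointAction E g (c • w) = c • adjointAction E g w :=
  translDeriv_smul (chart_mem_atlas E 1) (by simp) c w

theorem continuous_adjointAction : Continuous fun z : G × E => adjointAction E z.1 z.2 :=
  (continuousOn_translDeriv (chart_mem_atlas E (1 : G))).comp_continuous
    (f := fun z : G × E => ((z.1, z.1⁻¹), z.2)) (by fun_prop) fun z => by simp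

/-- The map `(x, y) ↦ φ₁⁻¹(x) φ₂⁻¹(y)⁻¹` is smooth when read in the chart `ψ`. -/
theorem exists_hasContDirDerivOn_div {φ₁ φ₂ : OpenPartialHomeomorph G E} (h₁ : φ₁ ∈ atlas E G)
    (h₂ : φ₂ ∈ atlas E G) (hψ : ψ ∈ atlas E G) :
    ∃ (Ω : Set (Unit × (E × E))), IsOpen Ω ∧
      (∀ k, ParamCk k (fun (_ : Unit) (z : E × E) => ψ (φ₁.symm z.1 * (φ₂.symm z.2)⁻¹)) Ω) ∧
      (∀ g ∈ φ₁.source, ∀ h ∈ φ₂.source, g * h⁻¹ ∈ ψ.source → ((), (φ₁ g, φ₂ h)) ∈ Ω) := by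
  have hW : IsOpen {z : Unit × (E × E) | z.2.1 ∈ φ₁.target ∧ z.2.2 ∈ φ₂.target} :=
    (φ₁.open_target.preimage (by fun_prop : Continuous fun z : Unit × (E × E) => z.2.1)).inter
      (φ₂.open_target.preimage (by fun_prop : Continuous fun z : Unit × (E × E) => z.2.2))
  have hs₁ := (GroupSmoothOn.chart_symm (T := Unit) h₁ (ContinuousLinearMap.fst ℝ E E)).mono
    (Ω' := {z : Unit × (E × E) | z.2.1 ∈ φ₁.target ∧ z.2.2 ∈ φ₂.target}) fun z hz => hz.1
  have hs₂ := (GroupSmoothOn.chart_symm (T := Unit) h₂ (ContinuousLinearMap.snd ℝ E E)).mono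
    (Ω' := {z : Unit × (E × E) | z.2.1 ∈ φ₁.target ∧ z.2.2 ∈ φ₂.target}) fun z hz => hz.2
  have hs := hs₁.mul hW (hs₂.inv hW)
  refine ⟨_, hs.isOpen_preimage hW ψ.open_source, hs.2 ψ hψ, fun g hg h hh hgh => ?_⟩
  refine ⟨⟨φ₁.map_source hg, φ₂.map_source hh⟩, ?_⟩
  change φ₁.symm (φ₁ g) * (φ₂.symm (φ₂ h))⁻¹ ∈ ψ.source
  rwa [φ₁.left_inv hg, φ₂.left_inv hh]

theorem hasDirDerivAt_line (x a : E) : HasDirDerivAt (fun s : ℝ => x + s • a) 0 1 a := by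
  refine Tendsto.congr' ?_ tendsto_const_nhds
  filter_upwards [self_mem_nhdsWithin] with t ht
  have ht : t ≠ 0 := ht
  simp [smul_smul, inv_mul_cancel₀ ht]

theorem tendsto_chartAt_one_symm_line (a : E) :
    Tendsto (fun s : ℝ => (chartAt E (1 : G)).symm (chartAt E (1 : G) 1 + s • a)) (𝓝 0) (𝓝 1) := by
  have h1 : Tendsto (fun s : ℝ => chartAt E (1 : G) 1 + s • a) (𝓝 0) (𝓝 (chartAt E (1 : G) 1)) := by
    have : Continuous fun s : ℝ => chartAt E (1 : G) 1 + s • a := by fun_prop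
    simpa using this.tendsto 0
  have h2 := ((chartAt E (1 : G)).symm.continuousAt chartAt_one_apply_one_mem).tendsto.comp h1
  rwa [chartAt_one_symm_apply_one] at h2

theorem hasDirDerivAt_div_lines (a b : E) :
    HasDirDerivAt (fun s : ℝ => chartAt E (1 : G)
      ((chartAt E (1 : G)).symm (chartAt E (1 : G) 1 + s • a) *
        ((chartAt E (1 : G)).symm (chartAt E (1 : G) 1 + s • b))⁻¹)) 0 1 (a - b) := by
  set φ := chartAt E (1 : G) with hφ
  obtain ⟨Ω, hΩ, hck, hmem⟩ := exists_hasContDirDerivOn_div (chart_mem_atlas E (1 : G))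
    (chart_mem_atlas E (1 : G)) (chart_mem_atlas E (1 : G))
  obtain ⟨-, dm, hm, -⟩ := hck 1
  have h1 : (1 : G) ∈ φ.source := mem_chart_source E 1
  have h0 : ((), (φ 1, φ 1)) ∈ Ω := hmem 1 h1 1 h1 (by simp)
  have key : ∀ a b : E, HasDirDerivAt (fun s : ℝ => φ (φ.symm (φ 1 + s • a) *
      (φ.symm (φ 1 + s • b))⁻¹)) 0 1 (dm () ((φ 1, φ 1), (a, b))) := by
    intro a b
    have := hm.comp_hasDirDerivAt (t := ()) hΩ (x := (0 : ℝ)) (by simpa using h0)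
      ((hasDirDerivAt_line (φ 1) a).prodMk (hasDirDerivAt_line (φ 1) b))
    simpa using this
  have e1 : dm () ((φ 1, φ 1), (a - b, 0)) = a - b := by
    refine (key (a - b) 0).unique ?_
    refine (hasDirDerivAt_line (φ 1) (a - b)).congr_of_eventuallyEq ?_
    have hc : Continuous fun s : ℝ => φ 1 + s • (a - b) := by fun_prop
    have : ∀ᶠ s : ℝ in 𝓝 0, φ 1 + s • (a - b) ∈ φ.target :=
      (φ.open_target.preimage hc).mem_nhds (by simp [h1])
    filter_upwards [this] with s hs
    simp [φ.right_inv hs, φ.left_inv h1]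
  have e2 : dm () ((φ 1, φ 1), (b, b)) = 0 := by
    refine (key b b).unique ?_
    simpa using hasDirDerivAt_const (φ 1) (0 : ℝ) (1 : ℝ)
  have e3 := hm.map_add hΩ h0 (a - b, 0) (b, b)
  simp only [Prod.mk_add_mk, sub_add_cancel, zero_add, e1, e2, add_zero] at e3
  rw [← e3]
  exact key a b

/-- If `g.a` and `h.b` are tangent vectors at `g` and `h`, then `(x, y) ↦ x y⁻¹` maps them to
`g h⁻¹ . Ad(h)(a - b)`. -/
theorem HasContDirDerivOn.div_apply {φ₁ φ₂ : OpenPartialHomeomorph G E} (h₁ : φ₁ ∈ atlas E G)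
    (h₂ : φ₂ ∈ atlas E G) (hψ : ψ ∈ atlas E G) {Ω : Set (Unit × (E × E))} (hΩ : IsOpen Ω)
    {df : Unit → (E × E) × (E × E) → E} (hf : HasContDirDerivOn
      (fun (_ : Unit) (z : E × E) => ψ (φ₁.symm z.1 * (φ₂.symm z.2)⁻¹)) df Ω)
    {g h : G} (hg : g ∈ φ₁.source) (hh : h ∈ φ₂.source) (hgh : g * h⁻¹ ∈ ψ.source)
    (hmem : ((), (φ₁ g, φ₂ h)) ∈ Ω) (a b : E) :
    df () ((φ₁ g, φ₂ h), (translDeriv φ₁ g 1 a, translDeriv φ₂ h 1 b)) =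
      translDeriv ψ (g * h⁻¹) 1 (adjointAction E h (a - b)) := by
  set φ := chartAt E (1 : G) with hφ
  have hφ1 : (1 : G) ∈ φ.source := mem_chart_source E 1
  have hX := HasDirDerivAt.transl h₁ (h := g) (k := 1) (by simpa using hg)
    (hasDirDerivAt_line (φ 1) a) (by simp [hφ])
  have hY := HasDirDerivAt.transl h₂ (h := h) (k := 1) (by simpa using hh)
    (hasDirDerivAt_line (φ 1) b) (by simp [hφ])
  have hXY := hf.comp_hasDirDerivAt (t := ()) hΩ (x := (0 : ℝ))
    (by simpa [← hφ, φ.left_inv hφ1] using hmem) (hX.prodMk hY)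
  have hk := hasDirDerivAt_div_lines (G := G) a b
  have hk2 := hk.transl (chart_mem_atlas E (1 : G)) (h := h) (k := h⁻¹) (by simp)
    (by simp)
  have hk3 := hk2.transl hψ (h := g * h⁻¹) (k := 1) (by simpa using hgh)
    (by simp [← hφ, φ.left_inv hφ1])
  simp only [zero_smul, add_zero, mul_one, ← hφ, φ.left_inv hφ1] at hXY hk3
  refine hXY.unique (hk3.congr_of_eventuallyEq ?_)
  have hp := tendsto_chartAt_one_symm_line (G := G) a
  have hr := tendsto_chartAt_one_symm_line (G := G) b
  rw [← hφ] at hp hr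
  have t1 := (hp.mul hr.inv)
  have t2 := (t1.const_mul h).mul_const h⁻¹
  have t3 := hp.const_mul g
  have t4 := hr.const_mul h
  simp only [inv_one, mul_one, mul_inv_cancel] at t1 t2 t3 t4
  filter_upwards [t1.eventually (φ.open_source.mem_nhds hφ1),
    t2.eventually (φ.open_source.mem_nhds hφ1), t3.eventually (φ₁.open_source.mem_nhds hg),
    t4.eventually (φ₂.open_source.mem_nhds hh)] with s s1 s2 s3 s4
  simp only [zero_add, smul_eq_mul, mul_one]
  rw [φ.left_inv s1, φ.left_inv s2, φ₁.left_inv s3, φ₂.left_inv s4]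
  congr 1
  group

/-- Change of charts for tangent vectors `g.v`. -/
theorem exists_hasContDirDerivOn_transition {φ : OpenPartialHomeomorph G E} (hφ : φ ∈ atlas E G)
    (hψ : ψ ∈ atlas E G) :
    ∃ df : Unit → E × E → E,
      (∀ k, ParamCk k (fun (_ : Unit) x => ψ (φ.symm x)) {z | z.2 ∈ (φ.symm ≫ₕ ψ).source}) ∧
      HasContDirDerivOn (fun (_ : Unit) x => ψ (φ.symm x)) df {z | z.2 ∈ (φ.symm ≫ₕ ψ).source} ∧
      ∀ g ∈ φ.source, g ∈ ψ.source → ∀ v,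
        df () (φ g, translDeriv φ g 1 v) = translDeriv ψ g 1 v := by
  have hck := (KellerLieGroup.smooth_transition φ hφ ψ hψ).paramCk (φ.symm ≫ₕ ψ).open_source
  obtain ⟨-, df, hdf, -⟩ := hck 1
  refine ⟨df, hck, hdf, fun g hg hgψ v => ?_⟩
  have h1 := hasDirDerivAt_transl hφ (h := g) (k := 1) (by simpa using hg) v
  have h2 := hdf.comp_hasDirDerivAt (t := ())
    ((φ.symm ≫ₕ ψ).open_source.preimage continuous_snd)
    (by simp [φ.left_inv hg, φ.map_source hg, hgψ]) h1
  simp only [chartAt_one_symm_apply_one, mul_one] at h2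
  refine h2.unique ?_
  have h3 := hasDirDerivAt_transl hψ (h := g) (k := 1) (by simpa using hgψ) v
  refine h3.congr_of_eventuallyEq ?_
  have t3 := (tendsto_chartAt_one_symm_line (G := G) v).const_mul g
  rw [mul_one] at t3
  filter_upwards [t3.eventually (φ.open_source.mem_nhds hg)] with s hs
  simp [φ.left_inv hs]

end Translations

/-! ### Lebesgue spaces and weak integrals -/

section WeakIntegral

variable {E : Type*} [AddCommGroup E] [Module ℝ E] [TopologicalSpace E]
  [IsTopologicalAddGroup E] [ContinuousSMul ℝ E]
  {F : Type*} [AddCommGroup F] [Module ℝ F] [TopologicalSpace F]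
  [IsTopologicalAddGroup F] [ContinuousSMul ℝ F]

theorem LusinMeasurableOn.mono {X : Type*} [TopologicalSpace X] {γ : ℝ → X} {I J : Set ℝ}
    (h : LusinMeasurableOn γ I) (hJ : IsClosed J) (hJI : J ⊆ I) : LusinMeasurableOn γ J := by
  obtain ⟨K, hK, h0⟩ := h
  refine ⟨fun j => K j ∩ J, fun j => ⟨(hK j).1.inter_right hJ, inter_subset_right,
    (hK j).2.2.mono inter_subset_left⟩, measure_mono_null ?_ h0⟩
  rintro t ⟨ht, h⟩
  refine ⟨hJI ht, fun hc => h ?_⟩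
  obtain ⟨j, hj⟩ := mem_iUnion.1 hc
  exact mem_iUnion.2 ⟨j, hj, ht⟩

theorem LusinMeasurableOn.comp_param {X Y : Type*} [TopologicalSpace X] [TopologicalSpace Y]
    {γ : ℝ → X} {I : Set ℝ} (h : LusinMeasurableOn γ I) {f : ℝ → X → Y}
    (hf : ContinuousOn (fun z : ℝ × X => f z.1 z.2) (I ×ˢ univ)) :
    LusinMeasurableOn (fun t => f t (γ t)) I := by
  obtain ⟨K, hK, h0⟩ := h
  exact ⟨K, fun j => ⟨(hK j).1, (hK j).2.1, hf.comp (f := fun t => (t, γ t))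
    (continuousOn_id.prodMk (hK j).2.2) fun t ht => ⟨(hK j).2.1 ht, mem_univ _⟩⟩, h0⟩

theorem MemLusinLp.mono {p : ℝ≥0∞} {γ : ℝ → E} {I J : Set ℝ} (h : MemLusinLp p γ I)
    (hJ : IsClosed J) (hJI : J ⊆ I) : MemLusinLp p γ J :=
  ⟨h.1.mono hJ hJI, fun q hq => (eLpNorm_mono_measure _ (Measure.restrict_mono hJI le_rfl)).trans_lt
    (h.2 q hq)⟩

theorem MemLusinLp.one {p : ℝ≥0∞} (hp : 1 ≤ p) {γ : ℝ → E} {a b : ℝ}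
    (h : MemLusinLp p γ (Icc a b)) : MemLusinLp 1 γ (Icc a b) :=
  ⟨h.1, fun q hq => ((h.memLp q hq).mono_exponent hp).2⟩

/-- The image of an `ℒ^p`-function under a family of linear maps depending continuously on `t`. -/
theorem MemLusinLp.comp_linear [LocallyConvexSpace ℝ E] [LocallyConvexSpace ℝ F] [T2Space F]
    {p : ℝ≥0∞} {γ : ℝ → E} {a b : ℝ} (h : MemLusinLp p γ (Icc a b)) {c : ℝ → E → F}
    (hc : ContinuousOn (fun z : ℝ × E => c z.1 z.2) (Icc a b ×ˢ univ))
    (hsmul : ∀ t ∈ Icc a b, ∀ (x : ℝ) v, c t (x • v) = x • c t v) :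
    MemLusinLp p (fun t => c t (γ t)) (Icc a b) := by
  refine ⟨h.1.comp_param hc, fun q hq => ?_⟩
  obtain ⟨r, hr, hle⟩ := exists_seminorm_bound isCompact_Icc hc hsmul q hq
  refine (eLpNorm_mono_ae_real ?_).trans_lt (h.2 r hr)
  filter_upwards [ae_restrict_mem measurableSet_Icc] with t ht
  rw [Real.norm_eq_abs, abs_of_nonneg (apply_nonneg q _)]
  exact hle t ht _

theorem MemLusinLp.prodMk {p : ℝ≥0∞} {γ : ℝ → E} {δ : ℝ → F} {I : Set ℝ}
    (hγ : MemLusinLp p γ I) (hδ : MemLusinLp p δ I) : MemLusinLp p (fun t => (γ t, δ t)) I := by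
  have h1 : (fun t => (γ t, δ t)) = (fun t => (γ t, (0 : F))) + fun t => ((0 : E), δ t) := by
    ext t <;> simp
  refine ⟨?_, fun q hq => ?_⟩
  · rw [h1]
    exact (hγ.1.comp (f := fun x => (x, (0 : F))) (by fun_prop)).add
      (hδ.1.comp (f := fun x => ((0 : E), x)) (by fun_prop))
  · have e1 := hγ.memLp (q.comp (LinearMap.inl ℝ E F))
      (hq.comp (by fun_prop : Continuous fun x : E => (x, (0 : F))))
    have e2 := hδ.memLp (q.comp (LinearMap.inr ℝ E F))
      (hq.comp (by fun_prop : Continuous fun x : F => ((0 : E), x)))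
    refine lt_of_le_of_lt (eLpNorm_mono_real fun t => ?_) (e1.add e2).2
    rw [Real.norm_eq_abs, abs_of_nonneg (apply_nonneg q _)]
    simpa using map_add_le_add q (γ t, 0) (0, δ t)

theorem MemLusinLp.integrableOn_seminorm {γ : ℝ → E} {I : Set ℝ} (h : MemLusinLp 1 γ I)
    (q : Seminorm ℝ E) (hq : Continuous q) : IntegrableOn (fun t => q (γ t)) I :=
  memLp_one_iff_integrable.1 (h.memLp q hq)

/-- The continuous seminorm `x ↦ |l x|`. -/
noncomputable def dualSeminorm (l : E →L[ℝ] ℝ) : Seminorm ℝ E :=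
  (normSeminorm ℝ ℝ).comp l.toLinearMap

theorem dualSeminorm_apply (l : E →L[ℝ] ℝ) (x : E) : dualSeminorm l x = |l x| := rfl

theorem continuous_dualSeminorm (l : E →L[ℝ] ℝ) : Continuous (dualSeminorm l) :=
  l.continuous.abs

theorem MemLusinLp.integrableOn_dual {γ : ℝ → E} {I : Set ℝ} (h : MemLusinLp 1 γ I)
    (l : E →L[ℝ] ℝ) : IntegrableOn (fun t => l (γ t)) I :=
  (h.integrableOn_seminorm (dualSeminorm l) (continuous_dualSeminorm l)).mono'
    (h.1.comp l.continuous).aestronglyMeasurable (ae_of_all _ fun _ => le_rfl)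

theorem IntegrableOn.intervalIntegrable_of_mem_Icc {f : ℝ → ℝ} {a b s t : ℝ}
    (h : IntegrableOn f (Icc a b)) (hs : s ∈ Icc a b) (ht : t ∈ Icc a b) :
    IntervalIntegrable f volume s t := by
  refine (h.mono_set ?_).intervalIntegrable
  exact uIcc_subset_Icc hs ht

namespace IsWeakIntegral

variable {γ δ : ℝ → E} {a b c : ℝ} {v w : E}

theorem unique [LocallyConvexSpace ℝ E] [T2Space E] (h : IsWeakIntegral γ a b v)
    (h' : IsWeakIntegral γ a b w) : v = w := by
  by_contra hne
  obtain ⟨l, hl⟩ := SeparatingDual.exists_separating_of_ne (R := ℝ) hne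
  exact hl ((h l).trans (h' l).symm)

theorem congr_ae (h : IsWeakIntegral γ a b v) (hab : a ≤ b)
    (hγδ : ∀ᵐ s ∂volume.restrict (Icc a b), γ s = δ s) : IsWeakIntegral δ a b v := by
  intro l
  rw [h l]
  refine intervalIntegral.integral_congr_ae_restrict ?_
  rw [uIoc_of_le hab]
  filter_upwards [ae_restrict_of_ae_restrict_of_subset Ioc_subset_Icc_self hγδ] with s hs
  rw [hs]

/-- The fundamental estimate for weak integrals. -/
theorem seminorm_le [LocallyConvexSpace ℝ E] (h : IsWeakIntegral γ a b v) (hab : a ≤ b)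
    {q : Seminorm ℝ E} (hq : Continuous q) {g : ℝ → ℝ} (hg : IntervalIntegrable g volume a b)
    (hle : ∀ s ∈ Icc a b, q (γ s) ≤ g s) : q v ≤ ∫ s in a..b, g s := by
  obtain ⟨l, hl, hlq⟩ := exists_dual_eq_seminorm q hq v
  rw [← hl, h l]
  refine (le_abs_self _).trans ((Real.norm_eq_abs _).symm.le.trans ?_)
  refine intervalIntegral.norm_integral_le_of_norm_le hab (ae_of_all _ fun s hs => ?_) hg
  exact (hlq _).trans (hle s (Ioc_subset_Icc_self hs))

theorem add_adjacent (h : IsWeakIntegral γ a b v) (h' : IsWeakIntegral γ b c w)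
    (hi : ∀ l : E →L[ℝ] ℝ, IntervalIntegrable (fun s => l (γ s)) volume a b)
    (hi' : ∀ l : E →L[ℝ] ℝ, IntervalIntegrable (fun s => l (γ s)) volume b c) :
    IsWeakIntegral γ a c (v + w) := by
  intro l
  rw [map_add, h l, h' l, intervalIntegral.integral_add_adjacent_intervals (hi l) (hi' l)]

theorem sub (h : IsWeakIntegral γ a b v) (h' : IsWeakIntegral δ a b w)
    (hi : ∀ l : E →L[ℝ] ℝ, IntervalIntegrable (fun s => l (γ s)) volume a b)
    (hi' : ∀ l : E →L[ℝ] ℝ, IntervalIntegrable (fun s => l (δ s)) volume a b) :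
    IsWeakIntegral (fun s => γ s - δ s) a b (v - w) := by
  intro l
  simp only [map_sub]
  rw [h l, h' l, intervalIntegral.integral_sub (hi l) (hi' l)]

theorem add (h : IsWeakIntegral γ a b v) (h' : IsWeakIntegral δ a b w)
    (hi : ∀ l : E →L[ℝ] ℝ, IntervalIntegrable (fun s => l (γ s)) volume a b)
    (hi' : ∀ l : E →L[ℝ] ℝ, IntervalIntegrable (fun s => l (δ s)) volume a b) :
    IsWeakIntegral (fun s => γ s + δ s) a b (v + w) := by
  intro l
  simp only [map_add]
  rw [h l, h' l, intervalIntegral.integral_add (hi l) (hi' l)]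

theorem smul (h : IsWeakIntegral γ a b v) (x : ℝ) :
    IsWeakIntegral (fun s => x • γ s) a b (x • v) := by
  intro l
  simp [h l]

end IsWeakIntegral

/-! ### Absolutely continuous functions -/

namespace HasACDerivOn

theorem isWeakIntegral {η γ : ℝ → E} {a b s t : ℝ} (h : HasACDerivOn η γ a b) (hs : s ∈ Icc a b)
    (ht : t ∈ Icc a b) : IsWeakIntegral γ s t (η t - η s) := by
  intro l
  have ha : a ∈ Icc a b := ⟨le_rfl, hs.1.trans hs.2⟩
  have e1 := h.2 t ht l
  have e2 := h.2 s hs l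
  have hi := h.1.integrableOn_dual l
  rw [← intervalIntegral.integral_interval_sub_left (a := a)
    (IntegrableOn.intervalIntegrable_of_mem_Icc hi ha ht)
    (IntegrableOn.intervalIntegrable_of_mem_Icc hi ha hs), ← e1, ← e2, ← map_sub]
  congr 1
  abel

theorem mono {η γ : ℝ → E} {a b s t : ℝ} (h : HasACDerivOn η γ a b) (hs : s ∈ Icc a b)
    (ht : t ∈ Icc a b) : HasACDerivOn η γ s t :=
  ⟨h.1.mono isClosed_Icc (Icc_subset_Icc hs.1 ht.2),
    fun _ hu => h.isWeakIntegral hs (Icc_subset_Icc hs.1 ht.2 hu)⟩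

theorem prodMk {η γ : ℝ → E} {ζ δ : ℝ → F} {a b : ℝ} (h : HasACDerivOn η γ a b)
    (h' : HasACDerivOn ζ δ a b) :
    HasACDerivOn (fun t => (η t, ζ t)) (fun t => (γ t, δ t)) a b := by
  refine ⟨h.1.prodMk h'.1, fun t ht l => ?_⟩
  have ha : a ∈ Icc a b := ⟨le_rfl, ht.1.trans ht.2⟩
  let l₁ := l.comp (ContinuousLinearMap.inl ℝ E F)
  let l₂ := l.comp (ContinuousLinearMap.inr ℝ E F)
  have hl : ∀ x y, l (x, y) = l₁ x + l₂ y := fun x y => by simp [l₁, l₂, ← map_add]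
  simp only [Prod.mk_sub_mk, hl]
  rw [h.2 t ht l₁, h'.2 t ht l₂, intervalIntegral.integral_add
    (IntegrableOn.intervalIntegrable_of_mem_Icc (h.1.integrableOn_dual l₁) ha ht)
    (IntegrableOn.intervalIntegrable_of_mem_Icc (h'.1.integrableOn_dual l₂) ha ht)]

end HasACDerivOn

/-- A bound on the increments of `Φ` by those of `m` over short intervals extends to all intervals. -/
theorem abs_sub_le_of_local {Φ m : ℝ → ℝ} {a b δ : ℝ} (hδ : 0 < δ)
    (h : ∀ t ∈ Icc a b, ∀ t' ∈ Icc a b, t ≤ t' → t' - t < δ → |Φ t' - Φ t| ≤ m t' - m t)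
    {t t' : ℝ} (ht : t ∈ Icc a b) (ht' : t' ∈ Icc a b) (htt : t ≤ t') :
    |Φ t' - Φ t| ≤ m t' - m t := by
  have key : ∀ n : ℕ, ∀ t' ∈ Icc a b, t ≤ t' → t' - t < n * (δ / 2) → |Φ t' - Φ t| ≤ m t' - m t := by
    intro n
    induction n with
    | zero =>
      intro t' _ htt h0
      simp only [Nat.cast_zero, zero_mul] at h0
      linarith
    | succ n ih =>
      intro t' ht' htt hn
      by_cases hc : t' - t < δ
      · exact h t ht t' ht' htt hc
      · push Not at hc
        have hm : t' - δ / 2 ∈ Icc a b := ⟨by linarith [ht.1], by linarith [ht'.2]⟩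
        have h1 := ih (t' - δ / 2) hm (by linarith) (by push_cast at hn; linarith)
        have h2 := h (t' - δ / 2) hm t' ht' (by linarith) (by linarith)
        calc |Φ t' - Φ t| ≤ |Φ t' - Φ (t' - δ / 2)| + |Φ (t' - δ / 2) - Φ t| := abs_sub_le _ _ _
          _ ≤ _ := by linarith
  obtain ⟨n, hn⟩ := exists_nat_gt ((t' - t) / (δ / 2))
  exact key n t' ht' htt ((div_lt_iff₀ (half_pos hδ)).1 hn)

theorem exists_pos_forall_seminorm_sub_lt {η : ℝ → E} {a b : ℝ} (hη : ContinuousOn η (Icc a b))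
    {r : Seminorm ℝ E} (hr : Continuous r) {ε : ℝ} (hε : 0 < ε) :
    ∃ δ > 0, ∀ s ∈ Icc a b, ∀ t ∈ Icc a b, |t - s| < δ → r (η t - η s) < ε := by
  let : UniformSpace E := IsTopologicalAddGroup.rightUniformSpace E
  have : IsUniformAddGroup E := isUniformAddGroup_of_addCommGroup
  have hu := isCompact_Icc.uniformContinuousOn_of_continuous hη
  have hV : {z : E × E | r (z.2 - z.1) < ε} ∈ uniformity E := by
    rw [uniformity_eq_comap_nhds_zero]
    exact preimage_mem_comap (t := {x | r x < ε})
      ((isOpen_Iio.preimage hr).mem_nhds (by simpa using hε))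
  have := hu hV
  rw [mem_map, mem_inf_principal, Metric.mem_uniformity_dist] at this
  obtain ⟨δ, hδ, h⟩ := this
  refine ⟨δ, hδ, fun s hs t ht hst => h (a := s) (b := t) ?_ ⟨hs, ht⟩⟩
  rwa [dist_comm, Real.dist_eq]

end WeakIntegral

section ChainRule

universe u

variable {E : Type u} [AddCommGroup E] [Module ℝ E] [TopologicalSpace E]
  [IsTopologicalAddGroup E] [ContinuousSMul ℝ E] [LocallyConvexSpace ℝ E]
  {F : Type*} [AddCommGroup F] [Module ℝ F] [TopologicalSpace F]
  [IsTopologicalAddGroup F] [ContinuousSMul ℝ F] [LocallyConvexSpace ℝ F] [T2Space F]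

/-- The chain rule for absolutely continuous functions. The increments of `l ∘ f ∘ η`, for a
functional `l`, are compared with the integrals of `l (df (η, γ))` by means of the mean value theorem
on short intervals, where the error is small relative to the integral of a seminorm of `γ`. -/
theorem HasACDerivOn.comp {f : E → F} {df : Unit → E × E → F} {Ω : Set (Unit × E)} (hΩ : IsOpen Ω)
    (hf : HasContDirDerivOn (fun (_ : Unit) x => f x) df Ω) (hdf : ParamCk 1 df (tangentDomain Ω))
    {η γ : ℝ → E} {a b : ℝ} (hη : ContinuousOn η (Icc a b)) (hηΩ : ∀ s ∈ Icc a b, ((), η s) ∈ Ω)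
    (h : HasACDerivOn η γ a b) :
    HasACDerivOn (fun s => f (η s)) (fun s => df () (η s, γ s)) a b := by
  have hcont : ContinuousOn (fun z : ℝ × E => df () (η z.1, z.2)) (Icc a b ×ˢ univ) :=
    hf.continuousOn.comp (f := fun z : ℝ × E => ((), (η z.1, z.2)))
      (continuousOn_const.prodMk ((hη.comp continuousOn_fst fun z hz => hz.1).prodMk
        continuousOn_snd)) fun z hz => hηΩ _ hz.1
  have hL : MemLusinLp 1 (fun s => df () (η s, γ s)) (Icc a b) :=
    h.1.comp_linear (c := fun s v => df () (η s, v)) hcont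
      fun t ht x v => hf.map_smul (hηΩ t ht) x v
  refine ⟨hL, fun t ht l => ?_⟩
  have ha : a ∈ Icc a b := ⟨le_rfl, ht.1.trans ht.2⟩
  have hO : IsOpen {z : ℝ × E | ((), z.2) ∈ Ω} := hΩ.preimage (by fun_prop)
  -- the Lipschitz estimate for `x ↦ l (df (x, v))` near the curve `η`
  have hPC := hdf.param_of_prod.comp_param (τ := fun s : ℝ × E => ((), s.2)) (by fun_prop)
    (Ω' := {z : (ℝ × E) × E | (z.1.1, z.2) ∈ {z : ℝ × E | ((), z.2) ∈ Ω}}) fun z hz => hz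
  obtain ⟨-, dc, hdc, -⟩ := hPC
  obtain ⟨r, hr, r', hr', hlip⟩ := hdc.exists_lipschitz hO
    (fun z hz x v => hf.map_smul hz x v) isCompact_Icc hη hηΩ
    (dualSeminorm l) (continuous_dualSeminorm l)
  have hD := hL.integrableOn_dual l
  have hm := h.1.integrableOn_seminorm r' hr'
  have hiD : ∀ s ∈ Icc a b, ∀ s' ∈ Icc a b, IntervalIntegrable (fun u => l (df () (η u, γ u)))
    volume s s' := fun s hs s' hs' => IntegrableOn.intervalIntegrable_of_mem_Icc hD hs hs'
  have him : ∀ s ∈ Icc a b, ∀ s' ∈ Icc a b, IntervalIntegrable (fun u => r' (γ u)) volume s s' :=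
    fun s hs s' hs' => IntegrableOn.intervalIntegrable_of_mem_Icc hm hs hs'
  have key : ∀ ε : ℝ, 0 < ε → ε < 1 / 2 →
      |l (f (η t)) - l (f (η a)) - ∫ u in a..t, l (df () (η u, γ u))| ≤
        2 * ε * ∫ u in a..t, r' (γ u) := by
    intro ε hε hε2
    obtain ⟨δ, hδ, hδr⟩ := exists_pos_forall_seminorm_sub_lt hη hr hε
    have hloc : ∀ s ∈ Icc a b, ∀ s' ∈ Icc a b, s ≤ s' → s' - s < δ →
        |(l (f (η s')) - ∫ u in a..s', l (df () (η u, γ u))) -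
          (l (f (η s)) - ∫ u in a..s, l (df () (η u, γ u)))| ≤
        2 * ε * (∫ u in a..s', r' (γ u)) - 2 * ε * ∫ u in a..s, r' (γ u) := by
      intro s hs s' hs' hss hlt
      have hseg : ∀ σ ∈ Icc (0 : ℝ) 1, r (η s + σ • (η s' - η s) - η s) < ε := by
        intro σ hσ
        rw [add_sub_cancel_left, map_smul_eq_mul, Real.norm_eq_abs, abs_of_nonneg hσ.1]
        refine (mul_le_of_le_one_left (apply_nonneg r _) hσ.2).trans_lt (hδr s hs s' hs' ?_)
        rwa [abs_of_nonneg (sub_nonneg.2 hss)]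
      have hsegΩ : ∀ σ ∈ Icc (0 : ℝ) 1, ((), η s + σ • (η s' - η s)) ∈ Ω := fun σ hσ =>
        (hlip s hs _ ((hseg σ hσ).trans (by linarith))).1
      obtain ⟨σ, hσ, hmv⟩ := exists_sub_eq_of_hasDirDerivAt (f := fun x => l (f x)) (x := η s)
        (v := η s' - η s) (d := fun σ => l (df () (η s + σ • (η s' - η s), η s' - η s)))
        fun σ hσ => (hf.hasDirDerivAt _ (hsegΩ σ hσ) _).clm_comp l
      set ξ := η s + σ • (η s' - η s)
      let Λ : E →L[ℝ] ℝ :=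
        { toFun := fun v => l (df () (ξ, v))
          map_add' := fun v w => by rw [hf.map_add hΩ (hsegΩ σ hσ), map_add]
          map_smul' := fun x v => by rw [hf.map_smul (hsegΩ σ hσ), map_smul]; rfl
          cont := l.continuous.comp (hf.continuousOn.comp_continuous
            (f := fun v : E => ((), (ξ, v))) (by fun_prop) fun v => hsegΩ σ hσ) }
      have hΛ : Λ (η s' - η s) = ∫ u in s..s', Λ (γ u) := h.isWeakIntegral hs hs' Λ
      have hiΛ : IntervalIntegrable (fun u => Λ (γ u)) volume s s' :=
        IntegrableOn.intervalIntegrable_of_mem_Icc (h.1.integrableOn_dual Λ) hs hs'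
      rw [add_sub_cancel] at hmv
      have e1 : (l (f (η s')) - ∫ u in a..s', l (df () (η u, γ u))) -
          (l (f (η s)) - ∫ u in a..s, l (df () (η u, γ u))) =
          ∫ u in s..s', (Λ (γ u) - l (df () (η u, γ u))) := by
        rw [intervalIntegral.integral_sub hiΛ (hiD s hs s' hs'), ← hΛ,
          ← intervalIntegral.integral_interval_sub_left (hiD a ha s' hs') (hiD a ha s hs)]
        change _ = l (df () (ξ, η s' - η s)) - _
        rw [← hmv]
        ring
      have e2 : 2 * ε * (∫ u in a..s', r' (γ u)) - 2 * ε * ∫ u in a..s, r' (γ u) =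
          ∫ u in s..s', 2 * ε * r' (γ u) := by
        rw [intervalIntegral.integral_const_mul,
          ← intervalIntegral.integral_interval_sub_left (him a ha s' hs') (him a ha s hs)]
        ring
      rw [e1, e2, ← Real.norm_eq_abs]
      refine intervalIntegral.norm_integral_le_of_norm_le hss (ae_of_all _ fun u hu => ?_)
        ((him s hs s' hs').const_mul _)
      have huI : u ∈ Icc a b := ⟨hs.1.trans hu.1.le, hu.2.trans hs'.2⟩
      have hsu : r (η s - η u) < ε := hδr u huI s hs (by
        rw [abs_sub_comm, abs_of_nonneg (by linarith [hu.1])]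
        linarith [hu.2])
      have hξu : r (ξ - η u) < 2 * ε := by
        have e3 : ξ - η u = (ξ - η s) + (η s - η u) := by abel
        rw [e3]
        exact (map_add_le_add r _ _).trans_lt (by linarith [hseg σ hσ])
      have h4 := (hlip u huI ξ (hξu.trans (by linarith))).2 (γ u)
      rw [dualSeminorm_apply, map_sub] at h4
      exact h4.trans (mul_le_mul_of_nonneg_right hξu.le (apply_nonneg r' _))
    have := abs_sub_le_of_local hδ hloc ha ht ht.1
    simpa [sub_right_comm] using this
  have hzero : |l (f (η t)) - l (f (η a)) - ∫ u in a..t, l (df () (η u, γ u))| ≤ 0 := by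
    have hlim : Tendsto (fun ε : ℝ => 2 * ε * ∫ u in a..t, r' (γ u)) (𝓝[>] 0) (𝓝 0) := by
      have : Continuous fun ε : ℝ => 2 * ε * ∫ u in a..t, r' (γ u) := by fun_prop
      simpa using (this.tendsto 0).mono_left nhdsWithin_le_nhds
    refine ge_of_tendsto hlim ?_
    filter_upwards [Ioo_mem_nhdsGT (by norm_num : (0 : ℝ) < 1 / 2)] with ε hε
      using key ε hε.1 hε.2
  rw [map_sub]
  exact sub_eq_zero.1 (abs_nonpos_iff.1 hzero)

end ChainRule

/-! ### Subdivisions of intervals -/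

section Subdivision

/-- There is a subdivision of `[a, b]` all of whose pieces `[s, t]` satisfy `P s t`. -/
def HasSubdivision (P : ℝ → ℝ → Prop) : ℝ → ℝ → Prop :=
  Relation.ReflTransGen fun s t => s < t ∧ P s t

/-- The property `P` of intervals passes to subintervals. -/
def IsHereditary (P : ℝ → ℝ → Prop) : Prop :=
  ∀ ⦃s t s' t' : ℝ⦄, P s t → s ≤ s' → s' ≤ t' → t' ≤ t → P s' t'

namespace HasSubdivision

variable {P Q : ℝ → ℝ → Prop} {a b c d : ℝ}

theorem le (h : HasSubdivision P a b) : a ≤ b := by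
  induction h with
  | refl => exact le_rfl
  | tail _ h ih => exact ih.trans h.1.le

theorem mono (h : HasSubdivision P a b) (hPQ : ∀ s t, P s t → Q s t) : HasSubdivision Q a b :=
  Relation.ReflTransGen.mono (fun _ _ h => ⟨h.1, hPQ _ _ h.2⟩) _ _ h

theorem restrict (hP : IsHereditary P) (h : HasSubdivision P a b) (hac : a ≤ c) (hcd : c ≤ d)
    (hdb : d ≤ b) : HasSubdivision (fun s t => (c ≤ s ∧ t ≤ d) ∧ P s t) c d := by
  induction h generalizing c d with
  | refl =>
    obtain rfl : c = d := le_antisymm hcd (hdb.trans hac)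
    exact Relation.ReflTransGen.refl
  | @tail e f _ hef ih =>
    rcases le_total d e with hde | hed
    · exact ih hac hcd hde
    rcases le_total c e with hce | hec
    · have h1 : HasSubdivision (fun s t => (c ≤ s ∧ t ≤ d) ∧ P s t) c e :=
        (ih hac hce le_rfl).mono fun s t h => ⟨⟨h.1.1, h.1.2.trans hed⟩, h.2⟩
      rcases hed.eq_or_lt with rfl | hlt
      · exact h1
      · exact h1.tail ⟨hlt, ⟨hce, le_rfl⟩, hP hef.2 le_rfl hed hdb⟩
    · rcases hcd.eq_or_lt with rfl | hlt
      · exact Relation.ReflTransGen.refl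
      · exact Relation.ReflTransGen.single ⟨hlt, ⟨le_rfl, le_rfl⟩, hP hef.2 hec hcd hdb⟩

theorem inter (hP : IsHereditary P) (hQ : IsHereditary Q) (h : HasSubdivision P a b)
    (h' : HasSubdivision Q a b) : HasSubdivision (fun s t => P s t ∧ Q s t) a b := by
  induction h' with
  | refl => exact Relation.ReflTransGen.refl
  | @tail e f hae hef ih =>
    have hae' : a ≤ e := le hae
    have h1 := ih ((h.restrict hP le_rfl hae' hef.1.le).mono fun _ _ h => h.2)
    have h2 : HasSubdivision (fun s t => (s < t ∧ P s t) ∧ Q s t) e f := by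
      refine Relation.ReflTransGen.mono ?_ _ _ (h.restrict hP hae' hef.1.le le_rfl)
      rintro s t ⟨hst, ⟨hs, ht⟩, hPst⟩
      exact ⟨hst, ⟨hst, hPst⟩, hQ hef.2 hs hst.le ht⟩
    exact h1.trans (h2.mono fun _ _ h => ⟨h.1.2, h.2⟩)

theorem exists_points (h : HasSubdivision P a b) : ∃ (m : ℕ) (t : ℕ → ℝ), t 0 = a ∧ t m = b ∧
    ∀ j < m, t j < t (j + 1) ∧ P (t j) (t (j + 1)) := by
  induction h with
  | refl => exact ⟨0, fun _ => a, rfl, rfl, by simp⟩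
  | @tail e f _ hef ih =>
    obtain ⟨m, t, h0, hm, ht⟩ := ih
    refine ⟨m + 1, fun j => if j ≤ m then t j else f, by simp [h0], by simp, fun j hj => ?_⟩
    have hjm : j ≤ m := Nat.lt_succ_iff.1 hj
    rcases hjm.eq_or_lt with rfl | hlt
    · simpa [hm] using hef
    · have : j + 1 ≤ m := hlt
      simpa [hjm, this] using ht j hlt

theorem of_points {m : ℕ} {t : ℕ → ℝ} (ht : ∀ j < m, t j < t (j + 1) ∧ P (t j) (t (j + 1))) :
    HasSubdivision P (t 0) (t m) := by
  induction m with
  | zero => exact Relation.ReflTransGen.refl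
  | succ m ih => exact (ih fun j hj => ht j (hj.trans m.lt_succ_self)).tail (ht m m.lt_succ_self)

/-- Every subdivision of `[a, b]` consists of subintervals of `[a, b]`. -/
theorem subset_Icc (h : HasSubdivision P a b) :
    HasSubdivision (fun s t => (a ≤ s ∧ t ≤ b) ∧ P s t) a b := by
  induction h with
  | refl => exact Relation.ReflTransGen.refl
  | @tail e f hae hef ih =>
    exact (mono ih fun s t h => ⟨⟨h.1.1, h.1.2.trans hef.1.le⟩, h.2⟩).tail
      ⟨hef.1, ⟨le hae, le_rfl⟩, hef.2⟩

theorem of_open_cover {X ι : Type*} [TopologicalSpace X] {y : ℝ → X} (hy : Continuous y)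
    {U : ι → Set X} (hU : ∀ i, IsOpen (U i)) (hcov : ∀ x, ∃ i, x ∈ U i) :
    HasSubdivision (fun s t => ∃ i, ∀ u ∈ Icc s t, y u ∈ U i) 0 1 := by
  obtain ⟨t, h0, hmono, ⟨m, hm⟩, ht⟩ := exists_monotone_Icc_subset_open_cover_unitInterval
    (c := fun i => (fun s : unitInterval => y s) ⁻¹' U i)
    (fun i => (hU i).preimage (hy.comp continuous_subtype_val))
    (fun s _ => by simpa using hcov (y s))
  have key : ∀ n, HasSubdivision (fun s t => ∃ i, ∀ u ∈ Icc s t, y u ∈ U i) 0 (t n) := by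
    intro n
    induction n with
    | zero => rw [h0]; exact Relation.ReflTransGen.refl
    | succ n ih =>
      have hle : (t n : ℝ) ≤ t (n + 1) := hmono n.le_succ
      rcases hle.eq_or_lt with heq | hlt
      · rw [← heq]; exact ih
      · obtain ⟨i, hi⟩ := ht n
        refine ih.tail ⟨hlt, i, fun u hu => ?_⟩
        have hu' : u ∈ Icc (0 : ℝ) 1 := ⟨(t n).2.1.trans hu.1, hu.2.trans (t (n + 1)).2.2⟩
        exact @hi ⟨u, hu'⟩ ⟨hu.1, hu.2⟩
  have := key m
  rwa [hm m le_rfl] at this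

end HasSubdivision

end Subdivision

/-! ### Evolutions -/

section Evolutions

universe u

variable {E : Type u} [AddCommGroup E] [Module ℝ E] [TopologicalSpace E]
  [IsTopologicalAddGroup E] [ContinuousSMul ℝ E] [LocallyConvexSpace ℝ E] [T2Space E]
  {G : Type*} [Group G] [TopologicalSpace G] [ChartedSpace E G]

theorem HasACDerivOn.congr {η η' γ γ' : ℝ → E} {a b : ℝ} (h : HasACDerivOn η γ a b)
    (hη : ∀ s ∈ Icc a b, η s = η' s) (hγ : ∀ s ∈ Icc a b, γ s = γ' s) :
    HasACDerivOn η' γ' a b := by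
  refine ⟨⟨?_, fun q hq => ?_⟩, fun t ht => ?_⟩
  · obtain ⟨K, hK, h0⟩ := h.1.1
    exact ⟨K, fun j => ⟨(hK j).1, (hK j).2.1, (hK j).2.2.congr fun s hs =>
      (hγ s ((hK j).2.1 hs)).symm⟩, h0⟩
  · refine lt_of_le_of_lt (le_of_eq (eLpNorm_congr_ae ?_)) (h.1.2 q hq)
    filter_upwards [ae_restrict_mem measurableSet_Icc] with s hs
    rw [hγ s hs]
  · have ha : a ∈ Icc a b := ⟨le_rfl, ht.1.trans ht.2⟩
    rw [← hη t ht, ← hη a ha]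
    refine (h.2 t ht).congr_ae ht.1 ?_
    filter_upwards [ae_restrict_mem measurableSet_Icc] with s hs
    exact hγ s ⟨hs.1, hs.2.trans ht.2⟩

/-- On `[a, b]`, the function `y` takes its values in the domain of a chart and solves `y' = y.γ`. -/
def SolvesOn (γ : ℝ → E) (y : ℝ → G) (a b : ℝ) : Prop :=
  ∃ φ ∈ atlas E G, (∀ s ∈ Icc a b, y s ∈ φ.source) ∧
    HasACDerivOn (fun s => φ (y s)) (fun s => translDeriv φ (y s) 1 (γ s)) a b

theorem SolvesOn.isHereditary (γ : ℝ → E) (y : ℝ → G) : IsHereditary (SolvesOn γ y) := by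
  rintro s t s' t' ⟨φ, hφ, hy, h⟩ hs hst ht
  exact ⟨φ, hφ, fun u hu => hy u (Icc_subset_Icc hs ht hu),
    h.mono ⟨hs, hst.trans ht⟩ ⟨hs.trans hst, ht⟩⟩

variable [IsTopologicalGroup G] [KellerLieGroup E G]

theorem MemLusinLp.translDeriv {γ : ℝ → E} {a b : ℝ} {p : ℝ≥0∞} (hγ : MemLusinLp p γ (Icc a b))
    {y : ℝ → G} (hy : Continuous y) {φ : OpenPartialHomeomorph G E} (hφ : φ ∈ atlas E G)
    (hyφ : ∀ s ∈ Icc a b, y s ∈ φ.source) :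
    MemLusinLp p (fun s => translDeriv φ (y s) 1 (γ s)) (Icc a b) := by
  refine hγ.comp_linear (c := fun s v => _root_.translDeriv φ (y s) 1 v) ?_ fun t ht x v =>
    translDeriv_smul hφ (by simpa using hyφ t ht) x v
  refine (continuousOn_translDeriv hφ).comp (f := fun z : ℝ × E => ((y z.1, 1), z.2))
    (by fun_prop) fun z hz => ?_
  simpa using hyφ _ hz.1

theorem solvesOn_iff {γ : ℝ → E} {a b : ℝ} (hγ : MemLusinLp 1 γ (Icc a b))
    {y : ℝ → G} (hy : Continuous y) :
    SolvesOn γ y a b ↔ ∃ φ ∈ atlas E G, (∀ s ∈ Icc a b, y s ∈ φ.source) ∧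
      ∃ δ : ℝ → E, HasACDerivOn (fun s => φ (y s)) δ a b ∧
        ∀ᵐ s ∂volume.restrict (Icc a b), IsLeftTranslate φ (y s) (γ s) (δ s) := by
  constructor
  · rintro ⟨φ, hφ, hyφ, h⟩
    refine ⟨φ, hφ, hyφ, _, h, ?_⟩
    filter_upwards [ae_restrict_mem measurableSet_Icc] with s hs
    exact isLeftTranslate_translDeriv hφ (hyφ s hs) _
  · rintro ⟨φ, hφ, hyφ, δ, h, hδ⟩
    refine ⟨φ, hφ, hyφ, hγ.translDeriv hy hφ hyφ, fun t ht => (h.2 t ht).congr_ae ht.1 ?_⟩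
    filter_upwards [ae_restrict_of_ae_restrict_of_subset (Icc_subset_Icc_right ht.2) hδ,
      ae_restrict_mem measurableSet_Icc] with s hs hst
    exact hs.eq_translDeriv hφ (hyφ s ⟨hst.1, hst.2.trans ht.2⟩)

theorem isEvolution_iff {γ : ℝ → E} (hγ : MemLusinLp 1 γ (Icc 0 1)) {η : C(unitInterval, G)} :
    IsEvolution γ η ↔ η 0 = 1 ∧ HasSubdivision (SolvesOn γ (IccExtend zero_le_one η)) 0 1 := by
  have hy : Continuous (IccExtend zero_le_one η) := η.continuous.Icc_extend'
  have hsub : ∀ s t, (0 ≤ s ∧ t ≤ 1) → MemLusinLp 1 γ (Icc s t) := fun s t h =>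
    hγ.mono isClosed_Icc (Icc_subset_Icc h.1 h.2)
  refine and_congr_right fun _ => ⟨?_, fun h => ?_⟩
  · rintro ⟨m, t, h0, hm, hlt, ht⟩
    have h1 := HasSubdivision.of_points (P := fun s t => ∃ φ ∈ atlas E G,
      (∀ u ∈ Icc s t, IccExtend zero_le_one η u ∈ φ.source) ∧
      ∃ δ : ℝ → E, HasACDerivOn (fun u => φ (IccExtend zero_le_one η u)) δ s t ∧
        ∀ᵐ u ∂volume.restrict (Icc s t), IsLeftTranslate φ (IccExtend zero_le_one η u) (γ u) (δ u))
      (t := t) (m := m) fun j hj => ⟨hlt j hj, ht j hj⟩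
    rw [h0, hm] at h1
    refine h1.subset_Icc.mono fun s t h => ?_
    exact (solvesOn_iff (hsub s t h.1) hy).2 h.2
  · obtain ⟨m, t, h0, hm, ht⟩ := h.subset_Icc.exists_points
    exact ⟨m, t, h0, hm, fun j hj => (ht j hj).1, fun j hj =>
      (solvesOn_iff (hsub _ _ (ht j hj).2.1) hy).1 (ht j hj).2.2⟩

/-- The logarithmic derivative does not depend on the chart. -/
theorem SolvesOn.hasACDerivOn {γ : ℝ → E} {y : ℝ → G} (hy : Continuous y) {a b : ℝ}
    (h : SolvesOn γ y a b) {ψ : OpenPartialHomeomorph G E} (hψ : ψ ∈ atlas E G)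
    (hyψ : ∀ s ∈ Icc a b, y s ∈ ψ.source) :
    HasACDerivOn (fun s => ψ (y s)) (fun s => translDeriv ψ (y s) 1 (γ s)) a b := by
  obtain ⟨φ, hφ, hyφ, h⟩ := h
  obtain ⟨df, hck, hdf, happly⟩ := exists_hasContDirDerivOn_transition hφ hψ
  have hO : IsOpen {z : Unit × E | z.2 ∈ (φ.symm ≫ₕ ψ).source} :=
    (φ.symm ≫ₕ ψ).open_source.preimage continuous_snd
  obtain ⟨-, df', hdf', hdf1⟩ := hck 2
  have hmem : ∀ s ∈ Icc a b, ((), φ (y s)) ∈ {z : Unit × E | z.2 ∈ (φ.symm ≫ₕ ψ).source} := by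
    intro s hs
    simp [φ.left_inv (hyφ s hs), φ.map_source (hyφ s hs), hyψ s hs]
  have h1 := HasACDerivOn.comp hO hdf' hdf1
    (φ.continuousOn.comp hy.continuousOn hyφ) hmem h
  refine h1.congr (fun s hs => by simp only [Function.comp_apply]; rw [φ.left_inv (hyφ s hs)])
    fun s hs => ?_
  rw [← happly _ (hyφ s hs) (hyψ s hs)]
  exact (hdf'.hasDirDerivAt _ (hmem s hs) _).unique (hdf.hasDirDerivAt _ (hmem s hs) _)

/-- If `η' = η.γ` and `ζ' = ζ.δ`, then the quotient `η ζ⁻¹` solves the equation for `Ad(ζ)(γ - δ)`. -/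
theorem SolvesOn.div {γ δ : ℝ → E} {y z : ℝ → G} (hy : Continuous y) (hz : Continuous z) {a b : ℝ}
    (h : SolvesOn γ y a b) (h' : SolvesOn δ z a b) {ψ : OpenPartialHomeomorph G E}
    (hψ : ψ ∈ atlas E G) (hyzψ : ∀ s ∈ Icc a b, y s * (z s)⁻¹ ∈ ψ.source) :
    SolvesOn (fun s => adjointAction E (z s) (γ s - δ s)) (fun s => y s * (z s)⁻¹) a b := by
  obtain ⟨φ₁, h₁, hy₁, hγ⟩ := h
  obtain ⟨φ₂, h₂, hz₂, hδ⟩ := h'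
  refine ⟨ψ, hψ, hyzψ, ?_⟩
  obtain ⟨Ω, hΩ, hck, hmem⟩ := exists_hasContDirDerivOn_div h₁ h₂ hψ
  obtain ⟨-, df, hdf, hdf1⟩ := hck 2
  have hm : ∀ s ∈ Icc a b, ((), (φ₁ (y s), φ₂ (z s))) ∈ Ω := fun s hs =>
    hmem _ (hy₁ s hs) _ (hz₂ s hs) (hyzψ s hs)
  refine (HasACDerivOn.comp hΩ hdf hdf1 ((φ₁.continuousOn.comp hy.continuousOn hy₁).prodMk
    (φ₂.continuousOn.comp hz.continuousOn hz₂)) hm (hγ.prodMk hδ)).congr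
    (fun s hs => ?_) fun s hs => ?_
  · simp only [Function.comp_apply]
    rw [φ₁.left_inv (hy₁ s hs), φ₂.left_inv (hz₂ s hs)]
  · exact hdf.div_apply h₁ h₂ hψ hΩ (hy₁ s hs) (hz₂ s hs) (hyzψ s hs) (hm s hs) _ _

theorem MemLusinLp.adjointAction {p : ℝ≥0∞} {γ : ℝ → E} {a b : ℝ} (hγ : MemLusinLp p γ (Icc a b))
    {z : ℝ → G} (hz : Continuous z) :
    MemLusinLp p (fun s => adjointAction E (z s) (γ s)) (Icc a b) :=
  hγ.comp_linear (c := fun s v => _root_.adjointAction E (z s) v)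
    (continuous_adjointAction.comp (f := fun w : ℝ × E => (z w.1, w.2)) (by fun_prop)).continuousOn
    fun t _ x v => adjointAction_smul (z t) x v

theorem MemLusinLp.sub {p : ℝ≥0∞} {γ δ : ℝ → E} (hγ : MemLusinLp p γ (Icc 0 1))
    (hδ : MemLusinLp p δ (Icc 0 1)) : MemLusinLp p (fun s => γ s - δ s) (Icc 0 1) :=
  (LpFun p E).sub_mem hγ hδ

theorem IsEvolution.div {γ δ : ℝ → E} (hγ : MemLusinLp 1 γ (Icc 0 1))
    (hδ : MemLusinLp 1 δ (Icc 0 1)) {η ζ : C(unitInterval, G)} (h : IsEvolution γ η)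
    (h' : IsEvolution δ ζ) :
    IsEvolution (fun s => adjointAction E (IccExtend zero_le_one ζ s) (γ s - δ s)) (η * ζ⁻¹) := by
  have hy : Continuous (IccExtend zero_le_one η) := η.continuous.Icc_extend'
  have hz : Continuous (IccExtend zero_le_one ζ) := ζ.continuous.Icc_extend'
  rw [isEvolution_iff hγ] at h
  rw [isEvolution_iff hδ] at h'
  rw [isEvolution_iff ((hγ.sub hδ).adjointAction hz)]
  refine ⟨by simp [h.1, h'.1], ?_⟩
  have hcov := HasSubdivision.of_open_cover (hy.mul hz.inv)
    (U := fun φ : atlas E G => φ.1.source) (fun φ => φ.1.open_source)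
    fun x => ⟨⟨chartAt E x, chart_mem_atlas E x⟩, mem_chart_source E x⟩
  have hcov' : IsHereditary (fun s t => ∃ φ : atlas E G, ∀ u ∈ Icc s t,
      IccExtend zero_le_one η u * (IccExtend zero_le_one ζ u)⁻¹ ∈ φ.1.source) := by
    rintro s t s' t' ⟨φ, hφ⟩ hs _ ht
    exact ⟨φ, fun u hu => hφ u (Icc_subset_Icc hs ht hu)⟩
  have h3 := (h.2.inter (SolvesOn.isHereditary _ _) (SolvesOn.isHereditary _ _) h'.2).inter
    (fun s t s' t' hst h1 h2 h3 => ⟨SolvesOn.isHereditary _ _ hst.1 h1 h2 h3,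
      SolvesOn.isHereditary _ _ hst.2 h1 h2 h3⟩) hcov' hcov
  refine h3.mono ?_
  rintro s t ⟨⟨h1, h2⟩, φ, hφ⟩
  exact h1.div hy hz h2 φ.2 hφ

/-- Along a solution with values in the domain of a chart, the equation can be integrated in this
chart. -/
theorem IsEvolution.hasACDerivOn {γ : ℝ → E} (hγ : MemLusinLp 1 γ (Icc 0 1))
    {η : C(unitInterval, G)} (h : IsEvolution γ η) {φ : OpenPartialHomeomorph G E}
    (hφ : φ ∈ atlas E G) (hηφ : ∀ t, η t ∈ φ.source) :
    HasACDerivOn (fun s => φ (IccExtend zero_le_one η s))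
      (fun s => translDeriv φ (IccExtend zero_le_one η s) 1 (γ s)) 0 1 := by
  have hy : Continuous (IccExtend zero_le_one η) := η.continuous.Icc_extend'
  have hyφ : ∀ s, IccExtend zero_le_one η s ∈ φ.source := fun s => hηφ _
  have hm := hγ.translDeriv hy hφ fun s _ => hyφ s
  refine ⟨hm, ?_⟩
  have h1 := ((isEvolution_iff hγ).1 h).2.subset_Icc
  have key : ∀ b, HasSubdivision (fun s t => (0 ≤ s ∧ t ≤ 1) ∧
      SolvesOn γ (IccExtend zero_le_one η) s t) 0 b →
      ∀ t ∈ Icc 0 b, IsWeakIntegral (fun s => translDeriv φ (IccExtend zero_le_one η s) 1 (γ s)) 0 t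
        (φ (IccExtend zero_le_one η t) - φ (IccExtend zero_le_one η 0)) := by
    intro b hb
    induction hb with
    | refl =>
      rintro t ht
      obtain rfl : t = 0 := le_antisymm ht.2 ht.1
      intro l
      simp
    | @tail e f hae hef ih =>
      intro t ht
      rcases le_total t e with hte | het
      · exact ih t ⟨ht.1, hte⟩
      have he0 : 0 ≤ e := HasSubdivision.le hae
      have h2 := hef.2.2.hasACDerivOn hy hφ fun s _ => hyφ s
      have h3 := (ih e ⟨he0, le_rfl⟩).add_adjacent (h2.2 t ⟨het, ht.2⟩)
        (fun l => IntegrableOn.intervalIntegrable_of_mem_Icc (hm.integrableOn_dual l)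
          ⟨le_rfl, zero_le_one⟩ ⟨he0, hef.1.le.trans hef.2.1.2⟩)
        (fun l => IntegrableOn.intervalIntegrable_of_mem_Icc (hm.integrableOn_dual l)
          ⟨he0, hef.1.le.trans hef.2.1.2⟩ ⟨ht.1, ht.2.trans hef.2.1.2⟩)
      rwa [add_comm, sub_add_sub_cancel] at h3
  exact key 1 h1

theorem IsEvolution.eq_one {γ : ℝ → E} (hγ : MemLusinLp 1 γ (Icc 0 1)) {η : C(unitInterval, G)}
    (h : IsEvolution γ η) (h0 : ∀ᵐ s ∂volume.restrict (Icc 0 1), γ s = 0) : η = 1 := by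
  have h1 := ((isEvolution_iff hγ).1 h).2.subset_Icc
  have key : ∀ b, HasSubdivision (fun s t => (0 ≤ s ∧ t ≤ 1) ∧
      SolvesOn γ (IccExtend zero_le_one η) s t) 0 b →
      ∀ t ∈ Icc 0 b, IccExtend zero_le_one η t = IccExtend zero_le_one η 0 := by
    intro b hb
    induction hb with
    | refl =>
      rintro t ht
      rw [le_antisymm ht.2 ht.1]
    | @tail e f hae hef ih =>
      intro t ht
      rcases le_total t e with hte | het
      · exact ih t ⟨ht.1, hte⟩
      rw [← ih e ⟨HasSubdivision.le hae, le_rfl⟩]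
      obtain ⟨hef1, ⟨he0, hf1⟩, φ, hφ, hyφ, hAC⟩ := hef
      have h2 := hAC.2 t ⟨het, ht.2⟩
      have h3 : IsWeakIntegral (fun _ => (0 : E)) e t
          (φ (IccExtend zero_le_one η t) - φ (IccExtend zero_le_one η e)) := by
        refine h2.congr_ae het ?_
        filter_upwards [ae_restrict_of_ae_restrict_of_subset
          (Icc_subset_Icc he0 (ht.2.trans hf1)) h0, ae_restrict_mem measurableSet_Icc] with s hs hst
        rw [hs]
        simpa using translDeriv_smul hφ (h := IccExtend zero_le_one η s) (k := 1)
          (by simpa using hyφ s ⟨hst.1, hst.2.trans ht.2⟩) 0 0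
      have h4 : IsWeakIntegral (fun _ => (0 : E)) e t 0 := fun l => by simp
      exact φ.injOn (hyφ t ⟨het, ht.2⟩) (hyφ e ⟨le_rfl, hef1.le⟩) (sub_eq_zero.1 (h3.unique h4))
  ext t
  have h2 := key 1 h1 t t.2
  rw [IccExtend_val, IccExtend_left] at h2
  rw [h2]
  exact h.1

theorem IsEvolution.unique {γ δ : ℝ → E} (hγ : MemLusinLp 1 γ (Icc 0 1))
    (hδ : MemLusinLp 1 δ (Icc 0 1)) {η ζ : C(unitInterval, G)} (h : IsEvolution γ η)
    (h' : IsEvolution δ ζ) (heq : ∀ᵐ s ∂volume.restrict (Icc 0 1), γ s = δ s) : η = ζ := by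
  have hz : Continuous (IccExtend zero_le_one ζ) := ζ.continuous.Icc_extend'
  refine mul_inv_eq_one.1 ((h.div hγ hδ h').eq_one ((hγ.sub hδ).adjointAction hz) ?_)
  filter_upwards [heq] with s hs
  rw [hs, sub_self]
  simpa using adjointAction_smul (E := E) (IccExtend zero_le_one ζ s) 0 0

section Evol

variable {p : ℝ≥0∞}

theorem LpSpace.mk_eq_mk_iff {γ δ : LpFun p E} :
    (LpSpace.mk γ = LpSpace.mk δ) ↔ ∀ᵐ s ∂volume.restrict (Icc 0 1), γ.1 s = δ.1 s := by
  have h1 : (LpSpace.mk γ = LpSpace.mk δ) ↔ γ - δ ∈ LpNull p E := Submodule.Quotient.eq _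
  rw [h1]
  change (γ - δ).1 =ᵐ[volume.restrict (Icc 0 1)] 0 ↔ _
  refine eventually_congr (Eventually.of_forall fun s => ?_)
  simp [sub_eq_zero]

variable [hp : Fact (1 ≤ p)]

theorem LpFun.memLusinLp_one (γ : LpFun p E) : MemLusinLp 1 γ.1 (Icc 0 1) :=
  MemLusinLp.one hp.out γ.2

theorem Evol_mk_eq {γ : LpFun p E} {η : C(unitInterval, G)} (h : IsEvolution γ.1 η) :
    Evol p E G (LpSpace.mk γ) = η := by
  have hex : ∃ η : C(unitInterval, G), ∃ γ' : LpFun p E, LpSpace.mk γ' = LpSpace.mk γ ∧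
    IsEvolution γ'.1 η := ⟨η, γ, rfl, h⟩
  rw [Evol, dif_pos hex]
  obtain ⟨γ', hγ', h'⟩ := hex.choose_spec
  exact h'.unique (LpFun.memLusinLp_one γ') (LpFun.memLusinLp_one γ) h (LpSpace.mk_eq_mk_iff.1 hγ')

theorem LpSemiregular.isEvolution (hG : LpSemiregular p E G) (γ : LpFun p E) :
    IsEvolution γ.1 (Evol p E G (LpSpace.mk γ)) := by
  obtain ⟨η, hη⟩ := hG γ.1 γ.2
  rwa [Evol_mk_eq hη]

end Evol

end Evolutions

/-! ### Lebesgue spaces as locally convex spaces -/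

section LpTopology

variable {E : Type*} [AddCommGroup E] [Module ℝ E] [TopologicalSpace E]
  [IsTopologicalAddGroup E] [ContinuousSMul ℝ E]
  {F : Type*} [AddCommGroup F] [Module ℝ F] [TopologicalSpace F]
  [IsTopologicalAddGroup F] [ContinuousSMul ℝ F]
  {p : ℝ≥0∞} [hp : Fact (1 ≤ p)]

instance : IsTopologicalAddGroup (LpSpace p E) :=
  (LpSpace.withSeminorms p).topologicalAddGroup

instance : ContinuousSMul ℝ (LpSpace p E) :=
  (LpSpace.withSeminorms p).continuousSMul

namespace LpSpace

theorem tendsto_nhds {ι : Type*} {l : Filter ι} {u : ι → LpSpace p E} {g : LpSpace p E} :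
    Tendsto u l (𝓝 g) ↔ ∀ (q : Seminorm ℝ E) (hq : Continuous q), ∀ ε > 0,
      ∀ᶠ i in l, LpSpace.seminorm p q hq (u i - g) < ε := by
  rw [(LpSpace.withSeminorms p).tendsto_nhds]
  exact ⟨fun h q hq ε hε => h ⟨q, hq⟩ ε hε, fun h q ε hε => h q.1 q.2 ε hε⟩

theorem tendsto_seminorm_sub {q : Seminorm ℝ E} (hq : Continuous q) (g : LpSpace p E) :
    Tendsto (fun g' => LpSpace.seminorm p q hq (g' - g)) (𝓝 g) (𝓝 0) := by
  refine (tendsto_order.2 ⟨fun a ha => Eventually.of_forall fun g' =>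
    ha.trans_le (apply_nonneg _ _), fun a ha => ?_⟩)
  exact tendsto_nhds.1 tendsto_id q hq a ha

theorem seminorm_mk_le {q : Seminorm ℝ E} (hq : Continuous q) {r : Seminorm ℝ F}
    (hr : Continuous r) {γ : LpFun p E} {δ : LpFun p F} {C : ℝ} (hC : 0 ≤ C)
    (h : ∀ s ∈ Icc (0 : ℝ) 1, q (γ.1 s) ≤ C * r (δ.1 s)) :
    LpSpace.seminorm p q hq (mk γ) ≤ C * LpSpace.seminorm p r hr (mk δ) := by
  have hC' : C = (ENNReal.ofReal C).toReal := (ENNReal.toReal_ofReal hC).symm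
  rw [seminorm_mk, seminorm_mk, hC', ← ENNReal.toReal_mul]
  refine ENNReal.toReal_mono (ENNReal.mul_ne_top ENNReal.ofReal_ne_top (δ.2.2 r hr).ne) ?_
  refine eLpNorm_le_mul_eLpNorm_of_ae_le_mul ?_ p
  filter_upwards [ae_restrict_mem measurableSet_Icc] with s hs
  simpa [abs_of_nonneg (apply_nonneg _ _)] using h s hs

/-- On an interval of length one, the `L^1`-norm is bounded by the `L^p`-norm. -/
theorem integral_seminorm_le {q : Seminorm ℝ E} (hq : Continuous q) (γ : LpFun p E) {t : ℝ}
    (ht : t ∈ Icc (0 : ℝ) 1) :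
    ∫ s in (0)..t, q (γ.1 s) ≤ LpSpace.seminorm p q hq (mk γ) := by
  have h1 := (MemLusinLp.one hp.out γ.2).memLp q hq
  have h2 : ∫ s in (0)..t, q (γ.1 s) ≤ ∫ s in Icc (0 : ℝ) 1, q (γ.1 s) := by
    rw [intervalIntegral.integral_of_le ht.1]
    refine setIntegral_mono_set (memLp_one_iff_integrable.1 h1)
      (Eventually.of_forall fun s => apply_nonneg _ _) ?_
    exact (Ioc_subset_Icc_self.trans (Icc_subset_Icc_right ht.2)).eventuallyLE
  have h3 : ∫ s in Icc (0 : ℝ) 1, q (γ.1 s) =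
      (eLpNorm (fun s => q (γ.1 s)) 1 (volume.restrict (Icc 0 1))).toReal := by
    rw [eLpNorm_one_eq_lintegral_enorm, ← integral_norm_eq_lintegral_enorm h1.1]
    simp [abs_of_nonneg (apply_nonneg _ _)]
  have : IsProbabilityMeasure (volume.restrict (Icc (0 : ℝ) 1)) := ⟨by simp⟩
  rw [seminorm_mk]
  refine h2.trans (h3.le.trans (ENNReal.toReal_mono (γ.2.2 q hq).ne ?_))
  exact eLpNorm_le_eLpNorm_of_exponent_le hp.out h1.1

open Classical in
/-- The class of an `ℒ^p`-function, as a function of all maps `ℝ → E` (with the irrelevant value `0`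
on maps that are not in `ℒ^p`). -/
noncomputable def ofFun (p : ℝ≥0∞) (γ : ℝ → E) : LpSpace p E :=
  if h : γ ∈ LpFun p E then mk ⟨γ, h⟩ else 0

theorem ofFun_eq {γ : ℝ → E} (h : γ ∈ LpFun p E) : ofFun p γ = mk ⟨γ, h⟩ := dif_pos h

/-- A representative of an element of `L^p`. -/
noncomputable def rep (g : LpSpace p E) : LpFun p E := Function.surjInv mk_surjective g

@[simp] theorem mk_rep (g : LpSpace p E) : mk (rep g) = g := Function.surjInv_eq mk_surjective g

end LpSpace

end LpTopology

/-! ### Multiplication operators on Lebesgue spaces -/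

section MulOp

universe u

open LpSpace

variable {D : Type u} [AddCommGroup D] [Module ℝ D] [TopologicalSpace D]
  [IsTopologicalAddGroup D] [ContinuousSMul ℝ D]
  {E : Type*} [AddCommGroup E] [Module ℝ E] [TopologicalSpace E]
  [IsTopologicalAddGroup E] [ContinuousSMul ℝ E]
  {F : Type*} [AddCommGroup F] [Module ℝ F] [TopologicalSpace F]
  [IsTopologicalAddGroup F] [ContinuousSMul ℝ F]
  {p : ℝ≥0∞} [hp : Fact (1 ≤ p)]

/-- The fibrewise linear operator `(v, y) ↦ [t ↦ b (t, v t) (y t)]` for `v ∈ L^p([0,1], F)` and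
`y ∈ C([0,1], D)`, where `b (t, v) x` is linear in `v`. -/
noncomputable def mulOp (p : ℝ≥0∞) (b : unitInterval × F → D → E) (v : LpSpace p F)
    (y : C(unitInterval, D)) : LpSpace p E :=
  ofFun p fun s => b (projIcc 0 1 zero_le_one s, (rep v).1 s) (y (projIcc 0 1 zero_le_one s))

variable [LocallyConvexSpace ℝ E] [T2Space E] [LocallyConvexSpace ℝ F] [T2Space F]
  {Ω : Set (unitInterval × D)} {b : unitInterval × F → D → E}

theorem mulOp_mem (hb : ContinuousOn (fun z : (unitInterval × F) × D => b z.1 z.2)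
      {z | (z.1.1, z.2) ∈ Ω})
    (hsmul : ∀ z ∈ Ω, ∀ (a : ℝ) v, b (z.1, a • v) z.2 = a • b (z.1, v) z.2)
    (v : LpFun p F) {y : C(unitInterval, D)} (hy : ∀ t, (t, y t) ∈ Ω) :
    (fun s => b (projIcc 0 1 zero_le_one s, v.1 s) (y (projIcc 0 1 zero_le_one s))) ∈
      LpFun p E := by
  refine MemLusinLp.comp_linear (c := fun s v => b (projIcc 0 1 zero_le_one s, v)
    (y (projIcc 0 1 zero_le_one s))) v.2 ?_ fun t _ x w => hsmul _ (hy _) x w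
  have hc : Continuous fun s : ℝ => projIcc (0 : ℝ) 1 zero_le_one s := continuous_projIcc
  exact ContinuousOn.comp (g := fun z : (unitInterval × F) × D => b z.1 z.2) hb
    (f := fun z : ℝ × F => ((projIcc 0 1 zero_le_one z.1, z.2), y (projIcc 0 1 zero_le_one z.1)))
    (by fun_prop) fun z _ => hy _

theorem mulOp_eq (hb : ContinuousOn (fun z : (unitInterval × F) × D => b z.1 z.2)
      {z | (z.1.1, z.2) ∈ Ω})
    (hsmul : ∀ z ∈ Ω, ∀ (a : ℝ) v, b (z.1, a • v) z.2 = a • b (z.1, v) z.2)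
    (v : LpFun p F) {y : C(unitInterval, D)} (hy : ∀ t, (t, y t) ∈ Ω) :
    mulOp p b (mk v) y = mk ⟨_, mulOp_mem (E := E) hb hsmul v hy⟩ := by
  rw [mulOp, ofFun_eq (mulOp_mem hb hsmul _ hy), mk_eq_mk_iff]
  filter_upwards [mk_eq_mk_iff.1 (mk_rep (mk v))] with s hs
  simp only [hs]

theorem mulOp_add (hb : ContinuousOn (fun z : (unitInterval × F) × D => b z.1 z.2)
      {z | (z.1.1, z.2) ∈ Ω})
    (hadd : ∀ z ∈ Ω, ∀ v v', b (z.1, v + v') z.2 = b (z.1, v) z.2 + b (z.1, v') z.2)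
    (hsmul : ∀ z ∈ Ω, ∀ (a : ℝ) v, b (z.1, a • v) z.2 = a • b (z.1, v) z.2)
    (v w : LpSpace p F) {y : C(unitInterval, D)} (hy : ∀ t, (t, y t) ∈ Ω) :
    mulOp p b (v + w) y = mulOp p b v y + mulOp p b w y := by
  obtain ⟨v, rfl⟩ := mk_surjective v
  obtain ⟨w, rfl⟩ := mk_surjective w
  rw [← map_add, mulOp_eq hb hsmul _ hy, mulOp_eq hb hsmul _ hy, mulOp_eq hb hsmul _ hy, ← map_add]
  exact congrArg mk (Subtype.ext (funext fun s => hadd _ (hy _) _ _))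

theorem mulOp_smul (hb : ContinuousOn (fun z : (unitInterval × F) × D => b z.1 z.2)
      {z | (z.1.1, z.2) ∈ Ω})
    (hsmul : ∀ z ∈ Ω, ∀ (a : ℝ) v, b (z.1, a • v) z.2 = a • b (z.1, v) z.2)
    (a : ℝ) (v : LpSpace p F) {y : C(unitInterval, D)} (hy : ∀ t, (t, y t) ∈ Ω) :
    mulOp p b (a • v) y = a • mulOp p b v y := by
  obtain ⟨v, rfl⟩ := mk_surjective v
  rw [← map_smul, mulOp_eq hb hsmul _ hy, mulOp_eq hb hsmul _ hy, ← map_smul]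
  exact congrArg mk (Subtype.ext (funext fun s => hsmul _ (hy _) _ _))

/-- For fixed `y`, the multiplication operator is continuous at `0`. -/
theorem tendsto_mulOp_zero (hb : ContinuousOn (fun z : (unitInterval × F) × D => b z.1 z.2)
      {z | (z.1.1, z.2) ∈ Ω})
    (hsmul : ∀ z ∈ Ω, ∀ (a : ℝ) v, b (z.1, a • v) z.2 = a • b (z.1, v) z.2)
    {y : C(unitInterval, D)} (hy : ∀ t, (t, y t) ∈ Ω) :
    Tendsto (fun v : LpSpace p F => mulOp p b v y) (𝓝 0) (𝓝 0) := by
  refine LpSpace.tendsto_nhds.2 fun q hq ε hε => ?_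
  obtain ⟨r, hr, h⟩ := exists_seminorm_bound (K := (univ : Set unitInterval))
    (g := fun t v => b (t, v) (y t)) isCompact_univ
    (ContinuousOn.comp (g := fun z : (unitInterval × F) × D => b z.1 z.2) hb
      (f := fun z : unitInterval × F => (z, y z.1)) (by fun_prop) fun z _ => hy _)
    (fun t _ c v => hsmul _ (hy t) c v) q hq
  filter_upwards [(tendsto_order.1 (tendsto_seminorm_sub hr (0 : LpSpace p F))).2 ε hε] with v hv
  obtain ⟨v, rfl⟩ := mk_surjective v
  rw [sub_zero] at hv ⊢
  rw [mulOp_eq hb hsmul v hy]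
  refine lt_of_le_of_lt ?_ hv
  rw [← one_mul (LpSpace.seminorm p r hr _)]
  refine seminorm_mk_le hq hr zero_le_one fun s _ => ?_
  rw [one_mul]
  exact h _ (mem_univ _) _

variable [LocallyConvexSpace ℝ D]

/-- The multiplication operator `(v, y) ↦ [t ↦ b (t, v t) (y t)]` is of class `C^k` in the variable
`y` if `b` is of class `C^{k+1}`. The loss of one derivative results from the fact that continuity of
`b` does not give uniform continuity in `y` on neighbourhoods of `v = 0`, but differentiability gives
a Lipschitz estimate. -/
theorem ParamCk.mulOp {k : ℕ} (hΩ : IsOpen Ω) (hb : ParamCk (k + 1) b {z | (z.1.1, z.2) ∈ Ω})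
    (hadd : ∀ z ∈ Ω, ∀ v v', b (z.1, v + v') z.2 = b (z.1, v) z.2 + b (z.1, v') z.2)
    (hsmul : ∀ z ∈ Ω, ∀ (a : ℝ) v, b (z.1, a • v) z.2 = a • b (z.1, v) z.2) :
    ParamCk k (fun v y => mulOp p b v y) {z | ∀ t, (t, z.2 t) ∈ Ω} := by
  have hc0 : ∀ {D : Type u} [AddCommGroup D] [Module ℝ D] [TopologicalSpace D]
      [IsTopologicalAddGroup D] [ContinuousSMul ℝ D] [LocallyConvexSpace ℝ D]
      {Ω : Set (unitInterval × D)} {b : unitInterval × F → D → E} (hΩ : IsOpen Ω)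
      (hb : ParamCk 1 b {z | (z.1.1, z.2) ∈ Ω})
      (hadd : ∀ z ∈ Ω, ∀ v v', b (z.1, v + v') z.2 = b (z.1, v) z.2 + b (z.1, v') z.2)
      (hsmul : ∀ z ∈ Ω, ∀ (a : ℝ) v, b (z.1, a • v) z.2 = a • b (z.1, v) z.2),
      ContinuousOn (fun z : LpSpace p F × C(unitInterval, D) => _root_.mulOp p b z.1 z.2)
        {z | ∀ t, (t, z.2 t) ∈ Ω} := by
    intro D _ _ _ _ _ _ Ω b hΩ hb hadd hsmul z₀ hy₀
    obtain ⟨v₀, y₀⟩ := z₀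
    have hy₀ : ∀ t, (t, y₀ t) ∈ Ω := hy₀
    obtain ⟨bc, db, hdb, -⟩ := hb
    refine ContinuousAt.continuousWithinAt ?_
    have h1 : Tendsto (fun z : LpSpace p F × C(unitInterval, D) => _root_.mulOp p b z.1 y₀)
        (𝓝 (v₀, y₀)) (𝓝 (_root_.mulOp p b v₀ y₀)) := by
      have hs : Tendsto (fun z : LpSpace p F × C(unitInterval, D) => z.1 - v₀) (𝓝 (v₀, y₀))
          (𝓝 0) := by
        have : Continuous fun z : LpSpace p F × C(unitInterval, D) => z.1 - v₀ := by fun_prop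
        simpa using this.tendsto (v₀, y₀)
      have h2 := ((tendsto_mulOp_zero bc hsmul hy₀).comp hs).add_const (_root_.mulOp p b v₀ y₀)
      rw [zero_add] at h2
      refine h2.congr fun z => ?_
      rw [Function.comp_apply, ← mulOp_add bc hadd hsmul _ _ hy₀, sub_add_cancel]
    have h2 : Tendsto (fun z : LpSpace p F × C(unitInterval, D) =>
        _root_.mulOp p b z.1 z.2 - _root_.mulOp p b z.1 y₀) (𝓝 (v₀, y₀)) (𝓝 0) := by
      refine LpSpace.tendsto_nhds.2 fun q hq ε hε => ?_
      obtain ⟨r, hr, r', hr', h⟩ := hdb.exists_lipschitz hΩ hsmul isCompact_univ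
        y₀.continuous.continuousOn (fun t _ => hy₀ t) q hq
      set N : ℝ := LpSpace.seminorm p r' hr' v₀ + 1 with hN
      have hN0 : 0 < N := by
        have := apply_nonneg (LpSpace.seminorm p r' hr') v₀
        positivity
      have e1 : ∀ᶠ z : LpSpace p F × C(unitInterval, D) in 𝓝 (v₀, y₀),
          LpSpace.seminorm p r' hr' z.1 < N := by
        have := (continuous_fst.tendsto (v₀, y₀)).eventually
          ((tendsto_order.1 (tendsto_seminorm_sub hr' v₀)).2 1 one_pos)
        filter_upwards [this] with z hz
        have h3 := map_add_le_add (LpSpace.seminorm p r' hr') (z.1 - v₀) v₀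
        rw [sub_add_cancel] at h3
        linarith
      have hmin : 0 < min 1 (ε / N) := lt_min one_pos (div_pos hε hN0)
      have e2 : ∀ᶠ z : LpSpace p F × C(unitInterval, D) in 𝓝 (v₀, y₀),
          ∀ t, r (z.2 t - y₀ t) < min 1 (ε / N) :=
        (continuous_snd.tendsto (v₀, y₀)).eventually
          (ContinuousMap.tendsto_nhds_iff_seminorm.1 tendsto_id r hr _ hmin)
      filter_upwards [e1, e2] with z hz1 hz2
      obtain ⟨v, y⟩ := z
      obtain ⟨v, rfl⟩ := mk_surjective v
      have hy : ∀ t, (t, y t) ∈ Ω := fun t =>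
        (h t (mem_univ t) (y t) ((hz2 t).trans_le (min_le_left _ _))).1
      rw [sub_zero, mulOp_eq bc hsmul v hy, mulOp_eq bc hsmul v hy₀, ← map_sub]
      refine (seminorm_mk_le hq hr' (C := ε / N) (δ := v) (by positivity) fun s _ => ?_).trans_lt ?_
      · refine ((h _ (mem_univ _) _ ((hz2 _).trans_le (min_le_left _ _))).2 (v.1 s)).trans ?_
        exact mul_le_mul_of_nonneg_right ((hz2 _).le.trans (min_le_right _ _)) (apply_nonneg _ _)
      · rw [div_mul_eq_mul_div, div_lt_iff₀ hN0]
        exact mul_lt_mul_of_pos_left hz1 hε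
    have h3 := h2.add h1
    rw [zero_add] at h3
    exact h3.congr fun z => by rw [sub_add_cancel]
  induction k generalizing D with
  | zero => exact hc0 hΩ hb hadd hsmul
  | succ k ih =>
    obtain ⟨bc, db, hdb, hdk⟩ := hb
    have hO : IsOpen {z : (unitInterval × F) × D | (z.1.1, z.2) ∈ Ω} :=
      hΩ.preimage (by fun_prop)
    have hd := hdb.hasDirDerivAt
    have hev : ∀ t : unitInterval, ∀ x w : D, (t, x) ∈ Ω → ∀ᶠ s : ℝ in 𝓝[≠] 0,
        (t, x + s • w) ∈ Ω := fun t x w hx => by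
      have hc : Continuous fun s : ℝ => (t, x + s • w) := by fun_prop
      have := (hΩ.preimage hc).mem_nhds (x := 0) (by simpa using hx)
      exact mem_nhdsWithin_of_mem_nhds this
    have hadd' : ∀ z ∈ tangentDomain Ω, ∀ v v',
        db (z.1, v + v') z.2 = db (z.1, v) z.2 + db (z.1, v') z.2 := fun z hz v v' => by
      have hz' : (z.1, z.2.1) ∈ Ω := hz
      refine (hd ((z.1, v + v'), z.2.1) hz z.2.2).unique (Tendsto.congr' ?_
        (Tendsto.add (hd ((z.1, v), z.2.1) hz z.2.2) (hd ((z.1, v'), z.2.1) hz z.2.2)))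
      filter_upwards [hev z.1 z.2.1 z.2.2 hz'] with s hs
      have h1 := hadd _ hs v v'
      have h2 := hadd _ hz' v v'
      simp only at h1 h2
      simp only [h1, h2]
      rw [← smul_add, add_sub_add_comm]
    have hsmul' : ∀ z ∈ tangentDomain Ω, ∀ (a : ℝ) v,
        db (z.1, a • v) z.2 = a • db (z.1, v) z.2 := fun z hz a v => by
      have hz' : (z.1, z.2.1) ∈ Ω := hz
      refine (hd ((z.1, a • v), z.2.1) hz z.2.2).unique (Tendsto.congr' ?_
        (Tendsto.const_smul (hd ((z.1, v), z.2.1) hz z.2.2) a))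
      filter_upwards [hev z.1 z.2.1 z.2.2 hz'] with s hs
      have h1 := hsmul _ hs a v
      have h2 := hsmul _ hz' a v
      simp only at h1 h2
      simp only [h1, h2]
      rw [← smul_sub, smul_comm]
    have hk := (ih hΩ.tangentDomain hdk hadd' hsmul').comp_clm continuous_id
      (ContinuousMap.pairL unitInterval D D)
      (Ω' := tangentDomain {z : LpSpace p F × C(unitInterval, D) | ∀ t, (t, z.2 t) ∈ Ω})
      fun z hz => hz
    refine ⟨hc0 hΩ ⟨bc, db, hdb, hdk.continuousOn⟩ hadd hsmul, _,
      ⟨fun z hz w => ?_, hk.continuousOn⟩, hk⟩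
    obtain ⟨v, y⟩ := z
    obtain ⟨v, rfl⟩ := mk_surjective v
    have hy : ∀ t, (t, y t) ∈ Ω := hz
    refine LpSpace.tendsto_nhds.2 fun q hq ε hε => ?_
    have hyw : ∀ t, (t, (y t, w t)) ∈ tangentDomain Ω := hy
    obtain ⟨-, ddb, hddb, -⟩ := hdk
    obtain ⟨r, hr, r', hr', h⟩ := hddb.exists_lipschitz hΩ.tangentDomain hsmul' isCompact_univ
      (y := fun t => (y t, w t)) (by fun_prop) (fun t _ => hyw t) q hq
    have hrw : Continuous fun t => r (w t, (0 : D)) := hr.comp (by fun_prop)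
    obtain ⟨ρ, hρ⟩ := (isCompact_range hrw).bddAbove
    have hρ' : ∀ t, r (w t, (0 : D)) ≤ ρ := fun t => hρ (mem_range_self t)
    have hρ0 : 0 ≤ ρ := (apply_nonneg _ _).trans (hρ' 0)
    set N : ℝ := LpSpace.seminorm p r' hr' (mk v) with hN
    have hN0 : 0 ≤ N := apply_nonneg _ _
    have e1 : Tendsto (fun s : ℝ => |s| * ρ) (𝓝[≠] 0) (𝓝 0) := by
      have : Continuous fun s : ℝ => |s| * ρ := by fun_prop
      simpa using (this.tendsto 0).mono_left nhdsWithin_le_nhds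
    have e2 : Tendsto (fun s : ℝ => |s| * ρ * N) (𝓝[≠] 0) (𝓝 0) := by
      simpa using e1.mul_const N
    filter_upwards [(tendsto_order.1 e1).2 1 one_pos, (tendsto_order.1 e2).2 ε hε,
      self_mem_nhdsWithin] with s hs1 hs2 hs0
    have hs0 : s ≠ 0 := hs0
    have hr1 : ∀ t, ∀ σ ∈ Icc (0 : ℝ) 1, r ((y t + σ • s • w t, w t) - (y t, w t)) ≤ |s| * ρ := by
      intro t σ hσ
      have h1 : ((y t + σ • s • w t, w t) - (y t, w t) : D × D) = (σ * s) • (w t, (0 : D)) := by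
        simp [mul_smul]
      rw [h1, map_smul_eq_mul, Real.norm_eq_abs, abs_mul, abs_of_nonneg hσ.1]
      have h2 : σ * |s| ≤ |s| := mul_le_of_le_one_left (abs_nonneg _) hσ.2
      exact mul_le_mul h2 (hρ' t) (apply_nonneg _ _) (abs_nonneg _)
    have hmem : ∀ t, ∀ σ ∈ Icc (0 : ℝ) 1, (t, y t + σ • s • w t) ∈ Ω := fun t σ hσ =>
      (h t (mem_univ t) _ ((hr1 t σ hσ).trans_lt hs1)).1
    have hys : ∀ t, (t, (y + s • w) t) ∈ Ω := fun t => by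
      simpa using hmem t 1 ⟨zero_le_one, le_rfl⟩
    have hyw' : ∀ t, (t, ContinuousMap.pairL unitInterval D D (y, w) t) ∈ tangentDomain Ω := hyw
    simp only [id]
    rw [mulOp_eq bc hsmul v hys, mulOp_eq bc hsmul v hy, mulOp_eq hdb.continuousOn hsmul' v hyw',
      ← map_sub, ← map_smul, ← map_sub]
    refine (seminorm_mk_le hq hr' (C := |s| * ρ) (δ := v) (by positivity) fun u _ => ?_).trans_lt hs2
    set t := projIcc (0 : ℝ) 1 zero_le_one u with ht
    change q (s⁻¹ • (b (t, v.1 u) (y t + s • w t) - b (t, v.1 u) (y t)) -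
      db (t, v.1 u) (y t, w t)) ≤ _
    have key := seminorm_sub_le_of_hasDirDerivAt (f := b (t, v.1 u)) (x := y t) (v := s • w t)
      (d := fun σ => s • db (t, v.1 u) (y t + σ • s • w t, w t)) (fun σ hσ => by
        have h1 := hd ((t, v.1 u), y t + σ • s • w t) (hmem t σ hσ) (w t)
        exact h1.smul s) q hq (w := s • db (t, v.1 u) (y t, w t))
      (M := |s| * (|s| * ρ * r' (v.1 u))) (fun σ hσ => by
        rw [← smul_sub, map_smul_eq_mul, Real.norm_eq_abs]
        refine mul_le_mul_of_nonneg_left ?_ (abs_nonneg _)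
        refine ((h t (mem_univ t) _ ((hr1 t σ hσ).trans_lt hs1)).2 (v.1 u)).trans ?_
        exact mul_le_mul_of_nonneg_right (hr1 t σ hσ) (apply_nonneg _ _))
    have h3 : s⁻¹ • (b (t, v.1 u) (y t + s • w t) - b (t, v.1 u) (y t)) - db (t, v.1 u) (y t, w t) =
        s⁻¹ • (b (t, v.1 u) (y t + s • w t) - b (t, v.1 u) (y t) - s • db (t, v.1 u) (y t, w t)) := by
      rw [smul_sub _ _ (s • _), smul_smul, inv_mul_cancel₀ hs0, one_smul]
    rw [h3, map_smul_eq_mul, norm_inv, Real.norm_eq_abs, inv_mul_le_iff₀ (abs_pos.2 hs0)]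
    exact key

end MulOp

/-! ### Primitives as limits -/

section Primitives

variable {E : Type*} [AddCommGroup E] [Module ℝ E] [TopologicalSpace E]
  [IsTopologicalAddGroup E] [ContinuousSMul ℝ E] [LocallyConvexSpace ℝ E] [T2Space E]

/-- A uniform limit of continuous functions, uniformity being tested by seminorms, is continuous. -/
theorem continuous_of_seminorm_uniform_limit {X ι : Type*} [TopologicalSpace X] {l : Filter ι}
    [l.NeBot] {u : ι → X → E} {f : X → E} (hu : ∀ i, Continuous (u i))
    (h : ∀ q : Seminorm ℝ E, Continuous q → ∀ ε > 0, ∀ᶠ i in l, ∀ x, q (u i x - f x) < ε) :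
    Continuous f := by
  let : UniformSpace E := IsTopologicalAddGroup.rightUniformSpace E
  have : IsUniformAddGroup E := isUniformAddGroup_of_addCommGroup
  refine TendstoUniformly.continuous (F := u) (p := l) ?_ (Frequently.of_forall hu)
  rw [TendstoUniformly, uniformity_eq_comap_nhds_zero]
  rintro V hV
  obtain ⟨W, hW, hWV⟩ := mem_comap.1 hV
  obtain ⟨q, hq, hqW⟩ := exists_seminorm_lt_one_subset hW
  filter_upwards [h q hq 1 one_pos] with i hi x
  exact hWV (hqW (hi x))

/-- If functions `δ i` with primitives `w i` converge to the `ℒ^1`-function `γ` in a suitable way,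
then, by sequential completeness, `γ` has a continuous primitive, to which the `w i` converge
uniformly. -/
theorem exists_primitive_of_tendsto (hE : IsSeqComplete E) {ι : Type*} {l : Filter ι}
    {a : ℕ → ι} (ha : Tendsto a atTop l) {γ : ℝ → E} (hγ : MemLusinLp 1 γ (Icc 0 1))
    {δ : ι → ℝ → E} (hδ : ∀ᶠ i in l, MemLusinLp 1 (δ i) (Icc 0 1)) {w : ι → C(unitInterval, E)}
    (hw : ∀ᶠ i in l, ∀ t : unitInterval, IsWeakIntegral (δ i) 0 t (w i t))
    (hδγ : ∀ q : Seminorm ℝ E, Continuous q → ∃ r : Seminorm ℝ E, Continuous r ∧ ∀ ε > 0,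
      ∀ᶠ i in l, ∀ s ∈ Icc (0 : ℝ) 1, q (δ i s - γ s) ≤ ε * r (γ s)) :
    ∃ v : C(unitInterval, E), (∀ t : unitInterval, IsWeakIntegral γ 0 t (v t)) ∧
      Tendsto w l (𝓝 v) := by
  have hint : ∀ {f : ℝ → E}, MemLusinLp 1 f (Icc 0 1) → ∀ (t : unitInterval) (L : E →L[ℝ] ℝ),
      IntervalIntegrable (fun s => L (f s)) volume 0 t := fun hf t L =>
    IntegrableOn.intervalIntegrable_of_mem_Icc (hf.integrableOn_dual L) ⟨le_rfl, zero_le_one⟩ t.2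
  have hintq : ∀ (q : Seminorm ℝ E), Continuous q → ∀ t ∈ Icc (0 : ℝ) 1,
      IntervalIntegrable (fun s => q (γ s)) volume 0 t := fun q hq t ht =>
    IntegrableOn.intervalIntegrable_of_mem_Icc (hγ.integrableOn_seminorm q hq)
      ⟨le_rfl, zero_le_one⟩ ht
  have hsub : ∀ t : unitInterval, ∀ s ∈ Icc (0 : ℝ) t, s ∈ Icc (0 : ℝ) 1 :=
    fun t s hs => ⟨hs.1, hs.2.trans t.2.2⟩
  -- The total mass `∫₀¹ r(γ)` dominates the integrals over `[0, t]`.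
  have hmass : ∀ r : Seminorm ℝ E, Continuous r → ∀ t : unitInterval,
      ∫ s in (0 : ℝ)..t, r (γ s) ≤ ∫ s in (0 : ℝ)..1, r (γ s) := fun r hr t =>
    intervalIntegral.integral_mono_interval le_rfl t.2.1 t.2.2
      (Eventually.of_forall fun s => apply_nonneg _ _) (hintq r hr 1 ⟨zero_le_one, le_rfl⟩)
  have hεN : ∀ N : ℝ, 0 ≤ N → ∀ ε > 0, ∃ ε' > 0, ε' * N < ε := fun N hN ε hε =>
    ⟨ε / (N + 1), by positivity, by
      rw [div_mul_eq_mul_div, div_lt_iff₀ (by positivity)]; nlinarith⟩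
  have hcauchy : ∀ q : Seminorm ℝ E, Continuous q → ∀ ε > 0, ∃ S ∈ l, ∀ i ∈ S, ∀ j ∈ S, ∀ t,
      q (w i t - w j t) < ε := by
    intro q hq ε hε
    obtain ⟨r, hr, h⟩ := hδγ q hq
    have hN : 0 ≤ ∫ s in (0 : ℝ)..1, r (γ s) :=
      intervalIntegral.integral_nonneg zero_le_one fun s _ => apply_nonneg _ _
    obtain ⟨ε', hε', hlt⟩ := hεN _ hN (ε / 2) (half_pos hε)
    refine ⟨_, hδ.and (hw.and (h ε' hε')), fun i hi j hj t => ?_⟩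
    have h1 := ((hi.2.1 t).sub (hj.2.1 t) (hint hi.1 t) (hint hj.1 t)).seminorm_le t.2.1 hq
      (((hintq r hr t t.2).const_mul (ε' + ε'))) fun s hs => by
        have h2 : δ i s - δ j s = (δ i s - γ s) - (δ j s - γ s) := by abel
        rw [h2]
        refine (map_sub_le_add q _ _).trans ?_
        rw [add_mul]
        exact add_le_add (hi.2.2 s (hsub t s hs)) (hj.2.2 s (hsub t s hs))
    rw [intervalIntegral.integral_const_mul] at h1
    have h3 := mul_le_mul_of_nonneg_left (hmass r hr t) (add_pos hε' hε').le
    linarith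
  have hlim : ∀ t : unitInterval, ∃ x, Tendsto (fun n => w (a n) t) atTop (𝓝 x) := by
    refine fun t => hE _ fun U hU => ?_
    obtain ⟨q, hq, hqU⟩ := exists_seminorm_lt_one_subset hU
    obtain ⟨S, hS, h⟩ := hcauchy q hq 1 one_pos
    obtain ⟨N, hN⟩ := eventually_atTop.1 (ha.eventually hS)
    exact ⟨N, fun m hm n hn => hqU (h _ (hN m hm) _ (hN n hn) t)⟩
  choose v hv using hlim
  have hunif : ∀ q : Seminorm ℝ E, Continuous q → ∀ ε > 0, ∀ᶠ i in l, ∀ t,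
      q (w i t - v t) < ε := by
    intro q hq ε hε
    obtain ⟨S, hS, h⟩ := hcauchy q hq (ε / 2) (half_pos hε)
    filter_upwards [hS] with i hi t
    refine lt_of_le_of_lt ?_ (half_lt_self hε)
    refine le_of_tendsto ((hq.tendsto _).comp ((hv t).const_sub (w i t))) ?_
    filter_upwards [ha.eventually hS] with n hn
    exact (h i hi _ hn t).le
  have hvc : Continuous v := continuous_of_seminorm_uniform_limit (l := atTop)
    (fun n => (w (a n)).continuous) fun q hq ε hε => ha.eventually (hunif q hq ε hε)
  refine ⟨⟨v, hvc⟩, fun t L => ?_, ContinuousMap.tendsto_nhds_iff_seminorm.2 hunif⟩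
  obtain ⟨r, hr, h⟩ := hδγ (dualSeminorm L) (continuous_dualSeminorm L)
  have h1 : Tendsto (fun n => L (w (a n) t)) atTop (𝓝 (L (v t))) :=
    (L.continuous.tendsto _).comp (hv t)
  refine tendsto_nhds_unique h1 (Metric.tendsto_nhds.2 fun ε hε => ?_)
  have hN : 0 ≤ ∫ s in (0 : ℝ)..1, r (γ s) :=
    intervalIntegral.integral_nonneg zero_le_one fun s _ => apply_nonneg _ _
  obtain ⟨ε', hε', hlt⟩ := hεN _ hN ε hε
  filter_upwards [ha.eventually (hδ.and (hw.and (h ε' hε')))] with n hn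
  rw [Real.dist_eq, hn.2.1 t L, ← intervalIntegral.integral_sub (hint hn.1 t L) (hint hγ t L)]
  refine lt_of_le_of_lt (intervalIntegral.abs_integral_le_integral_abs t.2.1) ?_
  have h2 := intervalIntegral.integral_mono_on t.2.1
    ((hint hn.1 t L).sub (hint hγ t L)).abs ((hintq r hr t t.2).const_mul ε') fun s hs => by
      have := hn.2.2 s (hsub t s hs)
      rwa [dualSeminorm_apply, map_sub] at this
  rw [intervalIntegral.integral_const_mul] at h2
  have h3 := mul_le_mul_of_nonneg_left (hmass r hr t) hε'.le
  exact lt_of_le_of_lt h2 (by linarith)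

variable {p : ℝ≥0∞} [hp : Fact (1 ≤ p)]

/-- If all `ℒ^p`-functions have continuous primitives, then passage to the primitive is a continuous
linear operator `L^p([0,1], E) → C([0,1], E)`. -/
theorem exists_primitive_clm (h : ∀ γ : LpFun p E, ∃ v : C(unitInterval, E),
      ∀ t : unitInterval, IsWeakIntegral γ.1 0 t (v t)) :
    ∃ P : LpSpace p E →L[ℝ] C(unitInterval, E), ∀ (γ : LpFun p E) (t : unitInterval),
      IsWeakIntegral γ.1 0 t (P (LpSpace.mk γ) t) := by
  choose P₀ hP₀ using h
  have hint : ∀ (γ : LpFun p E) (t : unitInterval) (L : E →L[ℝ] ℝ),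
      IntervalIntegrable (fun s => L (γ.1 s)) volume 0 t := fun γ t L =>
    IntegrableOn.intervalIntegrable_of_mem_Icc ((LpFun.memLusinLp_one γ).integrableOn_dual L)
      ⟨le_rfl, zero_le_one⟩ t.2
  let P₁ : LpSpace p E → C(unitInterval, E) := fun g => P₀ (LpSpace.rep g)
  have hP₁ : ∀ (γ : LpFun p E) (t : unitInterval),
      IsWeakIntegral γ.1 0 t (P₁ (LpSpace.mk γ) t) := fun γ t => by
    refine (hP₀ (LpSpace.rep (LpSpace.mk γ)) t).congr_ae t.2.1 ?_
    exact ae_restrict_of_ae_restrict_of_subset (Icc_subset_Icc_right t.2.2)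
      (LpSpace.mk_eq_mk_iff.1 (LpSpace.mk_rep _))
  have hadd : ∀ g g', P₁ (g + g') = P₁ g + P₁ g' := fun g g' => by
    obtain ⟨γ, rfl⟩ := LpSpace.mk_surjective g
    obtain ⟨δ, rfl⟩ := LpSpace.mk_surjective g'
    ext t
    rw [← map_add]
    exact (hP₁ (γ + δ) t).unique ((hP₁ γ t).add (hP₁ δ t) (hint γ t) (hint δ t))
  have hsmul : ∀ (x : ℝ) g, P₁ (x • g) = x • P₁ g := fun x g => by
    obtain ⟨γ, rfl⟩ := LpSpace.mk_surjective g
    ext t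
    rw [← map_smul]
    exact (hP₁ (x • γ) t).unique ((hP₁ γ t).smul x)
  let P₂ : LpSpace p E →ₗ[ℝ] C(unitInterval, E) := ⟨⟨P₁, hadd⟩, hsmul⟩
  have hcont : Continuous P₂ := by
    refine continuous_of_continuousAt_zero P₂ ?_
    rw [ContinuousAt, map_zero]
    refine ContinuousMap.tendsto_nhds_iff_seminorm.2 fun q hq ε hε => ?_
    filter_upwards [LpSpace.tendsto_nhds.1 tendsto_id q hq ε hε] with g hg t
    obtain ⟨γ, rfl⟩ := LpSpace.mk_surjective g
    have h1 := (hP₁ γ t).seminorm_le t.2.1 hq (IntegrableOn.intervalIntegrable_of_mem_Icc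
      ((LpFun.memLusinLp_one γ).integrableOn_seminorm q hq) ⟨le_rfl, zero_le_one⟩ t.2)
      fun s _ => le_rfl
    rw [ContinuousMap.zero_apply, sub_zero]
    refine lt_of_le_of_lt (h1.trans (LpSpace.integral_seminorm_le hq γ t.2)) ?_
    simpa using hg
  exact ⟨⟨P₂, hcont⟩, hP₁⟩

end Primitives

/-! ### Charts of the mapping group -/

section MappingChart

variable {E G : Type*} [AddCommGroup E] [TopologicalSpace E]
  [Group G] [TopologicalSpace G] [IsTopologicalGroup G]
  {φ : OpenPartialHomeomorph G E} {η ζ : C(unitInterval, G)}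

theorem mem_mappingChart_source :
    ζ ∈ (mappingChart φ η).source ↔ ∀ t, (η t)⁻¹ * ζ t ∈ φ.source := by
  simp [mappingChart, postcompHomeo]

theorem mappingChart_apply (h : ζ ∈ (mappingChart φ η).source) (t : unitInterval) :
    mappingChart φ η ζ t = φ ((η t)⁻¹ * ζ t) := by
  have h' : ∀ t, (η⁻¹ * ζ) t ∈ φ.source := mem_mappingChart_source.1 h
  change (postcompHomeo unitInterval φ 1 0 (η⁻¹ * ζ)) t = _
  simp only [postcompHomeo, OpenPartialHomeomorph.coe_mk, dif_pos h']
  rfl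

end MappingChart

/-! ### Continuity of the evolution map, and its derivative at the origin -/

section EvolutionMap

universe u

variable {E : Type u} [AddCommGroup E] [Module ℝ E] [TopologicalSpace E]
  [IsTopologicalAddGroup E] [ContinuousSMul ℝ E] [LocallyConvexSpace ℝ E] [T2Space E]
  {G : Type*} [Group G] [TopologicalSpace G] [ChartedSpace E G]
  [IsTopologicalGroup G] [KellerLieGroup E G]
  {p : ℝ≥0∞} [hp : Fact (1 ≤ p)]

/-- The pointwise adjoint action of `ζ ∈ C([0,1], G)` on `L^p([0,1], 𝔤)`. -/
noncomputable def adjointOp (p : ℝ≥0∞) (ζ : C(unitInterval, G)) (v : LpSpace p E) : LpSpace p E :=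
  mulOp p (fun z (_ : E) => adjointAction E (ζ z.1) z.2) v 0

theorem continuousOn_adjointAction_path (ζ : C(unitInterval, G)) :
    ContinuousOn (fun z : (unitInterval × E) × E => adjointAction E (ζ z.1.1) z.1.2)
      {z | (z.1.1, z.2) ∈ (univ : Set (unitInterval × E))} :=
  (continuous_adjointAction.comp
    (f := fun z : (unitInterval × E) × E => (ζ z.1.1, z.1.2)) (by fun_prop)).continuousOn

theorem adjointOp_mk (ζ : C(unitInterval, G)) (γ : LpFun p E) :
    adjointOp p ζ (LpSpace.mk γ) = LpSpace.mk ⟨fun s => adjointAction E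
      (IccExtend zero_le_one ζ s) (γ.1 s), γ.2.adjointAction ζ.continuous.Icc_extend'⟩ :=
  mulOp_eq (Ω := univ) (continuousOn_adjointAction_path ζ)
    (fun _ _ _ _ => adjointAction_smul _ _ _) γ fun _ => mem_univ _

theorem adjointOp_smul (ζ : C(unitInterval, G)) (a : ℝ) (v : LpSpace p E) :
    adjointOp p ζ (a • v) = a • adjointOp p ζ v :=
  mulOp_smul (Ω := univ) (continuousOn_adjointAction_path ζ)
    (fun _ _ _ _ => adjointAction_smul _ _ _) a v fun _ => mem_univ _

theorem tendsto_adjointOp_zero (ζ : C(unitInterval, G)) :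
    Tendsto (fun v : LpSpace p E => adjointOp p ζ v) (𝓝 0) (𝓝 0) :=
  tendsto_mulOp_zero (Ω := univ) (continuousOn_adjointAction_path ζ)
    (fun _ _ _ _ => adjointAction_smul _ _ _) fun _ => mem_univ _

namespace LpSemiregular

theorem Evol_eq_mul (hG : LpSemiregular p E G) (g g' : LpSpace p E) :
    Evol p E G g' = Evol p E G (adjointOp p (Evol p E G g) (g' - g)) * Evol p E G g := by
  obtain ⟨γ, rfl⟩ := LpSpace.mk_surjective g
  obtain ⟨δ, rfl⟩ := LpSpace.mk_surjective g'
  have h := (hG.isEvolution δ).div (LpFun.memLusinLp_one δ) (LpFun.memLusinLp_one γ)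
    (hG.isEvolution γ)
  rw [← map_sub, adjointOp_mk]
  generalize Evol p E G (LpSpace.mk γ) = ζ at h ⊢
  generalize Evol p E G (LpSpace.mk δ) = η at h ⊢
  have h' : Evol p E G (LpSpace.mk ⟨fun s => adjointAction E (IccExtend zero_le_one ζ s)
      ((δ - γ).1 s), (δ - γ).2.adjointAction ζ.continuous.Icc_extend'⟩) = η * ζ⁻¹ := Evol_mk_eq h
  rw [h', inv_mul_cancel_right]

theorem Evol_zero (hG : LpSemiregular p E G) : Evol p E G 0 = 1 := by
  have h := hG.isEvolution (0 : LpFun p E)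
  rw [map_zero] at h
  exact h.eq_one (LpFun.memLusinLp_one _) (Eventually.of_forall fun _ => rfl)

theorem continuous_Evol (hG : LpSemiregular p E G) (hcont : ContinuousAt (Evol p E G) 0) :
    Continuous (Evol p E G) := by
  refine continuous_iff_continuousAt.2 fun g => ?_
  have h0 : Tendsto (fun g' : LpSpace p E => g' - g) (𝓝 g) (𝓝 0) := by
    have : Continuous fun g' : LpSpace p E => g' - g := by fun_prop
    simpa using this.tendsto g
  have h1 := (hcont.tendsto.comp ((tendsto_adjointOp_zero (Evol p E G g)).comp h0)).mul_const
    (Evol p E G g)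
  rw [hG.Evol_zero, one_mul] at h1
  exact h1.congr fun g' => (hG.Evol_eq_mul g g').symm

/-- The directional derivatives of the evolution map at `0` are the primitives. The chart
representation of `Evol (ε γ)` is a primitive of `ε • c (Evol (ε γ)) γ`, where `c` is Lipschitz
around `e` and `c e` is the identity; hence its difference quotients form a Cauchy sequence, which
also yields the existence of the primitive of `γ`. -/
theorem exists_hasDirDerivAt_Evol_zero (hG : LpSemiregular p E G) (hE : IsSeqComplete E)
    (hcont : ContinuousAt (Evol p E G) 0) :
    ∃ P : LpSpace p E →L[ℝ] C(unitInterval, E), ∀ g,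
      HasDirDerivAt (fun g => mappingChart (chartAt E (1 : G)) 1 (Evol p E G g)) 0 g (P g) := by
  set φ := chartAt E (1 : G) with hφ
  have hφa : φ ∈ atlas E G := chart_mem_atlas E 1
  have hφ1 : (1 : G) ∈ φ.source := mem_chart_source E 1
  have h1src : (1 : C(unitInterval, G)) ∈ (mappingChart φ 1).source :=
    mem_mappingChart_source.2 fun t => by simpa using hφ1
  have h1val : ∀ t, mappingChart φ 1 (1 : C(unitInterval, G)) t = φ 1 := fun t => by
    rw [mappingChart_apply h1src]; simp
  -- The Lipschitz estimate for `c x v`, the left translate of `v` by `φ⁻¹ x` in the chart `φ`.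
  have hlip : ∀ q : Seminorm ℝ E, Continuous q → ∃ r : Seminorm ℝ E, Continuous r ∧
      ∃ r' : Seminorm ℝ E, Continuous r' ∧ ∀ y ∈ φ.source, r (φ y - φ 1) < 1 →
        ∀ v, q (translDeriv φ y 1 v - v) ≤ r (φ y - φ 1) * r' v := by
    intro q hq
    have hΩ : IsOpen {z : Unit × E | z.2 ∈ φ.target} := φ.open_target.preimage continuous_snd
    have h1 : GroupSmoothOn E (fun (_ : Unit) (x : E) => φ.symm x) {z | z.2 ∈ φ.target} :=
      GroupSmoothOn.chart_symm hφa (ContinuousLinearMap.id ℝ E)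
    have h2 : GroupSmoothOn E (fun (_ : Unit) (_ : E) => (1 : G)) {z | z.2 ∈ φ.target} :=
      GroupSmoothOn.of_param (c := fun _ => (1 : G)) continuous_const _
    have h3 := (h1.translDeriv hΩ h2 hφa 1).mono
      (Ω' := {z : (Unit × E) × E | (z.1.1, z.2) ∈ {z : Unit × E | z.2 ∈ φ.target}})
      fun z hz => ⟨hz, by simpa using φ.map_target hz⟩
    obtain ⟨-, dc, hdc, -⟩ := h3
    obtain ⟨r, hr, r', hr', h⟩ := hdc.exists_lipschitz hΩ
      (fun z hz a v => translDeriv_smul hφa (by simpa using φ.map_target hz) a v)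
      (K := univ) isCompact_univ (y := fun _ => φ 1) continuousOn_const
      (fun _ _ => φ.map_source hφ1) q hq
    refine ⟨r, hr, r', hr', fun y hy hry v => ?_⟩
    have h4 := (h () (mem_univ _) (φ y) hry).2 v
    simp only at h4
    rwa [φ.left_inv hy, φ.left_inv hφ1, translDeriv_chartAt_one] at h4
  have key : ∀ γ : LpFun p E, ∃ v : C(unitInterval, E),
      (∀ t : unitInterval, IsWeakIntegral γ.1 0 t (v t)) ∧
      HasDirDerivAt (fun g => mappingChart φ 1 (Evol p E G g)) 0 (LpSpace.mk γ) v := by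
    intro γ
    set η : ℝ → C(unitInterval, G) := fun ε => Evol p E G (ε • LpSpace.mk γ) with hη
    have hηt : Tendsto η (𝓝[≠] 0) (𝓝 1) := by
      have hc : Continuous fun ε : ℝ => ε • (LpSpace.mk γ : LpSpace p E) := by fun_prop
      have h0 : Tendsto (fun ε : ℝ => ε • (LpSpace.mk γ : LpSpace p E)) (𝓝[≠] 0) (𝓝 0) := by
        simpa using (hc.tendsto 0).mono_left nhdsWithin_le_nhds
      have := hcont.tendsto.comp h0
      rwa [hG.Evol_zero] at this
    have hsrc : ∀ᶠ ε in 𝓝[≠] 0, η ε ∈ (mappingChart φ 1).source :=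
      hηt.eventually ((mappingChart φ 1).open_source.mem_nhds h1src)
    have hmem : ∀ {ε}, η ε ∈ (mappingChart φ 1).source → ∀ t, η ε t ∈ φ.source := fun h t => by
      simpa using mem_mappingChart_source.1 h t
    have hval : ∀ {ε}, η ε ∈ (mappingChart φ 1).source → ∀ t,
        mappingChart φ 1 (η ε) t = φ (η ε t) := fun h t => by
      rw [mappingChart_apply h]; simp
    have hx : Tendsto (fun ε => mappingChart φ 1 (η ε)) (𝓝[≠] 0) (𝓝 (mappingChart φ 1 1)) :=
      ((mappingChart φ 1).continuousAt h1src).tendsto.comp hηt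
    have hseq : Tendsto (fun n : ℕ => 1 / ((n : ℝ) + 1)) atTop (𝓝[≠] 0) :=
      tendsto_nhdsWithin_iff.2 ⟨tendsto_one_div_add_atTop_nhds_zero_nat,
        Eventually.of_forall fun n => (Nat.one_div_pos_of_nat (α := ℝ) (n := n)).ne'⟩
    obtain ⟨v, hv, hlim⟩ := exists_primitive_of_tendsto hE hseq (LpFun.memLusinLp_one γ)
      (δ := fun ε s => translDeriv φ (IccExtend zero_le_one (η ε) s) 1 (γ.1 s))
      (w := fun ε => ε⁻¹ • (mappingChart φ 1 (η ε) - mappingChart φ 1 1))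
      (by
        filter_upwards [hsrc] with ε hε
        exact (LpFun.memLusinLp_one γ).translDeriv (η ε).continuous.Icc_extend' hφa
          fun s _ => hmem hε _)
      (by
        filter_upwards [hsrc, self_mem_nhdsWithin] with ε hε hε0 t
        have hε0 : ε ≠ 0 := hε0
        have hev : IsEvolution (ε • γ).1 (η ε) := by
          have := hG.isEvolution (ε • γ)
          rwa [map_smul] at this
        have h1 := ((hev.hasACDerivOn (LpFun.memLusinLp_one _) hφa (hmem hε)).2 t t.2).smul ε⁻¹
        simp only [IccExtend_val, IccExtend_left] at h1
        have h2 : φ (η ε t) - φ (η ε ⟨0, left_mem_Icc.2 zero_le_one⟩) =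
            (mappingChart φ 1 (η ε) - mappingChart φ 1 1) t := by
          have h3 : η ε ⟨0, left_mem_Icc.2 zero_le_one⟩ = 1 := hev.1
          rw [ContinuousMap.sub_apply, hval hε, h1val, h3]
        rw [h2] at h1
        refine h1.congr_ae t.2.1 (Eventually.of_forall fun s => ?_)
        have h4 := translDeriv_smul hφa (h := IccExtend zero_le_one (η ε) s) (k := 1)
          (by rw [mul_one]; exact hmem hε _) ε (γ.1 s)
        change ε⁻¹ • translDeriv φ _ 1 (ε • γ.1 s) = _
        rw [h4, smul_smul, inv_mul_cancel₀ hε0, one_smul])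
      (by
        intro q hq
        obtain ⟨r, hr, r', hr', h⟩ := hlip q hq
        refine ⟨r', hr', fun ε' hε' => ?_⟩
        filter_upwards [hsrc, ContinuousMap.tendsto_nhds_iff_seminorm.1 hx r hr (min 1 ε')
          (lt_min one_pos hε')] with ε hε hsmall s _
        have h1 := hsmall (projIcc 0 1 zero_le_one s)
        rw [hval hε, h1val] at h1
        refine (h _ (hmem hε _) (h1.trans_le (min_le_left _ _)) _).trans ?_
        exact mul_le_mul_of_nonneg_right (h1.le.trans (min_le_right _ _)) (apply_nonneg _ _))
    refine ⟨v, hv, hlim.congr fun ε => ?_⟩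
    simp only [zero_add, hG.Evol_zero, hη]
  obtain ⟨P, hP⟩ := exists_primitive_clm fun γ : LpFun p E => (key γ).imp fun v hv => hv.1
  refine ⟨P, fun g => ?_⟩
  obtain ⟨γ, rfl⟩ := LpSpace.mk_surjective g
  obtain ⟨v, hv, hd⟩ := key γ
  have : P (LpSpace.mk γ) = v := ContinuousMap.ext fun t => (hP γ t).unique (hv t)
  rwa [this]

end LpSemiregular

end EvolutionMap

/-! ### Smoothness of the evolution map -/

section SmoothEvolution

universe u

variable {E : Type u} [AddCommGroup E] [Module ℝ E] [TopologicalSpace E]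
  [IsTopologicalAddGroup E] [ContinuousSMul ℝ E] [LocallyConvexSpace ℝ E] [T2Space E]
  {G : Type*} [Group G] [TopologicalSpace G] [ChartedSpace E G]
  [IsTopologicalGroup G] [KellerLieGroup E G]
  {p : ℝ≥0∞} [hp : Fact (1 ≤ p)]

/-- A continuous solution `S` of a differential equation `dS(g, v) = Ψ (S g, v)` is of class `C^k` for
all `k` if the right-hand side can be chosen of class `C^k` for all `k`. -/
theorem ParamCk.of_hasDirDerivAt {X Y : Type u} [AddCommGroup X] [Module ℝ X] [TopologicalSpace X]
    [IsTopologicalAddGroup X] [ContinuousSMul ℝ X] [AddCommGroup Y] [Module ℝ Y]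
    [TopologicalSpace Y] [IsTopologicalAddGroup Y] [ContinuousSMul ℝ Y] [LocallyConvexSpace ℝ Y]
    {S : X → Y} {V : Set X} {Ω : Set (Unit × (Y × X))} (hΩ : IsOpen Ω)
    (hS : ContinuousOn S V) (hSΩ : ∀ g ∈ V, ∀ v, ((), (S g, v)) ∈ Ω)
    (h : ∀ k, ∃ Ψ : Y × X → Y, ParamCk k (fun (_ : Unit) z => Ψ z) Ω ∧
      ∀ g ∈ V, ∀ v, HasDirDerivAt S g v (Ψ (S g, v))) (k : ℕ) :
    ParamCk k (fun (_ : Unit) g => S g) {z | z.2 ∈ V} := by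
  have hc : ContinuousOn (fun z : Unit × X => S z.2) {z | z.2 ∈ V} :=
    hS.comp continuousOn_snd fun z hz => hz
  induction k with
  | zero => exact hc
  | succ k ih =>
    obtain ⟨Ψ, hΨ, hd⟩ := h k
    have e1 : ParamCk k (fun (_ : Unit) (z : X × X) => S z.1) (tangentDomain {z | z.2 ∈ V}) :=
      ih.comp_clm continuous_id (ContinuousLinearMap.fst ℝ X X) fun z hz => hz
    have e2 : ParamCk k (fun (_ : Unit) (z : X × X) => Ψ (S z.1, z.2))
        (tangentDomain {z | z.2 ∈ V}) :=
      hΨ.comp hΩ continuous_id (e1.prodMk (ParamCk.clm k (ContinuousLinearMap.snd ℝ X X) _))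
        fun z hz => hSΩ _ hz _
    exact ⟨hc, fun _ z => Ψ (S z.1, z.2), ⟨fun z hz v => hd _ hz v, e2.continuousOn⟩, e2⟩

theorem groupSmoothOn_mul_chart_symm {φ : OpenPartialHomeomorph G E} (hφ : φ ∈ atlas E G)
    (η : C(unitInterval, G)) :
    GroupSmoothOn E (fun t (y : E) => η t * φ.symm y)
      {z : unitInterval × E | z.2 ∈ φ.target} := by
  have hΩ : IsOpen {z : unitInterval × E | z.2 ∈ φ.target} :=
    φ.open_target.preimage continuous_snd
  exact (GroupSmoothOn.of_param η.continuous _).mul hΩ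
    (GroupSmoothOn.chart_symm hφ (ContinuousLinearMap.id ℝ E))

/-- The operator `(y, v) ↦ Ad(η φ⁻¹(y)) v` from `C([0,1], E) × L^p` to `L^p`, followed by a continuous
linear operator, is smooth. -/
theorem ParamCk.adjoint_chart {φ : OpenPartialHomeomorph G E} (hφ : φ ∈ atlas E G)
    (η : C(unitInterval, G)) (P : LpSpace p E →L[ℝ] C(unitInterval, E)) (k : ℕ) :
    ParamCk k (fun (_ : Unit) (z : C(unitInterval, E) × LpSpace p E) =>
      P (_root_.mulOp p (fun w x => adjointAction E (η w.1 * φ.symm x) w.2) z.2 z.1))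
      {z | ∀ t, z.2.1 t ∈ φ.target} := by
  have hΩ : IsOpen {z : unitInterval × E | z.2 ∈ φ.target} :=
    φ.open_target.preimage continuous_snd
  have h1 := groupSmoothOn_mul_chart_symm hφ η
  have hb : ∀ k, ParamCk k (fun (w : unitInterval × E) x =>
      adjointAction E (η w.1 * φ.symm x) w.2)
      {z | (z.1.1, z.2) ∈ {z : unitInterval × E | z.2 ∈ φ.target}} := fun k =>
    (h1.translDeriv hΩ (h1.inv hΩ) (chart_mem_atlas E (1 : G)) k).mono fun z hz => ⟨hz, by simp⟩
  have hadd : ∀ z ∈ {z : unitInterval × E | z.2 ∈ φ.target}, ∀ v v',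
      adjointAction E (η z.1 * φ.symm z.2) (v + v') = adjointAction E (η z.1 * φ.symm z.2) v +
        adjointAction E (η z.1 * φ.symm z.2) v' := fun z _ v v' => adjointAction_add _ _ _
  have hsmul : ∀ z ∈ {z : unitInterval × E | z.2 ∈ φ.target}, ∀ (a : ℝ) v,
      adjointAction E (η z.1 * φ.symm z.2) (a • v) =
        a • adjointAction E (η z.1 * φ.symm z.2) v := fun z _ a v => adjointAction_smul _ _ _
  have h2 := ((hb (k + 1)).mulOp (p := p) hΩ hadd hsmul).clm_comp P
  have hO : IsOpen {z : Unit × C(unitInterval, E) | ∀ t, z.2 t ∈ φ.target} :=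
    (isOpen_setOf_forall_mem hΩ).preimage continuous_snd
  refine (h2.comp_param (τ := fun s : Unit × LpSpace p E => s.2) continuous_snd
    fun z hz => hz).prod_of_param hO (fun z hz v v' => ?_) fun z hz a v => ?_
  · exact (congrArg P (mulOp_add (Ω := {z : unitInterval × E | z.2 ∈ φ.target})
      (hb 0).continuousOn hadd hsmul v v' hz)).trans (map_add P _ _)
  · exact (congrArg P (mulOp_smul (Ω := {z : unitInterval × E | z.2 ∈ φ.target})
      (hb 0).continuousOn hsmul a v hz)).trans (map_smul P _ _)

/-- In a chart, the evolution map is a continuous solution of a differential equation with smooth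
right-hand side, and `ParamCk.of_hasDirDerivAt` applies. The right-hand side is the derivative of
`(y, ξ) ↦ φ(η⁻¹ φ₀⁻¹(ξ) η φ⁻¹(y))` with respect to `ξ`, in the direction of the primitive of
`Ad(η φ⁻¹(y)) v`. -/
theorem LpSemiregular.kellerSmoothOn_Evol (hG : LpSemiregular p E G) (hE : IsSeqComplete E)
    (hcont : ContinuousAt (Evol p E G) 0) {φ : OpenPartialHomeomorph G E} (hφ : φ ∈ atlas E G)
    (η : C(unitInterval, G)) :
    KellerSmoothOn (fun g => mappingChart φ η (Evol p E G g))
      {g | Evol p E G g ∈ (mappingChart φ η).source} := by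
  have hEvol := hG.continuous_Evol hcont
  set V := {g : LpSpace p E | Evol p E G g ∈ (mappingChart φ η).source} with hVdef
  have hV : IsOpen V := (mappingChart φ η).open_source.preimage hEvol
  obtain ⟨P, hP⟩ := hG.exists_hasDirDerivAt_Evol_zero hE hcont
  set φ₀ := chartAt E (1 : G) with hφ₀
  set S : LpSpace p E → C(unitInterval, E) := fun g => mappingChart φ η (Evol p E G g) with hS
  set x₀ : C(unitInterval, E) := mappingChart φ₀ 1 1 with hx₀
  have h1src : (1 : C(unitInterval, G)) ∈ (mappingChart φ₀ 1).source :=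
    mem_mappingChart_source.2 fun t => by simp [hφ₀]
  have hx₀t : ∀ t, x₀ t = φ₀ 1 := fun t => by rw [hx₀, mappingChart_apply h1src]; simp
  -- `F t (y, ξ) = φ(η(t)⁻¹ φ₀⁻¹(ξ) η(t) φ⁻¹(y))`
  have hΩ : IsOpen {z : unitInterval × E | z.2 ∈ φ.target} :=
    φ.open_target.preimage continuous_snd
  have hη' : GroupSmoothOn E (fun t (_ : E) => (η t)⁻¹)
      {z : unitInterval × E | z.2 ∈ φ.target} := GroupSmoothOn.of_param η.continuous.inv _
  obtain ⟨hW, hF⟩ := hη'.transl hΩ (groupSmoothOn_mul_chart_symm hφ η) hφ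
  set W := translDomain φ (fun t (_ : E) => (η t)⁻¹) (fun t (y : E) => η t * φ.symm y)
    {z : unitInterval × E | z.2 ∈ φ.target} with hWdef
  set F : unitInterval → E × E → E := fun t z =>
    φ ((η t)⁻¹ * φ₀.symm z.2 * (η t * φ.symm z.1)) with hFdef
  set L := ContinuousMap.pairL unitInterval E E with hL
  set Ω : Set (Unit × (C(unitInterval, E) × C(unitInterval, E))) :=
    {z | ∀ t, (t, L z.2 t) ∈ W} with hΩdef
  have hΩo : IsOpen Ω := (isOpen_setOf_forall_mem hW).preimage (by fun_prop :
    Continuous fun z : Unit × (C(unitInterval, E) × C(unitInterval, E)) => L z.2)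
  have hFk : ∀ k, ParamCk k (fun (_ : Unit) (z : C(unitInterval, E) × C(unitInterval, E)) =>
      superposition F (L z)) Ω := fun k =>
    ((hF k).superposition hW).comp_clm continuous_id L fun z hz => hz
  -- Values of `S` and of the argument of `F`.
  have hSt : ∀ g ∈ V, ∀ t, S g t ∈ φ.target ∧ η t * φ.symm (S g t) = Evol p E G g t := by
    intro g hg t
    have h1 := mem_mappingChart_source.1 hg t
    rw [hS]
    simp only
    rw [mappingChart_apply hg, φ.left_inv h1]
    exact ⟨φ.map_source h1, by simp⟩
  have hSΩ : ∀ g ∈ V, ((), (S g, x₀)) ∈ Ω := by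
    intro g hg t
    have h1 := hSt g hg t
    have h2 : L (S g, x₀) t = (S g t, φ₀ 1) := by rw [hL, ContinuousMap.pairL_apply, hx₀t]
    rw [h2]
    refine mem_translDomain h1.1 ?_
    rw [h1.2]
    exact mem_mappingChart_source.1 hg t
  set J : LpSpace p E → C(unitInterval, E) → C(unitInterval, E) := fun v y =>
    P (mulOp p (fun w x => adjointAction E (η w.1 * φ.symm x) w.2) v y) with hJ
  have hJS : ∀ g ∈ V, ∀ v, J v (S g) = P (adjointOp p (Evol p E G g) v) := by
    intro g hg v
    simp only [hJ, adjointOp, mulOp]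
    congr 2
    funext s
    rw [(hSt g hg _).2]
  have hdS : ∀ {dF : Unit → (C(unitInterval, E) × C(unitInterval, E)) ×
      (C(unitInterval, E) × C(unitInterval, E)) → C(unitInterval, E)},
      HasContDirDerivOn (fun (_ : Unit) (z : C(unitInterval, E) × C(unitInterval, E)) =>
        superposition F (L z)) dF Ω →
      ∀ g ∈ V, ∀ v, HasDirDerivAt S g v (dF () ((S g, x₀), (0, J v (S g)))) := by
    intro dF hdF g hg v
    set u := adjointOp p (Evol p E G g) v with hu
    have hE0 : mappingChart φ₀ 1 (Evol p E G (0 : LpSpace p E)) = x₀ := by rw [hG.Evol_zero]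
    have h1 : HasDirDerivAt (fun w => (S g, mappingChart φ₀ 1 (Evol p E G w))) 0 u (0, P u) :=
      (hasDirDerivAt_const _ _ _).prodMk (hP u)
    have h2 := hdF.comp_hasDirDerivAt (t := ()) hΩo (by rw [hE0]; exact hSΩ g hg) h1
    rw [hE0, ← hJS g hg v] at h2
    have hsmall : Tendsto (fun ε : ℝ => ε • u) (𝓝 0) (𝓝 0) := by
      have : Continuous fun ε : ℝ => ε • u := by fun_prop
      simpa using this.tendsto 0
    have hsmall' : Tendsto (fun ε : ℝ => g + ε • v) (𝓝 0) (𝓝 g) := by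
      have : Continuous fun ε : ℝ => g + ε • v := by fun_prop
      simpa using this.tendsto 0
    have ev1 : ∀ᶠ ε : ℝ in 𝓝 0, Evol p E G (ε • u) ∈ (mappingChart φ₀ 1).source := by
      refine hsmall.eventually (hEvol.continuousAt.eventually_mem
        ((mappingChart φ₀ 1).open_source.mem_nhds ?_))
      rw [hG.Evol_zero]
      exact h1src
    have key : ∀ᶠ ε : ℝ in 𝓝 0, S (g + ε • v) =
        superposition F (L (S g, mappingChart φ₀ 1 (Evol p E G (ε • u)))) := by
      filter_upwards [ev1, hsmall'.eventually (hV.mem_nhds hg)] with ε h3 h4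
      have h5 : Evol p E G (g + ε • v) = Evol p E G (ε • u) * Evol p E G g := by
        rw [hG.Evol_eq_mul g, add_sub_cancel_left, adjointOp_smul]
      have h6 : ∀ t, Evol p E G (ε • u) t ∈ φ₀.source := fun t => by
        simpa using mem_mappingChart_source.1 h3 t
      have h7 : ∀ t, L (S g, mappingChart φ₀ 1 (Evol p E G (ε • u))) t =
          (S g t, φ₀ (Evol p E G (ε • u) t)) := fun t => by
        rw [hL, ContinuousMap.pairL_apply, mappingChart_apply h3]; simp
      have h8 : ∀ t, (η t)⁻¹ * φ₀.symm (φ₀ (Evol p E G (ε • u) t)) * (η t * φ.symm (S g t)) =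
          (η t)⁻¹ * Evol p E G (g + ε • v) t := fun t => by
        rw [(hSt g hg t).2, φ₀.left_inv (h6 t), h5, mul_assoc]
        rfl
      have h9 : ∀ t, (t, L (S g, mappingChart φ₀ 1 (Evol p E G (ε • u))) t) ∈ W := fun t => by
        rw [h7]
        refine ⟨⟨(hSt g hg t).1, φ₀.map_source (h6 t)⟩, ?_⟩
        change (η t)⁻¹ * φ₀.symm (φ₀ (Evol p E G (ε • u) t)) * (η t * φ.symm (S g t)) ∈ φ.source
        rw [h8]
        exact mem_mappingChart_source.1 h4 t
      ext t
      rw [superposition_apply (hF 0) h9 t, h7, hS]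
      simp only
      rw [mappingChart_apply h4, hFdef]
      simp only
      rw [h8]
    have key0 := key.self_of_nhds
    rw [zero_smul, zero_smul, add_zero] at key0
    refine Tendsto.congr' ?_ h2
    filter_upwards [key.filter_mono nhdsWithin_le_nhds] with ε hε
    rw [zero_add, ← hε, ← key0]
  have hJo : IsOpen {z : Unit × (C(unitInterval, E) × LpSpace p E) |
      ∀ t, z.2.1 t ∈ φ.target} :=
    (isOpen_setOf_forall_mem hΩ).preimage (by fun_prop :
      Continuous fun z : Unit × (C(unitInterval, E) × LpSpace p E) => z.2.1)
  refine ParamCk.kellerSmoothOn hV fun k => ?_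
  refine ParamCk.of_hasDirDerivAt (Ω := {z : Unit × (C(unitInterval, E) × LpSpace p E) |
    ((), (z.2.1, x₀)) ∈ Ω ∧ ∀ t, z.2.1 t ∈ φ.target}) (hΩo.preimage (by fun_prop) |>.inter hJo)
    ((mappingChart φ η).continuousOn.comp hEvol.continuousOn fun g hg => hg)
    (fun g hg v => ⟨hSΩ g hg, fun t => (hSt g hg t).1⟩) (fun k => ?_) k
  obtain ⟨-, dF, hdF, hdFk⟩ := hFk (k + 1)
  refine ⟨fun z => dF () ((z.1, x₀), (0, J z.2 z.1)), ?_, hdS hdF⟩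
  have e1 : ParamCk k (fun (_ : Unit) (z : C(unitInterval, E) × LpSpace p E) => z.1)
      {z | ((), (z.2.1, x₀)) ∈ Ω ∧ ∀ t, z.2.1 t ∈ φ.target} :=
    ParamCk.clm k (ContinuousLinearMap.fst ℝ C(unitInterval, E) (LpSpace p E)) _
  have e2 : ParamCk k (fun (_ : Unit) (z : C(unitInterval, E) × LpSpace p E) => J z.2 z.1)
      {z | ((), (z.2.1, x₀)) ∈ Ω ∧ ∀ t, z.2.1 t ∈ φ.target} :=
    (ParamCk.adjoint_chart hφ η P k).mono fun z hz => hz.2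
  exact hdFk.comp hΩo.tangentDomain (τ := fun _ : Unit => ()) continuous_const
    ((e1.prodMk (ParamCk.of_param k continuousOn_const)).prodMk
      ((ParamCk.of_param k continuousOn_const).prodMk e2)) fun z hz => hz.1

end SmoothEvolution

theorem theoremE {E : Type*} [AddCommGroup E] [Module ℝ E] [TopologicalSpace E]
    [IsTopologicalAddGroup E] [ContinuousSMul ℝ E] [LocallyConvexSpace ℝ E] [T2Space E]
    (hE : IsSeqComplete E)
    {G : Type*} [Group G] [TopologicalSpace G] [IsTopologicalGroup G] [T2Space G]
    [ChartedSpace E G] [KellerLieGroup E G]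
    (p : ℝ≥0∞) [Fact (1 ≤ p)]
    (hsemi : LpSemiregular p E G) (hcont : ContinuousAt (Evol p E G) 0) :
    LpRegular p E G := by
  refine ⟨hsemi, hsemi.continuous_Evol hcont, ?_⟩
  rintro φ hφ ψ ⟨φ', hφ', -, η, rfl⟩
  rw [chartedSpaceSelf_atlas] at hφ
  subst hφ
  change KellerSmoothOn (fun g => mappingChart φ' η (Evol p E G g))
    (univ ∩ {g | Evol p E G g ∈ (mappingChart φ' η).source})
  rw [univ_inter]
  exact hsemi.kellerSmoothOn_Evol hE hcont hφ' η
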